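/- **Setting.** Let $n\ge 1$, $E_n=\{0,1\}^n\setminus\{0\}$. Let $\Phi:\mathbb R\to[0,1]$ be an even $C^\infty$ function, supported in $[-\frac{4\pi}3,\frac{4\pi}3]$ and equal to $1$ on $[-\frac{2\pi}3,\frac{2\pi}3]$, such that $\varphi(\xi)=(\Phi(\xi/2)^2-\Phi(\xi)^2)^{1/2}$ is $C^\infty$ and $\varphi(\xi)^2+\varphi(2\pi-\xi)^2=1$ for $\frac{2\pi}3\le\xi\le\frac{4\pi}3$. With $\hat f(\xi)=\int f(x)e^{-ix\cdot\xi}\,dx$, $\phi^0=\Phi$ and $\phi^1(\xi)=e^{-i\xi/2}\varphi(\xi)$ on the frequency side, let $\phi^\epsilon$ ($\epsilon\in\{0,1\}^n$) be the Schwartz function on $\mathbb R^n$ with $\widehat{\phi^{\epsilon}}(\xi)=\prod_{i=1}^n\phi^{\epsilon_i}(\xi_i)$, and put $\phi^\epsilon_{j,k}(x)=2^{nj/2}\phi^\epsilon(2^jx-k)$ for $j\in\mathbb Z$, $k\in\mathbb Z^n$ (Meyer wavelets). For a tempered distribution $f$ put $f^\epsilon_{j,k}=\langle f,\phi^\epsilon_{j,k}\rangle$,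 $P_jf=\sum_k f^0_{j,k}\phi^0_{j,k}$ and, for $\epsilon\in E_n$, $Q^\epsilon_jf=\sum_k f^\epsilon_{j,k}\phi^\epsilon_{j,k}$. **Flow space.** A flow is a family $f(t)$, $t>0$, of tempered distributions on $\mathbb R^n$ that is weakly measurable in $t$ (that is, $t\mapsto\langle f(t),\psi\rangle$ is Lebesgue measurable for every Schwartz function $\psi$) and satisfies $f(t)=\sum_{\epsilon\in E_n,\,j\in\mathbb Z,\,k\in\mathbb Z^n}f^\epsilon_{j,k}(t)\,\phi^\epsilon_{j,k}$ for every $t>0$ (unconditional convergence against every Schwartz function), where $f^\epsilon_{j,k}(t)=\langle f(t),\phi^\epsilon_{j,k}\rangle$. Let $\chi$ be the characteristic function of $[0,1]^n$ and, for $j,j_t\in\mathbb Z$ and $a\in\mathbb R$, put $$f_{j,j_t}(x)=\sup_{2^{-2j_t}\le t<2^{2-2j_t}}2^{nj/2}\sum_{\epsilon\in E_n,\,k\in\mathbb Z^n}|f^\epsilon_{j,k}(t)|\,\chi(2^jx-k),$$ $$A^{p,a}_{j,j_t}=2^{2(j-j_t)a}\,2^{j(\frac np-1)}\sup_{\lambda>0}\lambda\,|\{x:f_{j,j_t}(x)>\lambda\}|^{1/p}.$$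 The flow $f$ belongs to ${}^{m'}_{m}\dot B^{\frac np-1,q}_{p,\infty}$ if $$\sup_{j_t\in\mathbb Z}\Big(\sum_{j\ge j_t}(A^{p,m}_{j,j_t})^q+\sum_{j<j_t}(A^{p,m'}_{j,j_t})^q\Big)<\infty\quad(1\le q<\infty),$$ $$\sup_{j_t\in\mathbb Z,\,j\ge j_t}A^{p,m}_{j,j_t}+\sup_{j_t\in\mathbb Z,\,j<j_t}A^{p,m'}_{j,j_t}<\infty\quad(q=\infty).$$ **Theorem 1.2.** Let $\epsilon\in E_n$, $l,l',l''\in\{1,\dots,n\}$, $1<p<\infty$, $1\le q\le\infty$, $0\le m'<\frac12$ and $m>1$. If $u,v\in{}^{m'}_{m}\dot B^{\frac np-1,q}_{p,\infty}$, then the paraproduct flows $$P_l(u,v)(t)=\int_0^te^{(t-s)\Delta}\partial_{x_l}\Big(\sum_{j\in\mathbb Z}P_{j-2}u(s)\,Q^\epsilon_jv(s)\Big)ds,$$ $$P_{l,l',l''}(u,v)(t)=\int_0^te^{(t-s)\Delta}\partial_{x_l}\partial_{x_{l'}}\partial_{x_{l''}}(-\Delta)^{-1}\Big(\sum_{j\in\mathbb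 Z}P_{j-2}u(s)\,Q^\epsilon_jv(s)\Big)ds$$ are well defined and belong to ${}^{m'}_{m}\dot B^{\frac np-1,q}_{p,\infty}$. Here the series over $j$ converges absolutely at every point, for every $s>0$. The operators $A_\tau=e^{\tau\Delta}\partial_{x_l}$ and $A_\tau=e^{\tau\Delta}\partial_{x_l}\partial_{x_{l'}}\partial_{x_{l''}}(-\Delta)^{-1}$ ($\tau>0$) are the Fourier multipliers with symbols $i\xi_l e^{-\tau|\xi|^2}$ and $(i\xi_l)(i\xi_{l'})(i\xi_{l''})|\xi|^{-2}e^{-\tau|\xi|^2}$, acting on functions $F$ by $\langle A_\tau F,\psi\rangle=\int F\,A_\tau^{\mathsf T}\psi\,dx$ with $A_\tau^{\mathsf T}$ the transposed multiplier. The integrals over $x$ and over $s\in(0,t)$ converge absolutely when tested against any Schwartz function $\psi$. -/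

import Mathlib

open MeasureTheory Set
open scoped ENNReal NNReal SchwartzMap FourierTransform ContDiff

noncomputable section

namespace BesovLorentz

/-- `ℝⁿ` with its Euclidean norm. -/
abbrev Eucl (n : ℕ) : Type := EuclideanSpace ℝ (Fin n)

/-! ### Meyer wavelets -/

/-- The band function `φ(ξ) = (Φ(ξ/2)² - Φ(ξ)²)^{1/2}` attached to a function `Φ` on the line. -/
def band (Φ : ℝ → ℝ) (ξ : ℝ) : ℝ := √(Φ (ξ / 2) ^ 2 - Φ ξ ^ 2)

/-- The generating function `Φ = φ⁰` of a system of Meyer wavelets (on the frequency side, for the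
convention `f̂(ξ) = ∫ f(x) e^{-ixξ} dx`): an even smooth function with support in
`[-4π/3, 4π/3]`, equal to `1` on `[-2π/3, 2π/3]`, with values in `[0, 1]`, whose band function
is smooth and satisfies `φ(ξ)² + φ(2π - ξ)² = 1` on `[2π/3, 4π/3]`. -/
structure MeyerFunction where
  /-- the function `Φ` -/
  Φ : ℝ → ℝ
  smooth : ContDiff ℝ ∞ Φ
  even : ∀ ξ, Φ (-ξ) = Φ ξ
  support_subset : ∀ ξ, Φ ξ ≠ 0 → |ξ| ≤ 4 * Real.pi / 3
  eq_one : ∀ ξ, |ξ| ≤ 2 * Real.pi / 3 → Φ ξ = 1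
  nonneg : ∀ ξ, 0 ≤ Φ ξ
  le_one : ∀ ξ, Φ ξ ≤ 1
  band_smooth : ContDiff ℝ ∞ (band Φ)
  band_sq_add : ∀ ξ, 2 * Real.pi / 3 ≤ ξ → ξ ≤ 4 * Real.pi / 3 →
    band Φ ξ ^ 2 + band Φ (2 * Real.pi - ξ) ^ 2 = 1

namespace MeyerFunction

variable (M : MeyerFunction)

/-- The one-dimensional symbols `φ⁰(ξ) = Φ(ξ)` and `φ¹(ξ) = e^{-iξ/2} φ(ξ)`. -/
def symbol (e : Fin 2) (ξ : ℝ) : ℂ :=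
  if e = 0 then (M.Φ ξ : ℂ) else Complex.exp (-(Complex.I * ξ / 2)) * (band M.Φ ξ : ℂ)

/-- The function `∏ᵢ φ^{εᵢ}(2π ηᵢ)`. The factor `2π` translates the convention
`f̂(ξ) = ∫ f(x) e^{-ixξ} dx` into that of Mathlib, `𝓕 f(η) = ∫ f(x) e^{-2πi xη} dx = f̂(2πη)`. -/
def symbolProd {n : ℕ} (ε : Fin n → Fin 2) (η : Eucl n) : ℂ :=
  ∏ i, M.symbol (ε i) (2 * Real.pi * η i)

theorem symbol_eq_zero (e : Fin 2) {ξ : ℝ} (h : 8 * Real.pi / 3 < |ξ|) : M.symbol e ξ = 0 := by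
  have hpi := Real.pi_pos
  have h1 : M.Φ ξ = 0 := by
    by_contra hne
    have := M.support_subset ξ hne
    linarith
  have h2 : M.Φ (ξ / 2) = 0 := by
    by_contra hne
    have := M.support_subset _ hne
    rw [abs_div, abs_two] at this
    linarith
  unfold symbol band
  simp [h1, h2]

theorem symbol_smooth (e : Fin 2) : ContDiff ℝ ∞ (M.symbol e) := by
  unfold symbol
  by_cases he : e = 0
  · simp only [he, if_true]
    exact Complex.ofRealCLM.contDiff.comp M.smooth
  · simp only [he, if_false]
    refine ContDiff.mul ?_ (Complex.ofRealCLM.contDiff.comp M.band_smooth)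
    refine ContDiff.cexp (ContDiff.neg (ContDiff.div_const (contDiff_const.mul ?_) 2))
    exact Complex.ofRealCLM.contDiff

theorem symbolProd_smooth {n : ℕ} (ε : Fin n → Fin 2) : ContDiff ℝ ∞ (M.symbolProd ε) := by
  unfold symbolProd
  refine contDiff_prod fun i _ => (M.symbol_smooth (ε i)).comp ?_
  exact contDiff_const.mul (EuclideanSpace.proj (𝕜 := ℝ) i).contDiff

theorem symbolProd_hasCompactSupport {n : ℕ} (ε : Fin n → Fin 2) :
    HasCompactSupport (M.symbolProd ε) := by
  have hK : IsCompact ((EuclideanSpace.equiv (Fin n) ℝ).symm ''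
      (Set.univ.pi fun _ : Fin n => Set.Icc (-(4 / 3 : ℝ)) (4 / 3))) :=
    (isCompact_univ_pi fun _ => isCompact_Icc).image
      (EuclideanSpace.equiv (Fin n) ℝ).symm.continuous
  refine HasCompactSupport.intro hK fun η hη => ?_
  by_contra hne
  refine hη ⟨EuclideanSpace.equiv (Fin n) ℝ η, fun i _ => ?_, by simp⟩
  have hi : M.symbol (ε i) (2 * Real.pi * η i) ≠ 0 :=
    (Finset.prod_ne_zero_iff.mp hne) i (Finset.mem_univ i)
  have hle : |2 * Real.pi * η i| ≤ 8 * Real.pi / 3 := by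
    by_contra hlt
    exact hi (M.symbol_eq_zero _ (not_le.mp hlt))
  have hpi := Real.pi_pos
  rw [abs_mul, abs_of_pos (by positivity : (0 : ℝ) < 2 * Real.pi)] at hle
  have h3 : |η i| ≤ 4 / 3 := by
    by_contra hlt
    nlinarith [not_le.mp hlt]
  exact ⟨(abs_le.mp h3).1, (abs_le.mp h3).2⟩

/-- The Schwartz function `φ^ε` on `ℝⁿ` whose Fourier transform is `∏ᵢ φ^{εᵢ}(ξᵢ)`. -/
def mother {n : ℕ} (ε : Fin n → Fin 2) : 𝓢(Eucl n, ℂ) :=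
  𝓕⁻ ((M.symbolProd_hasCompactSupport ε).toSchwartzMap (M.symbolProd_smooth ε))

/-- `φ^ε_{j,k}(x) = 2^{nj/2} φ^ε(2^j x - k)`, as a Schwartz function. -/
def wavelet {n : ℕ} (ε : Fin n → Fin 2) (j : ℤ) (k : Fin n → ℤ) : 𝓢(Eucl n, ℂ) :=
  (((2 : ℝ) ^ ((n : ℝ) * j / 2) : ℝ) : ℂ) •
    SchwartzMap.compCLMOfContinuousLinearEquiv ℂ
      (ContinuousLinearEquiv.smulLeft (Units.mk0 ((2 : ℝ) ^ j) (zpow_ne_zero j two_ne_zero)))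
      (SchwartzMap.compSubConstCLM ℂ (WithLp.toLp 2 fun i => (k i : ℝ)) (M.mother ε))

theorem wavelet_apply {n : ℕ} (ε : Fin n → Fin 2) (j : ℤ) (k : Fin n → ℤ) (x : Eucl n) :
    M.wavelet ε j k x = (((2 : ℝ) ^ ((n : ℝ) * j / 2) : ℝ) : ℂ) *
      M.mother ε ((2 : ℝ) ^ j • x - WithLp.toLp 2 fun i => (k i : ℝ)) := by
  rfl

end MeyerFunction

/-! ### Wavelet coefficients and projections -/

section

variable {n : ℕ} (M : MeyerFunction)

/-- The index set `E_n = {0,1}ⁿ \ {0}`. -/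
abbrev Dir (n : ℕ) : Type := {ε : Fin n → Fin 2 // ε ≠ 0}

/-- The coefficient `f^ε_{j,k} = ⟨f, φ^ε_{j,k}⟩` of a tempered distribution (the functions
`φ^ε_{j,k}` are real-valued, so that no complex conjugate is needed). -/
def coeff (f : 𝓢'(Eucl n, ℂ)) (ε : Fin n → Fin 2) (j : ℤ) (k : Fin n → ℤ) : ℂ :=
  f (M.wavelet ε j k)

/-- `∑_k f^ε_{j,k} φ^ε_{j,k}(x)`: this is `P_j f(x)` for `ε = 0` and `Q^ε_j f(x)` for `ε ≠ 0`.
The coefficients grow at most polynomially in `k`, so that the series converges absolutely. -/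
def proj (f : 𝓢'(Eucl n, ℂ)) (ε : Fin n → Fin 2) (j : ℤ) (x : Eucl n) : ℂ :=
  ∑' k : Fin n → ℤ, coeff M f ε j k * M.wavelet ε j k x

/-- The `j`-th term `P_{j-2}f(x) Q^ε_j g(x)` of the paraproduct. -/
def paraTerm (ε : Fin n → Fin 2) (f g : 𝓢'(Eucl n, ℂ)) (x : Eucl n) (j : ℤ) : ℂ :=
  proj M f 0 (j - 2) x * proj M g ε j x

/-- The paraproduct `∑_j P_{j-2}f Q^ε_j g`. -/
def paraproduct (ε : Fin n → Fin 2) (f g : 𝓢'(Eucl n, ℂ)) (x : Eucl n) : ℂ :=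
  ∑' j : ℤ, paraTerm M ε f g x j

/-! ### The flow space -/

/-- The dyadic cube `{x : 2^j x - k ∈ [0,1]ⁿ}`. -/
def cube (j : ℤ) (k : Fin n → ℤ) : Set (Eucl n) :=
  {x | ∀ i, (2 : ℝ) ^ j * x i - k i ∈ Icc (0 : ℝ) 1}

/-- `f_j(t,x) = 2^{nj/2} ∑_{ε ∈ E_n, k} |f^ε_{j,k}(t)| χ(2^j x - k)`. -/
def level (f : ℝ → 𝓢'(Eucl n, ℂ)) (j : ℤ) (t : ℝ) (x : Eucl n) : ℝ≥0∞ :=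
  (2 : ℝ≥0∞) ^ ((n : ℝ) * j / 2) *
    ∑' γ : Dir n × (Fin n → ℤ),
      (cube j γ.2).indicator (fun _ => ‖coeff M (f t) γ.1 j γ.2‖ₑ) x

/-- `f_{j,j_t}(x) = sup { f_j(t,x) : 2^{-2j_t} ≤ t < 2^{2-2j_t} }`. -/
def ringLevel (f : ℝ → 𝓢'(Eucl n, ℂ)) (j jt : ℤ) (x : Eucl n) : ℝ≥0∞ :=
  ⨆ t ∈ Ico ((2 : ℝ) ^ (-2 * jt)) ((2 : ℝ) ^ (2 - 2 * jt)), level M f j t x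

/-- `A^{p,a}_{j,j_t} = 2^{2(j-j_t)a} 2^{j(n/p-1)} sup_{λ>0} λ |{x : f_{j,j_t}(x) > λ}|^{1/p}`. -/
def ringNorm (p a : ℝ) (f : ℝ → 𝓢'(Eucl n, ℂ)) (j jt : ℤ) : ℝ≥0∞ :=
  (2 : ℝ≥0∞) ^ (2 * ((j : ℝ) - jt) * a) * (2 : ℝ≥0∞) ^ ((j : ℝ) * (n / p - 1)) *
    ⨆ c : {c : ℝ≥0 // 0 < c},
      (c : ℝ≥0∞) * (volume {x : Eucl n | (c : ℝ≥0∞) < ringLevel M f j jt x}) ^ (1 / p)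

/-- The quantity whose finiteness defines the flow space `^{m'}_m Ḃ^{n/p-1,q}_{p,∞}`
(for `q < ∞` it is a `q`-th power). -/
def flowNorm (p : ℝ) (q : ℝ≥0∞) (m' m : ℝ) (f : ℝ → 𝓢'(Eucl n, ℂ)) : ℝ≥0∞ :=
  if q = ⊤ then
    (⨆ jt : ℤ, ⨆ j ∈ Ici jt, ringNorm M p m f j jt) +
      ⨆ jt : ℤ, ⨆ j ∈ Iio jt, ringNorm M p m' f j jt
  else
    ⨆ jt : ℤ, ((∑' j : Ici jt, ringNorm M p m f j jt ^ q.toReal) +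
      ∑' j : Iio jt, ringNorm M p m' f j jt ^ q.toReal)

/-- Membership of a flow `f(t,x)`, `t > 0`, in `^{m'}_m Ḃ^{n/p-1,q}_{p,∞}`. A flow is a family of
tempered distributions on `ℝⁿ`, measurable in time, each of which is the sum of its wavelet
series: `f(t,x) = ∑_{(ε,j,k)} f^ε_{j,k}(t) φ^ε_{j,k}(x)`. Values at `t ≤ 0` play no role. -/
structure MemFlowSpace (p : ℝ) (q : ℝ≥0∞) (m' m : ℝ) (f : ℝ → 𝓢'(Eucl n, ℂ)) : Prop where
  measurable : ∀ ψ : 𝓢(Eucl n, ℂ),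
    AEStronglyMeasurable (fun t => f t ψ) (volume.restrict (Ioi (0 : ℝ)))
  expansion : ∀ t : ℝ, 0 < t → ∀ ψ : 𝓢(Eucl n, ℂ),
    HasSum (fun γ : Dir n × ℤ × (Fin n → ℤ) =>
      coeff M (f t) γ.1 γ.2.1 γ.2.2 * ∫ x, M.wavelet γ.1.1 γ.2.1 γ.2.2 x * ψ x) (f t ψ)
  norm_lt_top : flowNorm M p q m' m f < ⊤

/-! ### The paraproduct flows -/

/-- The symbol `iξ_l e^{-τ|ξ|²}` of `e^{τΔ} ∂_l`, at `ξ = 2πη`. -/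
def symbolA (l : Fin n) (τ : ℝ) (η : Eucl n) : ℂ :=
  Complex.exp (-(τ * (2 * Real.pi * ‖η‖) ^ 2 : ℝ)) * (Complex.I * (2 * Real.pi * η l : ℝ))

/-- The symbol `(iξ_l)(iξ_{l'})(iξ_{l''}) |ξ|^{-2} e^{-τ|ξ|²}` of
`e^{τΔ} ∂_l ∂_{l'} ∂_{l''} (-Δ)^{-1}`, at `ξ = 2πη`. -/
def symbolA₃ (l l' l'' : Fin n) (τ : ℝ) (η : Eucl n) : ℂ :=
  Complex.exp (-(τ * (2 * Real.pi * ‖η‖) ^ 2 : ℝ)) *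
    ((Complex.I * (2 * Real.pi * η l : ℝ)) * (Complex.I * (2 * Real.pi * η l' : ℝ)) *
      (Complex.I * (2 * Real.pi * η l'' : ℝ))) / ((2 * Real.pi * ‖η‖) ^ 2 : ℝ)

/-- The transpose of the Fourier multiplier `T = 𝓕⁻ σ 𝓕`, namely `Tᵗ ψ = 𝓕 (σ 𝓕⁻ ψ)`. For a bounded
function `F`, the distribution `T F` is given by `⟨T F, ψ⟩ = ∫ F(x) (Tᵗ ψ)(x) dx`. -/
def transposeMultiplier (σ : Eucl n → ℂ) (ψ : 𝓢(Eucl n, ℂ)) : Eucl n → ℂ :=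
  𝓕 (fun η : Eucl n => σ η * (𝓕⁻ ψ) η)

/-- `w(t) = ∫₀ᵗ A_{t-s} (∑_j P_{j-2}u(s) Q^ε_j v(s)) ds` for all `t > 0`, where `A_τ` is the Fourier
multiplier with symbol `σ τ`: the series of the paraproduct converges absolutely, and the
integral converges absolutely when tested against Schwartz functions. -/
def IsParaproductFlow (σ : ℝ → Eucl n → ℂ) (ε : Fin n → Fin 2)
    (u v w : ℝ → 𝓢'(Eucl n, ℂ)) : Prop :=
  (∀ s : ℝ, 0 < s → ∀ x, Summable (paraTerm M ε (u s) (v s) x)) ∧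
  ∀ t : ℝ, 0 < t → ∀ ψ : 𝓢(Eucl n, ℂ),
    (∀ s ∈ Ioo 0 t, Integrable fun x =>
      paraproduct M ε (u s) (v s) x * transposeMultiplier (σ (t - s)) ψ x) ∧
    IntegrableOn (fun s => ∫ x,
      paraproduct M ε (u s) (v s) x * transposeMultiplier (σ (t - s)) ψ x) (Ioo 0 t) ∧
    w t ψ = ∫ s in Ioo 0 t, ∫ x,
      paraproduct M ε (u s) (v s) x * transposeMultiplier (σ (t - s)) ψ x

end

end BesovLorentz

end

/-!
# Boundedness of paraproduct flows on Besov–Lorentz flow spaces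

Both families of operators have symbols `e^{-τ|ξ|²} ρ(ξ)` with `ρ` continuous, smooth off the origin and
homogeneous of degree one (`IsHomogeneousSymbol`), and the argument uses nothing else about `ρ`.

*Discretization.* At the scale `j` the level functions are constant on dyadic cells, so that the weak `L^p`
quasi-norm of `f_{j,jt}` is a weak `ℓ^p` quasi-norm of `ringSeq`, the suprema over a ring of times of the
normalized coefficients. It is equivalent to the norm `seqNorm` with `θ = 1 - 1/p`
(`ringNorm_le_seqNorm`, `seqNorm_le_ringNorm`), for which Schur's test holds (`seqNorm_schur`). Membership
in the flow space, for whatever `q`, gives `seqNorm ≤ C 2^{jt} 2^{decay α β (j - jt)}` with the positive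
rates `α = 1 - 2m'` and `β = 2m - 1` of decay towards coarse and fine scales. Conversely, any geometric
decay of the ring norms in `|j - jt|` suffices for membership (`flowNorm_lt_top`).

*The paraproduct.* At times of order `4^{-jt}`, the wavelet expansion of `u` bounds `P_{j-2} u` uniformly by
`2^{jt} 2^{α min(j - jt, 0)}` (`exists_tsum_coeff_low_le`). Hence the series of the paraproduct converges
absolutely. Its `j`-th term has frequencies in an annulus of size `2^j`, so a wavelet of scale `j` sees only
the terms with `|j' - j| ≤ 2` (`integral_mul_transposeMultiplier_eq_zero`). Together with the kernel
estimate for `e^{-τ|ξ|²} ρ` on wavelets (`exists_transposeMultiplier_wavelet_le`) this bounds the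
coefficients of the Duhamel integrand by an almost diagonal matrix applied to those of `v`
(`exists_enorm_integral_paraproduct_le_tsum`).

*The time integral.* The times before `t ∈ [4^{-jt}, 4^{1-jt})` are cut into the rings of index `jt + i`. The
decay of the heat kernel in `4^j (t - s)` turns the sum over the rings into a gain of `2^{-2(j - jt)}` for
`j ≥ jt` (`exists_ring_weights`), whereas for `j < jt` the two factors `u` and `v` provide the rate `2α`.
The resulting rates `2α` and `β + 2` dominate the weights of the flow norm with room to spare
(`memFlowSpace_of_eq_duhamel`).

*Well-definedness.* The Meyer wavelet expansion of Schwartz functions is proved on the frequency side from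
Poisson summation and the telescoping two-scale relation (`hasSum_fourierInv_wavelet`). Inserted into the
Duhamel integral, with the summability of the wavelet coefficients of a test function
(`exists_tsum_wavelet_coeff_le`), it shows that the integrals converge absolutely, that they define a
tempered distribution (`exists_synthesis`), and that this distribution is the sum of its wavelet series
(`hasSum_duhamel`).
-/

noncomputable section

namespace BesovLorentz

/-! ### Weak Lebesgue norms of sequences -/

section SeqNorm

variable {ι : Type*}

/-- The normable version `sup_E |E|^{-θ} ∑_{k ∈ E} a_k` of the weak `ℓ^p` quasi-norm, where
`θ = 1 - 1/p` and `E` runs through the finite sets. -/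
def seqNorm (θ : ℝ) (a : ι → ℝ≥0∞) : ℝ≥0∞ :=
  ⨆ E : Finset ι, (E.card : ℝ≥0∞) ^ (-θ) * ∑ k ∈ E, a k

theorem sum_le_seqNorm (θ : ℝ) (a : ι → ℝ≥0∞) (E : Finset ι) :
    ∑ k ∈ E, a k ≤ (E.card : ℝ≥0∞) ^ θ * seqNorm θ a := by
  rcases E.eq_empty_or_nonempty with rfl | hE
  · simp
  have h0 : (E.card : ℝ≥0∞) ≠ 0 := by simpa using hE.ne_empty
  have h1 : (E.card : ℝ≥0∞) ≠ ⊤ := ENNReal.natCast_ne_top _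
  have h : (E.card : ℝ≥0∞) ^ (-θ) * ∑ k ∈ E, a k ≤ seqNorm θ a :=
    le_iSup (fun E : Finset ι => (E.card : ℝ≥0∞) ^ (-θ) * ∑ k ∈ E, a k) E
  calc ∑ k ∈ E, a k = (E.card : ℝ≥0∞) ^ θ * ((E.card : ℝ≥0∞) ^ (-θ) * ∑ k ∈ E, a k) := by
        rw [← mul_assoc, ← ENNReal.rpow_add _ _ h0 h1, add_neg_cancel, ENNReal.rpow_zero, one_mul]
    _ ≤ _ := by gcongr

theorem seqNorm_le {θ : ℝ} {a : ι → ℝ≥0∞} {C : ℝ≥0∞}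
    (h : ∀ E : Finset ι, E.Nonempty → ∑ k ∈ E, a k ≤ (E.card : ℝ≥0∞) ^ θ * C) :
    seqNorm θ a ≤ C := by
  refine iSup_le fun E => ?_
  rcases E.eq_empty_or_nonempty with rfl | hE
  · simp
  have h0 : (E.card : ℝ≥0∞) ≠ 0 := by simpa using hE.ne_empty
  have h1 : (E.card : ℝ≥0∞) ≠ ⊤ := ENNReal.natCast_ne_top _
  calc (E.card : ℝ≥0∞) ^ (-θ) * ∑ k ∈ E, a k
      ≤ (E.card : ℝ≥0∞) ^ (-θ) * ((E.card : ℝ≥0∞) ^ θ * C) := by gcongr; exact h E hE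
    _ = C := by
        rw [← mul_assoc, ← ENNReal.rpow_add _ _ h0 h1, neg_add_cancel, ENNReal.rpow_zero, one_mul]

theorem seqNorm_mono {θ : ℝ} {a b : ι → ℝ≥0∞} (h : ∀ k, a k ≤ b k) :
    seqNorm θ a ≤ seqNorm θ b := by
  unfold seqNorm
  gcongr with E k hk
  exact h k

theorem le_seqNorm (θ : ℝ) (a : ι → ℝ≥0∞) (k : ι) : a k ≤ seqNorm θ a := by
  simpa using sum_le_seqNorm θ a {k}

theorem seqNorm_const_mul (θ : ℝ) (C : ℝ≥0∞) (a : ι → ℝ≥0∞) :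
    seqNorm θ (fun k => C * a k) = C * seqNorm θ a := by
  unfold seqNorm
  rw [ENNReal.mul_iSup]
  congr 1 with E
  rw [← Finset.mul_sum]
  ring

theorem seqNorm_tsum_le {κ : Type*} (θ : ℝ) (a : κ → ι → ℝ≥0∞) :
    seqNorm θ (fun k => ∑' i, a i k) ≤ ∑' i, seqNorm θ (a i) := by
  refine seqNorm_le fun E _ => ?_
  rw [← Summable.tsum_finsetSum (fun _ _ => ENNReal.summable), ← ENNReal.tsum_mul_left]
  exact ENNReal.tsum_le_tsum fun i => sum_le_seqNorm θ (a i) E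

theorem seqNorm_sum_le {κ : Type*} (s : Finset κ) (θ : ℝ) (a : κ → ι → ℝ≥0∞) :
    seqNorm θ (fun k => ∑ i ∈ s, a i k) ≤ ∑ i ∈ s, seqNorm θ (a i) := by
  refine seqNorm_le fun E _ => ?_
  rw [Finset.sum_comm, Finset.mul_sum]
  exact Finset.sum_le_sum fun i _ => sum_le_seqNorm θ (a i) E

/-- Bernoulli's inequality, in the form that makes `∑_{i ≤ m} i^{θ-1}` telescope. -/
theorem rpow_sub_one_le_sub {θ : ℝ} (h0 : 0 < θ) (h1 : θ < 1) (m : ℕ) :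
    ((m : ℝ) + 1) ^ (θ - 1) ≤ θ⁻¹ * (((m : ℝ) + 1) ^ θ - (m : ℝ) ^ θ) := by
  have hm : (0 : ℝ) < (m : ℝ) + 1 := by positivity
  have hB := rpow_one_add_le_one_add_mul_self (s := -(1 / ((m : ℝ) + 1)))
    (by rw [neg_le_neg_iff, div_le_one hm]; linarith [(Nat.cast_nonneg m : (0 : ℝ) ≤ m)])
    h0.le h1.le
  have e1 : (1 : ℝ) + -(1 / ((m : ℝ) + 1)) = m / (m + 1) := by field_simp; ring
  rw [e1, Real.div_rpow (Nat.cast_nonneg m) hm.le, div_le_iff₀ (Real.rpow_pos_of_pos hm _)] at hB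
  have e2 : ((m : ℝ) + 1) ^ (θ - 1) = ((m : ℝ) + 1) ^ θ / (m + 1) := by
    rw [Real.rpow_sub_one hm.ne']
  rw [e2, le_inv_mul_iff₀ h0]
  have : (1 + θ * -(1 / ((m : ℝ) + 1))) * ((m : ℝ) + 1) ^ θ
      = ((m : ℝ) + 1) ^ θ - θ * (((m : ℝ) + 1) ^ θ / (m + 1)) := by ring
  linarith

/-- A weak-type bound on the superlevel sets of `a` controls `seqNorm`: the smallest of `m` values is
at most `A m^{θ-1}`, and removing the minimum repeatedly leads to the sum `∑_{i ≤ m} i^{θ-1}`. -/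
theorem seqNorm_le_of_weak {θ : ℝ} (h0 : 0 < θ) (h1 : θ < 1) {a : ι → ℝ≥0∞} {A : ℝ≥0∞}
    (h : ∀ c : ℝ≥0, 0 < c → ∀ E : Finset ι, (∀ k ∈ E, (c : ℝ≥0∞) < a k) →
      c * (E.card : ℝ≥0∞) ^ (1 - θ) ≤ A) :
    seqNorm θ a ≤ ENNReal.ofReal θ⁻¹ * A := by
  refine seqNorm_le fun E _ => ?_
  suffices H : ∀ m : ℕ, ∀ E : Finset ι, E.card = m →
      ∑ k ∈ E, a k ≤ ENNReal.ofReal (θ⁻¹ * (m : ℝ) ^ θ) * A by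
    refine (H _ E rfl).trans_eq ?_
    rw [ENNReal.ofReal_mul (by positivity), ← ENNReal.ofReal_rpow_of_nonneg (by positivity) h0.le,
      ENNReal.ofReal_natCast]
    ring
  intro m
  induction m with
  | zero => intro E hE; simp [Finset.card_eq_zero.mp hE]
  | succ m ih =>
    intro E hE
    have hne : E.Nonempty := Finset.card_pos.mp (by omega)
    classical
    obtain ⟨k0, hk0, hmin⟩ := E.exists_min_image a hne
    have hpos : (0 : ℝ) < (m : ℝ) + 1 := by positivity
    have hcard : ((m + 1 : ℕ) : ℝ≥0∞) = ENNReal.ofReal ((m : ℝ) + 1) := by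
      rw [← ENNReal.ofReal_natCast]; push_cast; rfl
    have hk : a k0 ≤ ENNReal.ofReal (((m : ℝ) + 1) ^ (θ - 1)) * A := by
      refine le_of_forall_lt fun c hc => ?_
      obtain ⟨c', hc1, hc2⟩ := ENNReal.lt_iff_exists_nnreal_btwn.mp hc
      have hc0 : 0 < c' := by
        by_contra hcon
        have : c' = 0 := by simpa using hcon
        subst this
        simp at hc1
      refine hc1.trans_le ?_
      have := h c' hc0 E fun k hk => hc2.trans_le (hmin k hk)
      rw [hE, hcard, ENNReal.ofReal_rpow_of_pos hpos] at this
      calc (c' : ℝ≥0∞) = ENNReal.ofReal (((m : ℝ) + 1) ^ (θ - 1))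
            * (c' * ENNReal.ofReal (((m : ℝ) + 1) ^ (1 - θ))) := by
            rw [mul_left_comm, ← ENNReal.ofReal_mul (by positivity), ← Real.rpow_add hpos]
            simp
        _ ≤ _ := by gcongr
    have hrest := ih (E.erase k0) (by rw [Finset.card_erase_of_mem hk0, hE]; rfl)
    rw [← Finset.add_sum_erase E a hk0]
    calc a k0 + ∑ k ∈ E.erase k0, a k
        ≤ ENNReal.ofReal (θ⁻¹ * (((m : ℝ) + 1) ^ θ - (m : ℝ) ^ θ)) * A
          + ENNReal.ofReal (θ⁻¹ * (m : ℝ) ^ θ) * A := by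
          refine add_le_add (hk.trans ?_) hrest
          gcongr
          exact rpow_sub_one_le_sub h0 h1 m
      _ = _ := by
          have hle : (m : ℝ) ^ θ ≤ ((m : ℝ) + 1) ^ θ :=
            Real.rpow_le_rpow (by positivity) (by linarith) h0.le
          rw [← add_mul, ← ENNReal.ofReal_add (mul_nonneg (by positivity) (by linarith))
            (by positivity)]
          push_cast
          congr 2
          ring

/-- The converse weak-type bound, which needs no constant. -/
theorem weak_le_seqNorm {θ : ℝ} (hθ : θ < 1) (a : ι → ℝ≥0∞) (c : ℝ≥0) (E : Finset ι)
    (hE : ∀ k ∈ E, c ≤ a k) : c * (E.card : ℝ≥0∞) ^ (1 - θ) ≤ seqNorm θ a := by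
  rcases E.eq_empty_or_nonempty with rfl | hne
  · simp [hθ]
  have h0 : (E.card : ℝ≥0∞) ≠ 0 := by simpa using hne.ne_empty
  have h1 : (E.card : ℝ≥0∞) ≠ ⊤ := ENNReal.natCast_ne_top _
  have h : (E.card : ℝ≥0∞) ^ (-θ) * ∑ k ∈ E, a k ≤ seqNorm θ a :=
    le_iSup (fun E : Finset ι => (E.card : ℝ≥0∞) ^ (-θ) * ∑ k ∈ E, a k) E
  refine le_trans ?_ h
  have h2 : (E.card : ℝ≥0∞) * c ≤ ∑ k ∈ E, a k := by
    simpa using Finset.card_nsmul_le_sum E a c hE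
  calc c * (E.card : ℝ≥0∞) ^ (1 - θ) = (E.card : ℝ≥0∞) ^ (-θ) * (E.card * c) := by
        rw [sub_eq_neg_add, ENNReal.rpow_add _ _ h0 h1, ENNReal.rpow_one]
        ring
    _ ≤ _ := by gcongr

/-- Schur's test for the weak `ℓ^p` norms, `1 < p < ∞`: if the row and column sums of a
nonnegative matrix are bounded by `C`, the matrix is bounded. The weighted sums
`∑ g a` with `0 ≤ g ≤ C`, `∑ g ≤ C |E|` are estimated by writing `g` as an integral over its
superlevel sets, which have at most `C |E| / c` elements at height `c`. -/
theorem seqNorm_schur {κ : Type*} {θ : ℝ} (h0 : 0 < θ) (h1 : θ < 1) [Countable κ]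
    (K : ι → κ → ℝ≥0∞) {C : ℝ≥0} (hrow : ∀ k, ∑' k', K k k' ≤ C)
    (hcol : ∀ k', ∑' k, K k k' ≤ C) (a : κ → ℝ≥0∞) :
    seqNorm θ (fun k => ∑' k', K k k' * a k') ≤
      ENNReal.ofReal (C * (1 - θ)⁻¹) * seqNorm θ a := by
  refine seqNorm_le fun E hE => ?_
  set g : κ → ℝ≥0∞ := fun k' => ∑ k ∈ E, K k k' with hg
  have hgC : ∀ k', g k' ≤ C := fun k' => (ENNReal.sum_le_tsum E).trans (hcol k')
  have hgsum : ∑' k', g k' ≤ E.card * C := by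
    rw [hg, Summable.tsum_finsetSum fun _ _ => ENNReal.summable]
    calc ∑ k ∈ E, ∑' k', K k k' ≤ ∑ k ∈ E, (C : ℝ≥0∞) := Finset.sum_le_sum fun k _ => hrow k
      _ = _ := by simp
  have hC0 : (0 : ℝ) ≤ C := C.2
  have hE0 : (0 : ℝ) ≤ E.card := Nat.cast_nonneg _
  have hEC : (0 : ℝ) ≤ E.card * C := mul_nonneg hE0 hC0
  -- the layer cake formula for `g`, whose values lie in `[0, C]`
  have hlayer : ∀ k', g k' = ∫⁻ c in Ioo (0 : ℝ) C,
      (if ENNReal.ofReal c < g k' then 1 else 0) := by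
    intro k'
    have hgt : g k' ≠ ⊤ := ((hgC k').trans_lt ENNReal.coe_lt_top).ne
    have : ∀ c ∈ Ioo (0 : ℝ) C, (if ENNReal.ofReal c < g k' then (1 : ℝ≥0∞) else 0)
        = (Iio (g k').toReal).indicator 1 c := by
      intro c hc
      simp only [indicator, mem_Iio, Pi.one_apply,
        ENNReal.ofReal_lt_iff_lt_toReal hc.1.le hgt]
    rw [setLIntegral_congr_fun measurableSet_Ioo this, lintegral_indicator_one measurableSet_Iio,
      Measure.restrict_apply measurableSet_Iio]
    have hle : (g k').toReal ≤ C := ENNReal.toReal_le_of_le_ofReal C.2 (by simpa using hgC k')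
    have : Iio (g k').toReal ∩ Ioo (0 : ℝ) C = Ioo 0 (g k').toReal := by
      ext c
      simp only [mem_inter_iff, mem_Iio, mem_Ioo]
      constructor
      · rintro ⟨h1, h2, h3⟩; exact ⟨h2, h1⟩
      · rintro ⟨h1, h2⟩; exact ⟨h2, h1, h2.trans_le hle⟩
    rw [this, Real.volume_Ioo, sub_zero, ENNReal.ofReal_toReal hgt]
  -- by Chebyshev, `{g > c}` has at most `C |E| / c` elements
  have hlevel : ∀ c ∈ Ioo (0 : ℝ) C, ∑' k', (if ENNReal.ofReal c < g k' then 1 else 0) * a k' ≤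
      ENNReal.ofReal ((E.card * C) ^ θ * c ^ (-θ)) * seqNorm θ a := by
    intro c hc
    refine ENNReal.summable.tsum_le_of_sum_le fun s => ?_
    have hfil : ∑ k' ∈ s, (if ENNReal.ofReal c < g k' then (1 : ℝ≥0∞) else 0) * a k'
        = ∑ k' ∈ s.filter (fun k' => ENNReal.ofReal c < g k'), a k' := by
      rw [Finset.sum_filter]
      exact Finset.sum_congr rfl fun k' _ => by split_ifs <;> simp
    rw [hfil]
    refine (sum_le_seqNorm θ a _).trans ?_
    gcongr
    set S := s.filter (fun k' => ENNReal.ofReal c < g k')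
    have hS : (S.card : ℝ≥0∞) * ENNReal.ofReal c ≤ ENNReal.ofReal (E.card * C) := by
      calc (S.card : ℝ≥0∞) * ENNReal.ofReal c ≤ ∑ k' ∈ S, g k' := by
            simpa using Finset.card_nsmul_le_sum S g (ENNReal.ofReal c)
              fun k' hk' => (Finset.mem_filter.mp hk').2.le
        _ ≤ ∑' k', g k' := ENNReal.sum_le_tsum S
        _ ≤ _ := hgsum
        _ = _ := by
          rw [ENNReal.ofReal_mul hE0, ENNReal.ofReal_natCast, ENNReal.ofReal_coe_nnreal]
    have hS' : (S.card : ℝ) ≤ E.card * C * c⁻¹ := by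
      rw [← ENNReal.ofReal_natCast, ← ENNReal.ofReal_mul (Nat.cast_nonneg _),
        ENNReal.ofReal_le_ofReal_iff hEC] at hS
      rw [← div_eq_mul_inv, le_div_iff₀ hc.1]
      exact hS
    rw [← ENNReal.ofReal_natCast, ENNReal.ofReal_rpow_of_nonneg (Nat.cast_nonneg _) h0.le]
    refine ENNReal.ofReal_le_ofReal ?_
    rw [Real.rpow_neg hc.1.le, ← Real.inv_rpow hc.1.le, ← Real.mul_rpow hEC
      (inv_nonneg.mpr hc.1.le)]
    exact Real.rpow_le_rpow (Nat.cast_nonneg _) hS' h0.le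
  calc ∑ k ∈ E, ∑' k', K k k' * a k' = ∑' k', g k' * a k' := by
        rw [← Summable.tsum_finsetSum fun _ _ => ENNReal.summable]
        simp only [hg, Finset.sum_mul]
    _ = ∑' k', ∫⁻ c in Ioo (0 : ℝ) C, (if ENNReal.ofReal c < g k' then 1 else 0) * a k' := by
        congr 1 with k'
        rw [lintegral_mul_const, ← hlayer]
        exact Measurable.ite (measurableSet_lt ENNReal.measurable_ofReal measurable_const)
          measurable_const measurable_const
    _ = ∫⁻ c in Ioo (0 : ℝ) C, ∑' k', (if ENNReal.ofReal c < g k' then 1 else 0) * a k' := by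
        rw [lintegral_tsum]
        intro k'
        exact ((Measurable.ite (measurableSet_lt ENNReal.measurable_ofReal measurable_const)
          measurable_const measurable_const).mul_const _).aemeasurable
    _ ≤ ∫⁻ c in Ioo (0 : ℝ) C, ENNReal.ofReal ((E.card * C) ^ θ * c ^ (-θ)) * seqNorm θ a :=
        setLIntegral_mono' measurableSet_Ioo hlevel
    _ = ENNReal.ofReal (∫ c in Ioo (0 : ℝ) C, (E.card * C) ^ θ * c ^ (-θ)) * seqNorm θ a := by
        have hint : IntegrableOn (fun c : ℝ => (E.card * C : ℝ) ^ θ * c ^ (-θ)) (Ioo (0 : ℝ) C) :=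
          (((intervalIntegral.intervalIntegrable_rpow' (a := 0) (b := C) (r := -θ)
            (by linarith)).1).mono_set Ioo_subset_Ioc_self).const_mul _
        rw [lintegral_mul_const _ (by fun_prop), ofReal_integral_eq_lintegral_ofReal hint]
        filter_upwards [ae_restrict_mem measurableSet_Ioo] with c hc
        exact mul_nonneg (Real.rpow_nonneg hEC _) (Real.rpow_nonneg hc.1.le _)
    _ = (E.card : ℝ≥0∞) ^ θ * (ENNReal.ofReal (C * (1 - θ)⁻¹) * seqNorm θ a) := by
        rw [← integral_Ioc_eq_integral_Ioo, integral_const_mul,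
          ← intervalIntegral.integral_of_le hC0, integral_rpow (Or.inl (by linarith)),
          Real.zero_rpow (by linarith), ← mul_assoc]
        congr 1
        rw [← ENNReal.ofReal_natCast, ENNReal.ofReal_rpow_of_nonneg hE0 h0.le,
          ← ENNReal.ofReal_mul (Real.rpow_nonneg hE0 _)]
        congr 1
        rw [Real.mul_rpow hE0 hC0, sub_zero, neg_add_eq_sub]
        rcases eq_or_lt_of_le hC0 with hC | hC
        · have : (C : ℝ) = 0 := hC.symm
          rw [this, Real.zero_rpow h0.ne']; simp
        · have : (C : ℝ) = C ^ θ * C ^ (1 - θ) := by rw [← Real.rpow_add hC]; simp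
          conv_rhs => rw [this]
          rw [div_eq_mul_inv]
          ring

end SeqNorm

/-! ### Lattice sums and dyadic cubes -/

section Lattice

variable {n : ℕ}

/-- The lattice point `k ∈ ℤⁿ` as a vector of `ℝⁿ`. -/
def lat (k : Fin n → ℤ) : Eucl n := WithLp.toLp 2 fun i => (k i : ℝ)

@[simp] theorem lat_apply (k : Fin n → ℤ) (i : Fin n) : lat k i = k i := rfl

/-- The profile `(1 + |x|)^{-n-1}`, an integrable majorant of Schwartz functions. -/
def prof (x : Eucl n) : ℝ≥0∞ := ENNReal.ofReal ((1 + ‖x‖) ^ (-((n : ℝ) + 1)))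

theorem measurable_prof : Measurable (prof (n := n)) := by
  unfold prof; fun_prop

theorem lintegral_prof_lt_top : ∫⁻ x : Eucl n, prof x < ⊤ := by
  have := finite_integral_one_add_norm (E := Eucl n) (μ := volume) (r := (n : ℝ) + 1) (by simp)
  exact this

theorem prof_ne_top (x : Eucl n) : prof x ≠ ⊤ := ENNReal.ofReal_ne_top

/-- The cells `{x : ⌊2^j x⌋ = k}`, which tile space. -/
def cell (j : ℤ) (k : Fin n → ℤ) : Set (Eucl n) := {x | (fun i => ⌊(2 : ℝ) ^ j * x i⌋) = k}

theorem mem_cell {j : ℤ} {k : Fin n → ℤ} {x : Eucl n} :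
    x ∈ cell j k ↔ ∀ i, ⌊(2 : ℝ) ^ j * x i⌋ = k i := funext_iff

theorem measurableSet_cell (j : ℤ) (k : Fin n → ℤ) : MeasurableSet (cell j k) := by
  have : cell j k = ⋂ i, {x : Eucl n | ⌊(2 : ℝ) ^ j * x i⌋ = k i} := by
    ext x; simp [mem_cell]
  rw [this]
  refine MeasurableSet.iInter fun i => ?_
  have : Measurable fun x : Eucl n => ⌊(2 : ℝ) ^ j * x i⌋ := by
    refine Int.measurable_floor.comp ?_
    fun_prop
  exact this (measurableSet_singleton _)

theorem pairwise_disjoint_cell (j : ℤ) : Pairwise (Function.onFun Disjoint (cell (n := n) j)) := by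
  intro k k' hk
  refine Set.disjoint_left.mpr fun x hx hx' => hk ?_
  exact (show _ = k from hx).symm.trans hx'

theorem cell_subset_cube (j : ℤ) (k : Fin n → ℤ) : cell j k ⊆ cube j k := by
  intro x hx i
  have := mem_cell.mp hx i
  rw [← this]
  exact ⟨by linarith [Int.floor_le ((2 : ℝ) ^ j * x i)],
    by linarith [Int.lt_floor_add_one ((2 : ℝ) ^ j * x i)]⟩

theorem two_rpow_ne_top (r : ℝ) : (2 : ℝ≥0∞) ^ r ≠ ⊤ := by simp

theorem two_rpow_add (r s : ℝ) : (2 : ℝ≥0∞) ^ (r + s) = 2 ^ r * 2 ^ s :=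
  ENNReal.rpow_add _ _ (by simp) (by simp)

theorem ofReal_two_rpow (r : ℝ) : ENNReal.ofReal ((2 : ℝ) ^ r) = 2 ^ r := by
  rw [← ENNReal.ofReal_rpow_of_pos two_pos]; simp

theorem volume_cell (j : ℤ) (k : Fin n → ℤ) : volume (cell j k) = 2 ^ (-((n : ℝ) * j)) := by
  have hpos : (0 : ℝ) < 2 ^ j := by positivity
  have : cell j k = (WithLp.ofLp : Eucl n → (Fin n → ℝ)) ⁻¹'
      (Set.pi univ fun i => Ico ((k i : ℝ) / 2 ^ j) (((k i : ℝ) + 1) / 2 ^ j)) := by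
    ext x
    simp only [mem_cell, mem_preimage, mem_pi, mem_univ, forall_true_left, mem_Ico,
      div_le_iff₀ hpos, lt_div_iff₀ hpos, Int.floor_eq_iff]
    simp only [mul_comm]
  rw [this, (PiLp.volume_preserving_ofLp (Fin n)).measure_preimage
    (MeasurableSet.univ_pi fun i => measurableSet_Ico).nullMeasurableSet, Real.volume_pi_Ico]
  have : ∀ i, ((k i : ℝ) + 1) / 2 ^ j - (k i : ℝ) / 2 ^ j = (2 : ℝ) ^ (-(j : ℝ)) := by
    intro i
    rw [← sub_div, add_sub_cancel_left, Real.rpow_neg two_pos.le, Real.rpow_intCast, one_div]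
  simp only [this, ofReal_two_rpow, Finset.prod_const, Finset.card_univ, Fintype.card_fin]
  rw [← ENNReal.rpow_natCast, ← ENNReal.rpow_mul]
  congr 1; ring

theorem norm_sub_lat_le {k : Fin n → ℤ} {x : Eucl n} (hx : x ∈ cell 0 k) : ‖x - lat k‖ ≤ n := by
  have h : ∀ i, |(x - lat k) i| ≤ 1 := by
    intro i
    have := cell_subset_cube 0 k hx i
    simp only [zpow_zero, one_mul, mem_Icc] at this
    simp only [PiLp.sub_apply, lat_apply]
    rw [abs_le]; constructor <;> linarith [this.1, this.2]
  rw [EuclideanSpace.norm_eq]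
  refine Real.sqrt_le_iff.mpr ⟨by positivity, ?_⟩
  calc ∑ i, ‖(x - lat k) i‖ ^ 2 ≤ ∑ i : Fin n, (1 : ℝ) := by
        refine Finset.sum_le_sum fun i _ => ?_
        rw [Real.norm_eq_abs]
        exact pow_le_one₀ (abs_nonneg _) (h i)
    _ = n := by simp
    _ ≤ (n : ℝ) ^ 2 := by
        exact_mod_cast Nat.le_self_pow two_ne_zero n

/-- Lattice sums of the profile are bounded uniformly in the centre. -/
theorem exists_tsum_prof_le (n : ℕ) :
    ∃ C : ℝ≥0, ∀ y : Eucl n, ∑' k : Fin n → ℤ, prof (y - lat k) ≤ C := by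
  set B : ℝ≥0∞ := ENNReal.ofReal ((1 + (n : ℝ)) ^ ((n : ℝ) + 1)) with hB
  have hfin : B * ∫⁻ x : Eucl n, prof x ≠ ⊤ :=
    ENNReal.mul_ne_top ENNReal.ofReal_ne_top lintegral_prof_lt_top.ne
  refine ⟨(B * ∫⁻ x : Eucl n, prof x).toNNReal, fun y => ?_⟩
  rw [ENNReal.coe_toNNReal hfin]
  have hpt : ∀ k : Fin n → ℤ, ∀ x ∈ cell 0 k, prof (y - lat k) ≤ B * prof (y - x) := by
    intro k x hx
    rw [hB, prof, prof, ← ENNReal.ofReal_mul (by positivity)]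
    refine ENNReal.ofReal_le_ofReal ?_
    have h1 : 1 + ‖y - x‖ ≤ (1 + n) * (1 + ‖y - lat k‖) := by
      have : ‖y - x‖ ≤ ‖y - lat k‖ + n := by
        calc ‖y - x‖ = ‖(y - lat k) - (x - lat k)‖ := by congr 1; abel
          _ ≤ _ := (norm_sub_le _ _).trans (by gcongr; exact norm_sub_lat_le hx)
      nlinarith [norm_nonneg (y - lat k), (Nat.cast_nonneg n : (0 : ℝ) ≤ n)]
    have h2 : ((1 + (n : ℝ)) * (1 + ‖y - lat k‖)) ^ (-((n : ℝ) + 1)) ≤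
        (1 + ‖y - x‖) ^ (-((n : ℝ) + 1)) :=
      Real.rpow_le_rpow_of_nonpos (by positivity) h1 (by linarith [(Nat.cast_nonneg n : (0 : ℝ) ≤ n)])
    rw [Real.mul_rpow (by positivity) (by positivity)] at h2
    calc (1 + ‖y - lat k‖) ^ (-((n : ℝ) + 1))
        = (1 + (n : ℝ)) ^ ((n : ℝ) + 1) *
          ((1 + (n : ℝ)) ^ (-((n : ℝ) + 1)) * (1 + ‖y - lat k‖) ^ (-((n : ℝ) + 1))) := by
          rw [← mul_assoc, ← Real.rpow_add (by positivity), add_neg_cancel, Real.rpow_zero, one_mul]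
      _ ≤ _ := by gcongr
  have hmeas : Measurable fun x : Eucl n => prof (y - x) :=
    measurable_prof.comp (measurable_const.sub measurable_id)
  calc ∑' k : Fin n → ℤ, prof (y - lat k)
      ≤ ∑' k : Fin n → ℤ, ∫⁻ x in cell 0 k, B * prof (y - x) := by
        refine ENNReal.tsum_le_tsum fun k => ?_
        calc prof (y - lat k) = ∫⁻ x in cell 0 k, prof (y - lat k) := by
              rw [setLIntegral_const, volume_cell]; simp
          _ ≤ _ := setLIntegral_mono' (measurableSet_cell 0 k) (hpt k)
    _ = ∫⁻ x in ⋃ k : Fin n → ℤ, cell 0 k, B * prof (y - x) :=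
        (lintegral_iUnion (measurableSet_cell 0) (pairwise_disjoint_cell 0) _).symm
    _ ≤ ∫⁻ x, B * prof (y - x) := setLIntegral_le_lintegral _ _
    _ = B * ∫⁻ x : Eucl n, prof x := by
        rw [lintegral_const_mul _ hmeas, lintegral_sub_left_eq_self]

theorem lintegral_comp_smul_sub (f : Eucl n → ℝ≥0∞) (j : ℤ) (a : Eucl n) :
    ∫⁻ x, f ((2 : ℝ) ^ j • x - a) = 2 ^ (-((n : ℝ) * j)) * ∫⁻ x, f x := by
  have hne : (2 : ℝ) ^ j ≠ 0 := by positivity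
  have h := (MeasurableEquiv.smul₀ ((2 : ℝ) ^ j) hne : Eucl n ≃ᵐ Eucl n).measurableEmbedding.lintegral_map
    (μ := volume) (fun x => f (x - a))
  have hm : Measure.map ((2 : ℝ) ^ j • · : Eucl n → Eucl n) volume
    = ENNReal.ofReal |(((2 : ℝ) ^ j) ^ n)⁻¹| • volume := by
    simpa [abs_inv] using Measure.map_addHaar_smul (volume : Measure (Eucl n)) hne
  simp only [MeasurableEquiv.coe_smul₀] at h
  rw [hm, lintegral_smul_measure, lintegral_sub_right_eq_self] at h
  rw [← h, smul_eq_mul]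
  congr 1
  rw [abs_of_pos (by positivity), ← ofReal_two_rpow]
  rw [Real.rpow_neg two_pos.le, mul_comm, Real.rpow_mul two_pos.le, Real.rpow_intCast,
    Real.rpow_natCast]

end Lattice

/-! ### Discretization of the flow norm -/

section Discretize

variable {n : ℕ} (M : MeyerFunction)

/-- The dyadic ring `[4^{-j_t}, 4^{1-j_t})` of times. -/
def ring (jt : ℤ) : Set ℝ := Ico ((2 : ℝ) ^ (-2 * jt)) ((2 : ℝ) ^ (2 - 2 * jt))

/-- The normalized coefficients `2^{nj/2} ∑_ε |f^ε_{j,k}(t)|`. -/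
def cellSeq (f : 𝓢'(Eucl n, ℂ)) (j : ℤ) (k : Fin n → ℤ) : ℝ≥0∞ :=
  2 ^ ((n : ℝ) * j / 2) * ∑' ε : Dir n, ‖coeff M f ε j k‖ₑ

/-- The supremum of `cellSeq` over a ring of times. -/
def ringSeq (f : ℝ → 𝓢'(Eucl n, ℂ)) (j jt : ℤ) (k : Fin n → ℤ) : ℝ≥0∞ :=
  ⨆ t ∈ ring jt, cellSeq M (f t) j k

theorem cellSeq_le_ringSeq (f : ℝ → 𝓢'(Eucl n, ℂ)) (j : ℤ) {jt : ℤ} {t : ℝ} (ht : t ∈ ring jt)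
    (k : Fin n → ℤ) : cellSeq M (f t) j k ≤ ringSeq M f j jt k :=
  le_iSup₂ (f := fun t (_ : t ∈ ring jt) => cellSeq M (f t) j k) t ht

theorem tsum_dir_level (f : 𝓢'(Eucl n, ℂ)) (j : ℤ) (x : Eucl n) :
    ∑' γ : Dir n × (Fin n → ℤ), (cube j γ.2).indicator (fun _ => ‖coeff M f γ.1 j γ.2‖ₑ) x =
    ∑' k : Fin n → ℤ, (cube j k).indicator (fun _ => ∑' ε : Dir n, ‖coeff M f ε j k‖ₑ) x := by
  rw [ENNReal.tsum_prod', ENNReal.tsum_comm]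
  congr 1 with k
  by_cases h : x ∈ cube j k <;> simp [h]

theorem cellSeq_le_level (f : ℝ → 𝓢'(Eucl n, ℂ)) (j : ℤ) (t : ℝ) {k : Fin n → ℤ} {x : Eucl n}
    (hx : x ∈ cell j k) : cellSeq M (f t) j k ≤ level M f j t x := by
  unfold cellSeq level
  rw [tsum_dir_level]
  gcongr
  refine le_trans ?_ (ENNReal.le_tsum k)
  rw [indicator_of_mem (cell_subset_cube j k hx)]

/-- Off the boundaries of the dyadic cubes of side `2^{-j}`, the level function is the coefficient
of the cube containing the point. -/
theorem level_eq_cellSeq (f : ℝ → 𝓢'(Eucl n, ℂ)) (j : ℤ) (t : ℝ) {x : Eucl n}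
    (hx : ∀ i, ∀ z : ℤ, (2 : ℝ) ^ j * x i ≠ z) :
    level M f j t x = cellSeq M (f t) j (fun i => ⌊(2 : ℝ) ^ j * x i⌋) := by
  unfold cellSeq level
  rw [tsum_dir_level]
  congr 1
  rw [tsum_eq_single (fun i => ⌊(2 : ℝ) ^ j * x i⌋)]
  · rw [indicator_of_mem (cell_subset_cube j _ rfl)]
  · intro k hk
    refine indicator_of_notMem (fun hmem => hk ?_) _
    funext i
    have h := hmem i
    refine (Int.floor_eq_iff.mpr ⟨by linarith [h.1], ?_⟩).symm
    have h2 : (2 : ℝ) ^ j * x i ≤ k i + 1 := by linarith [h.2]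
    refine lt_of_le_of_ne h2 ?_
    exact_mod_cast hx i (k i + 1)

theorem ae_notMem_boundary (j : ℤ) :
    ∀ᵐ x : Eucl n, ∀ i, ∀ z : ℤ, (2 : ℝ) ^ j * x i ≠ z := by
  rw [ae_all_iff]; intro i
  rw [ae_all_iff]; intro z
  have h0 : ∀ᵐ y : Fin n → ℝ, y i ≠ z / 2 ^ j := by
    have : ∀ᵐ r : ℝ, r ≠ z / 2 ^ j := by
      simp [ae_iff]
    exact (Measure.tendsto_eval_ae_ae (μ := fun _ : Fin n => (volume : Measure ℝ))
      (i := i)).eventually this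
  filter_upwards [(PiLp.volume_preserving_ofLp (Fin n)).quasiMeasurePreserving.ae h0] with x hx h
  refine hx ?_
  rw [← h]
  field_simp

/-- The weak `L^p` quasi-norm of a function that is constant on the cells of side `2^{-j}` is a weak
`ℓ^p` quasi-norm of its values; the volume `2^{-nj}` of a cell accounts for the power of `2^j`. -/
theorem ringNorm_le_seqNorm {p : ℝ} (hp : 1 < p) (a : ℝ) (f : ℝ → 𝓢'(Eucl n, ℂ)) (j jt : ℤ) :
    ringNorm M p a f j jt ≤ 2 ^ (2 * ((j : ℝ) - jt) * a) * 2 ^ (-(j : ℝ)) *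
      seqNorm (1 - 1 / p) (ringSeq M f j jt) := by
  have hp0 : 0 < p := by linarith
  set N := seqNorm (1 - 1 / p) (ringSeq M f j jt) with hN
  have hexp : (2 : ℝ≥0∞) ^ (-(j : ℝ)) =
      2 ^ ((j : ℝ) * (n / p - 1)) * (2 ^ (-((n : ℝ) * j))) ^ (1 / p) := by
    rw [← ENNReal.rpow_mul, ← two_rpow_add]; congr 1; field_simp; ring
  unfold ringNorm
  rw [hexp, mul_assoc, mul_assoc, mul_assoc, mul_assoc]
  refine mul_le_mul' le_rfl (mul_le_mul' le_rfl ?_)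
  refine iSup_le fun ⟨c, hc⟩ => ?_
  simp only
  rcases eq_or_ne N ⊤ with hNt | hNt
  · rw [hNt, ENNReal.mul_top]
    · exact le_top
    · simp
  set S : Set (Fin n → ℤ) := {k | (c : ℝ≥0∞) < ringSeq M f j jt k} with hS
  have hθ : 1 - (1 - 1 / p) = 1 / p := by ring
  have hweak : ∀ E : Finset (Fin n → ℤ), (E : Set (Fin n → ℤ)) ⊆ S →
      (c : ℝ≥0∞) * (E.card : ℝ≥0∞) ^ (1 / p) ≤ N := by
    intro E hE
    have h1 : 1 - 1 / p < 1 := by have : 0 < 1 / p := by positivity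
                                  linarith
    have := weak_le_seqNorm h1 (ringSeq M f j jt) c E fun k hk => (hE hk).le
    rwa [hθ] at this
  -- an infinite superlevel set would contain finite sets violating `hweak`
  have hfin : S.Finite := by
    by_contra hinf
    obtain ⟨m, hm⟩ := ENNReal.exists_nat_gt (r := (N / c) ^ p) (by
      refine ENNReal.rpow_ne_top_of_nonneg hp0.le (ENNReal.div_ne_top hNt ?_)
      exact_mod_cast hc.ne')
    obtain ⟨E, hES, hEc⟩ := (show S.Infinite from hinf).exists_subset_card_eq m
    have h1 := hweak E hES
    rw [hEc] at h1
    have h2 : (m : ℝ≥0∞) ^ (1 / p) ≤ N / c := by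
      rw [ENNReal.le_div_iff_mul_le (by left; exact_mod_cast hc.ne') (by left; simp), mul_comm]
      exact h1
    have h3 : (m : ℝ≥0∞) ≤ (N / c) ^ p := by
      have := ENNReal.rpow_le_rpow h2 hp0.le
      rwa [← ENNReal.rpow_mul, one_div_mul_cancel hp0.ne', ENNReal.rpow_one] at this
    exact absurd hm (not_lt.mpr h3)
  have hmeas : volume {x : Eucl n | (c : ℝ≥0∞) < ringLevel M f j jt x} ≤
      hfin.toFinset.card * 2 ^ (-((n : ℝ) * j)) := by
    calc volume {x : Eucl n | (c : ℝ≥0∞) < ringLevel M f j jt x}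
        ≤ volume (⋃ k ∈ hfin.toFinset, cell (n := n) j k) := by
          refine measure_mono_ae ?_
          filter_upwards [ae_notMem_boundary j] with x hx hc'
          refine mem_iUnion₂.mpr ⟨fun i => ⌊(2 : ℝ) ^ j * x i⌋, ?_, rfl⟩
          rw [Finite.mem_toFinset]
          have : ringLevel M f j jt x = ringSeq M f j jt (fun i => ⌊(2 : ℝ) ^ j * x i⌋) := by
            unfold ringLevel ringSeq ring
            simp only [level_eq_cellSeq M f j _ hx]
          exact lt_of_lt_of_eq (show (c : ℝ≥0∞) < ringLevel M f j jt x from hc') this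
      _ ≤ ∑ k ∈ hfin.toFinset, volume (cell (n := n) j k) := measure_biUnion_finset_le _ _
      _ = _ := by simp [volume_cell]
  calc (c : ℝ≥0∞) * volume {x : Eucl n | (c : ℝ≥0∞) < ringLevel M f j jt x} ^ (1 / p)
      ≤ c * (hfin.toFinset.card * 2 ^ (-((n : ℝ) * j))) ^ (1 / p) := by gcongr
    _ = (2 ^ (-((n : ℝ) * j))) ^ (1 / p) * (c * (hfin.toFinset.card : ℝ≥0∞) ^ (1 / p)) := by
        rw [ENNReal.mul_rpow_of_nonneg _ _ (by positivity)]; ring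
    _ ≤ _ := by gcongr; exact hweak _ (by simp)

/-- The converse of `ringNorm_le_seqNorm`, up to the constant of the equivalence of the normable
version with the weak quasi-norm. -/
theorem seqNorm_le_ringNorm {p : ℝ} (hp : 1 < p) (a : ℝ) (f : ℝ → 𝓢'(Eucl n, ℂ)) (j jt : ℤ) :
    seqNorm (1 - 1 / p) (ringSeq M f j jt) ≤ ENNReal.ofReal (1 - 1 / p)⁻¹ *
      (2 ^ (-(2 * ((j : ℝ) - jt) * a)) * 2 ^ (j : ℝ) * ringNorm M p a f j jt) := by
  have hp0 : 0 < p := by linarith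
  have hp1 : 1 / p < 1 := by rw [div_lt_one hp0]; exact hp
  have hp2 : 0 < 1 / p := by positivity
  refine seqNorm_le_of_weak (by linarith) (by linarith) fun c hc E hE => ?_
  have hθ : 1 - (1 - 1 / p) = 1 / p := by ring
  rw [hθ]
  set W := ⨆ c : {c : ℝ≥0 // 0 < c},
      (c : ℝ≥0∞) * (volume {x : Eucl n | (c : ℝ≥0∞) < ringLevel M f j jt x}) ^ (1 / p) with hW
  have h1 : (E.card : ℝ≥0∞) * 2 ^ (-((n : ℝ) * j)) ≤
      volume {x : Eucl n | (c : ℝ≥0∞) < ringLevel M f j jt x} := by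
    calc (E.card : ℝ≥0∞) * 2 ^ (-((n : ℝ) * j)) = ∑ k ∈ E, volume (cell (n := n) j k) := by
          simp [volume_cell]
      _ = volume (⋃ k ∈ E, cell (n := n) j k) :=
          (measure_biUnion_finset (fun k _ k' _ h => pairwise_disjoint_cell j h)
            fun k _ => measurableSet_cell j k).symm
      _ ≤ _ := by
          refine measure_mono ?_
          intro x hx
          simp only [mem_iUnion, exists_prop] at hx
          obtain ⟨k, hk, hxk⟩ := hx
          refine (hE k hk).trans_le ?_
          unfold ringSeq ringLevel
          exact iSup₂_mono fun t _ => cellSeq_le_level M f j t hxk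
  have h2 : (c : ℝ≥0∞) * (volume {x : Eucl n | (c : ℝ≥0∞) < ringLevel M f j jt x}) ^ (1 / p) ≤ W :=
    le_iSup (fun c : {c : ℝ≥0 // 0 < c} => (c : ℝ≥0∞) *
      (volume {x : Eucl n | (c : ℝ≥0∞) < ringLevel M f j jt x}) ^ (1 / p)) ⟨c, hc⟩
  have h3 : ringNorm M p a f j jt =
      2 ^ (2 * ((j : ℝ) - jt) * a) * 2 ^ ((j : ℝ) * (n / p - 1)) * W := rfl
  have h4 : (2 : ℝ≥0∞) ^ (-(2 * ((j : ℝ) - jt) * a)) * 2 ^ (j : ℝ) * ringNorm M p a f j jt =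
      2 ^ ((n : ℝ) * j * (1 / p)) * W := by
    rw [h3, ← mul_assoc, ← two_rpow_add, ← two_rpow_add, ← two_rpow_add]
    congr 2; field_simp; ring
  rw [h4]
  calc (c : ℝ≥0∞) * (E.card : ℝ≥0∞) ^ (1 / p)
      = 2 ^ ((n : ℝ) * j * (1 / p)) * (c * (E.card * 2 ^ (-((n : ℝ) * j))) ^ (1 / p)) := by
        rw [ENNReal.mul_rpow_of_nonneg _ _ hp2.le, ← ENNReal.rpow_mul, mul_left_comm,
          mul_left_comm (2 ^ _), ← two_rpow_add]
        have : (n : ℝ) * j * (1 / p) + -((n : ℝ) * j) * (1 / p) = 0 := by ring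
        rw [this, ENNReal.rpow_zero, mul_one]
    _ ≤ 2 ^ ((n : ℝ) * j * (1 / p)) *
        (c * (volume {x : Eucl n | (c : ℝ≥0∞) < ringLevel M f j jt x}) ^ (1 / p)) := by gcongr
    _ ≤ _ := by gcongr

/-- A finite flow norm, for any `q`, bounds the ring norms uniformly. -/
theorem exists_ringNorm_le {p m' m : ℝ} {q : ℝ≥0∞} (hq : 1 ≤ q) {f : ℝ → 𝓢'(Eucl n, ℂ)}
    (hf : flowNorm M p q m' m f < ⊤) :
    ∃ C : ℝ≥0, ∀ j jt : ℤ, ringNorm M p (if jt ≤ j then m else m') f j jt ≤ C := by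
  unfold flowNorm at hf
  split_ifs at hf with h
  · refine ⟨_, fun j jt => le_of_le_of_eq ?_ (ENNReal.coe_toNNReal hf.ne).symm⟩
    split_ifs with hj
    · refine le_trans ?_ le_self_add
      exact le_iSup_of_le jt (le_iSup₂_of_le j (mem_Ici.mpr hj) le_rfl)
    · refine le_trans ?_ le_add_self
      exact le_iSup_of_le jt (le_iSup₂_of_le j (mem_Iio.mpr (not_le.mp hj)) le_rfl)
  · have hq0 : 0 < q.toReal := ENNReal.toReal_pos (zero_lt_one.trans_le hq).ne' h
    set F := ⨆ jt : ℤ, ((∑' j : Ici jt, ringNorm M p m f j jt ^ q.toReal) +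
      ∑' j : Iio jt, ringNorm M p m' f j jt ^ q.toReal) with hF
    refine ⟨(F ^ (1 / q.toReal)).toNNReal, fun j jt => ?_⟩
    rw [ENNReal.coe_toNNReal (ENNReal.rpow_ne_top_of_nonneg (by positivity) hf.ne)]
    have hj : ringNorm M p (if jt ≤ j then m else m') f j jt ^ q.toReal ≤ F := by
      refine le_trans ?_ (le_iSup _ jt)
      split_ifs with hj
      · exact (ENNReal.le_tsum (f := fun j : Ici jt => ringNorm M p m f j jt ^ q.toReal)
          ⟨j, mem_Ici.mpr hj⟩).trans le_self_add
      · exact (ENNReal.le_tsum (f := fun j : Iio jt => ringNorm M p m' f j jt ^ q.toReal)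
          ⟨j, mem_Iio.mpr (not_le.mp hj)⟩).trans le_add_self
    rwa [one_div, ENNReal.le_rpow_inv_iff hq0]

theorem tsum_two_rpow_neg_abs_lt_top {r : ℝ} (hr : 0 < r) :
    ∑' i : ℤ, (2 : ℝ≥0∞) ^ (-(r * |(i : ℝ)|)) < ⊤ := by
  have hs : Summable fun i : ℤ => (2 : ℝ) ^ (-(r * |(i : ℝ)|)) := by
    have hgeo : Summable fun i : ℕ => (2 : ℝ) ^ (-(r * (i : ℝ))) := by
      have : ∀ i : ℕ, (2 : ℝ) ^ (-(r * (i : ℝ))) = ((2 : ℝ) ^ (-r)) ^ i := by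
        intro i; rw [← Real.rpow_natCast, ← Real.rpow_mul two_pos.le]; congr 1; ring
      simp only [this]
      exact summable_geometric_of_lt_one (by positivity)
        (Real.rpow_lt_one_of_one_lt_of_neg one_lt_two (by linarith))
    refine Summable.of_nat_of_neg ?_ ?_ <;> simpa using hgeo
  have := hs.tsum_ofReal_lt_top
  simpa only [ofReal_two_rpow] using this

/-- Geometric decay of the ring norms away from the diagonal `j = jt` gives finiteness of the flow
norm, for every `q`. -/
theorem flowNorm_lt_top {p m' m : ℝ} {q : ℝ≥0∞} (hq : 1 ≤ q) {f : ℝ → 𝓢'(Eucl n, ℂ)}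
    {C : ℝ≥0} {δ : ℝ} (hδ : 0 < δ)
    (hf : ∀ j jt : ℤ, ringNorm M p (if jt ≤ j then m else m') f j jt ≤
      C * 2 ^ (-(δ * |(j : ℝ) - jt|))) :
    flowNorm M p q m' m f < ⊤ := by
  have hle : ∀ j jt : ℤ, ringNorm M p (if jt ≤ j then m else m') f j jt ≤ C := by
    intro j jt
    refine (hf j jt).trans ?_
    calc (C : ℝ≥0∞) * 2 ^ (-(δ * |(j : ℝ) - jt|)) ≤ C * 2 ^ (0 : ℝ) := by
          gcongr
          · norm_num
          · have : 0 ≤ δ * |(j : ℝ) - jt| := by positivity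
            linarith
      _ = C := by simp
  unfold flowNorm
  split_ifs with h
  · refine ENNReal.add_lt_top.mpr ⟨?_, ?_⟩
    · refine lt_of_le_of_lt (iSup_le fun jt => iSup₂_le fun j hj => ?_) (ENNReal.coe_lt_top (r := C))
      have := hle j jt
      rwa [if_pos (mem_Ici.mp hj)] at this
    · refine lt_of_le_of_lt (iSup_le fun jt => iSup₂_le fun j hj => ?_) (ENNReal.coe_lt_top (r := C))
      have := hle j jt
      rwa [if_neg (not_le.mpr (mem_Iio.mp hj))] at this
  · have hq1 : 1 ≤ q.toReal := by
      rw [← ENNReal.toReal_one]; exact ENNReal.toReal_mono h hq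
    have hq0 : 0 < q.toReal := by linarith
    set r : ℝ := δ * q.toReal with hr
    have hr0 : 0 < r := by positivity
    set G : ℝ≥0∞ := ∑' i : ℤ, (C : ℝ≥0∞) ^ q.toReal * 2 ^ (-(r * |(i : ℝ)|)) with hG
    have hGfin : G < ⊤ := by
      rw [hG, ENNReal.tsum_mul_left]
      refine ENNReal.mul_lt_top (ENNReal.rpow_lt_top_of_nonneg hq0.le ENNReal.coe_ne_top) ?_
      exact tsum_two_rpow_neg_abs_lt_top hr0
    have hterm : ∀ j jt : ℤ, ringNorm M p (if jt ≤ j then m else m') f j jt ^ q.toReal ≤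
        (C : ℝ≥0∞) ^ q.toReal * 2 ^ (-(r * |((j - jt : ℤ) : ℝ)|)) := by
      intro j jt
      calc _ ≤ ((C : ℝ≥0∞) * 2 ^ (-(δ * |(j : ℝ) - jt|))) ^ q.toReal :=
            ENNReal.rpow_le_rpow (hf j jt) hq0.le
        _ = _ := by
            rw [ENNReal.mul_rpow_of_nonneg _ _ hq0.le, ← ENNReal.rpow_mul]
            push_cast
            congr 2
            rw [hr]; ring
    refine lt_of_le_of_lt (iSup_le fun jt => ?_) (ENNReal.add_lt_top.mpr ⟨hGfin, hGfin⟩)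
    refine add_le_add ?_ ?_
    · calc ∑' j : Ici jt, ringNorm M p m f j jt ^ q.toReal
          ≤ ∑' j : Ici jt, (C : ℝ≥0∞) ^ q.toReal * 2 ^ (-(r * |(((j : ℤ) - jt : ℤ) : ℝ)|)) := by
            refine ENNReal.tsum_le_tsum fun ⟨j, hj⟩ => ?_
            have := hterm j jt
            rwa [if_pos (mem_Ici.mp hj)] at this
        _ ≤ ∑' j : ℤ, (C : ℝ≥0∞) ^ q.toReal * 2 ^ (-(r * |((j - jt : ℤ) : ℝ)|)) :=
            ENNReal.tsum_comp_le_tsum_of_injective Subtype.val_injective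
              (fun j : ℤ => (C : ℝ≥0∞) ^ q.toReal * 2 ^ (-(r * |((j - jt : ℤ) : ℝ)|)))
        _ = G := (Equiv.subRight jt).tsum_eq
              (fun i : ℤ => (C : ℝ≥0∞) ^ q.toReal * 2 ^ (-(r * |(i : ℝ)|)))
    · calc ∑' j : Iio jt, ringNorm M p m' f j jt ^ q.toReal
          ≤ ∑' j : Iio jt, (C : ℝ≥0∞) ^ q.toReal * 2 ^ (-(r * |(((j : ℤ) - jt : ℤ) : ℝ)|)) := by
            refine ENNReal.tsum_le_tsum fun ⟨j, hj⟩ => ?_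
            have := hterm j jt
            rwa [if_neg (not_le.mpr (mem_Iio.mp hj))] at this
        _ ≤ ∑' j : ℤ, (C : ℝ≥0∞) ^ q.toReal * 2 ^ (-(r * |((j - jt : ℤ) : ℝ)|)) :=
            ENNReal.tsum_comp_le_tsum_of_injective Subtype.val_injective
              (fun j : ℤ => (C : ℝ≥0∞) ^ q.toReal * 2 ^ (-(r * |((j - jt : ℤ) : ℝ)|)))
        _ = G := (Equiv.subRight jt).tsum_eq
              (fun i : ℤ => (C : ℝ≥0∞) ^ q.toReal * 2 ^ (-(r * |(i : ℝ)|)))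

end Discretize

/-! ### Dilates and translates of a Schwartz function -/

section Atom

variable {n : ℕ}

/-- The dilated translate `2^{nj/2} φ(2^j x - k)` of a Schwartz function. -/
def atom (φ : 𝓢(Eucl n, ℂ)) (j : ℤ) (k : Fin n → ℤ) : 𝓢(Eucl n, ℂ) :=
  (((2 : ℝ) ^ ((n : ℝ) * j / 2) : ℝ) : ℂ) •
    SchwartzMap.compCLMOfContinuousLinearEquiv ℂ
      (ContinuousLinearEquiv.smulLeft (Units.mk0 ((2 : ℝ) ^ j) (zpow_ne_zero j two_ne_zero)))
      (SchwartzMap.compSubConstCLM ℂ (lat k) φ)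

theorem atom_apply (φ : 𝓢(Eucl n, ℂ)) (j : ℤ) (k : Fin n → ℤ) (x : Eucl n) :
    atom φ j k x = (((2 : ℝ) ^ ((n : ℝ) * j / 2) : ℝ) : ℂ) * φ ((2 : ℝ) ^ j • x - lat k) := rfl

theorem MeyerFunction.wavelet_eq_atom (M : MeyerFunction) (ε : Fin n → Fin 2) (j : ℤ)
    (k : Fin n → ℤ) : M.wavelet ε j k = atom (M.mother ε) j k := rfl

theorem exists_enorm_le_prof (φ : 𝓢(Eucl n, ℂ)) : ∃ C : ℝ≥0, ∀ x, ‖φ x‖ₑ ≤ C * prof x := by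
  have h := SchwartzMap.one_add_le_sup_seminorm_apply (𝕜 := ℝ) (m := (n + 1, 0)) (k := n + 1)
    (n := 0) le_rfl le_rfl φ
  set B := 2 ^ (n + 1) * (Finset.Iic ((n + 1, 0) : ℕ × ℕ)).sup
    (fun m => SchwartzMap.seminorm ℝ m.1 m.2) φ
  have hB : 0 ≤ B := by positivity
  refine ⟨B.toNNReal, fun x => ?_⟩
  have hx := h x
  rw [norm_iteratedFDeriv_zero] at hx
  have hpos : 0 < 1 + ‖x‖ := by positivity
  have h1 : ‖φ x‖ ≤ B * (1 + ‖x‖) ^ (-((n : ℝ) + 1)) := by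
    rw [Real.rpow_neg hpos.le, ← div_eq_mul_inv, le_div_iff₀ (Real.rpow_pos_of_pos hpos _)]
    have : (1 + ‖x‖) ^ ((n : ℝ) + 1) = (1 + ‖x‖) ^ (n + 1) := by
      rw [← Real.rpow_natCast]; push_cast; rfl
    rw [this, mul_comm]
    exact hx
  rw [prof, ← ENNReal.ofReal, ← ENNReal.ofReal_mul hB, ← ofReal_norm]
  exact ENNReal.ofReal_le_ofReal h1

theorem enorm_two_rpow (r : ℝ) : ‖(((2 : ℝ) ^ r : ℝ) : ℂ)‖ₑ = 2 ^ r := by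
  rw [← ofReal_norm, Complex.norm_real, Real.norm_of_nonneg (by positivity),
    ofReal_two_rpow]

theorem enorm_atom (φ : 𝓢(Eucl n, ℂ)) (j : ℤ) (k : Fin n → ℤ) (x : Eucl n) :
    ‖atom φ j k x‖ₑ = 2 ^ ((n : ℝ) * j / 2) * ‖φ ((2 : ℝ) ^ j • x - lat k)‖ₑ := by
  rw [atom_apply, enorm_mul, enorm_two_rpow]

theorem exists_tsum_enorm_atom_le (φ : 𝓢(Eucl n, ℂ)) :
    ∃ C : ℝ≥0, ∀ (j : ℤ) (x : Eucl n),
      ∑' k : Fin n → ℤ, ‖atom φ j k x‖ₑ ≤ C * 2 ^ ((n : ℝ) * j / 2) := by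
  obtain ⟨C, hC⟩ := exists_enorm_le_prof φ
  obtain ⟨B, hB⟩ := exists_tsum_prof_le n
  refine ⟨C * B, fun j x => ?_⟩
  simp only [enorm_atom]
  rw [ENNReal.tsum_mul_left, mul_comm]
  gcongr
  calc _ ≤ ∑' k : Fin n → ℤ, C * prof ((2 : ℝ) ^ j • x - lat k) :=
        ENNReal.tsum_le_tsum fun k => hC _
    _ ≤ _ := by
        rw [ENNReal.tsum_mul_left, ENNReal.coe_mul]
        gcongr
        exact hB _

theorem lintegral_enorm_atom (φ : 𝓢(Eucl n, ℂ)) (j : ℤ) (k : Fin n → ℤ) :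
    ∫⁻ x, ‖atom φ j k x‖ₑ = 2 ^ (-((n : ℝ) * j / 2)) * ∫⁻ x, ‖φ x‖ₑ := by
  simp only [enorm_atom]
  rw [lintegral_const_mul' _ _ (two_rpow_ne_top _),
    lintegral_comp_smul_sub (fun x => ‖φ x‖ₑ) j (lat k), ← mul_assoc, ← two_rpow_add]
  congr 2; ring

theorem integral_comp_smul_sub (f : Eucl n → ℂ) (j : ℤ) (a : Eucl n) :
    ∫ x, f ((2 : ℝ) ^ j • x - a) = ((2 : ℝ) ^ (-((n : ℝ) * j)) : ℝ) * ∫ x, f x := by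
  have h1 := Measure.integral_comp_smul (volume : Measure (Eucl n)) (fun x => f (x - a)) ((2 : ℝ) ^ j)
  rw [h1, integral_sub_right_eq_self, abs_of_pos (by positivity), finrank_euclideanSpace_fin,
    Complex.real_smul]
  congr 2
  rw [Real.rpow_neg two_pos.le, mul_comm (n : ℝ), Real.rpow_mul two_pos.le, Real.rpow_intCast,
    Real.rpow_natCast]

theorem fourierInv_atom (φ : 𝓢(Eucl n, ℂ)) (j : ℤ) (k : Fin n → ℤ) (η : Eucl n) :
    (𝓕⁻ (atom φ j k)) η = ((2 : ℝ) ^ (-((n : ℝ) * j / 2)) : ℝ) *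
      Complex.exp (↑(2 * Real.pi * inner ℝ (lat k) ((2 : ℝ) ^ (-j) • η)) * Complex.I) *
        (𝓕⁻ φ) ((2 : ℝ) ^ (-j) • η) := by
  rw [SchwartzMap.fourierInv_coe, SchwartzMap.fourierInv_coe, Real.fourierInv_eq',
    Real.fourierInv_eq']
  set h : Eucl n → ℂ := fun y =>
    Complex.exp (↑(2 * Real.pi * inner ℝ (y + lat k) ((2 : ℝ) ^ (-j) • η)) * Complex.I) • φ y with hh
  have h1 : ∀ v : Eucl n, Complex.exp (↑(2 * Real.pi * inner ℝ v η) * Complex.I) • atom φ j k v =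
      (((2 : ℝ) ^ ((n : ℝ) * j / 2) : ℝ) : ℂ) * h ((2 : ℝ) ^ j • v - lat k) := by
    intro v
    simp only [hh, atom_apply, sub_add_cancel, inner_smul_left, inner_smul_right, smul_eq_mul,
      conj_trivial]
    rw [← mul_assoc ((2 : ℝ) ^ (-j)), ← zpow_add₀ two_ne_zero, neg_add_cancel, zpow_zero, one_mul]
    ring
  have h2 : ∫ y, h y = Complex.exp (↑(2 * Real.pi * inner ℝ (lat k) ((2 : ℝ) ^ (-j) • η)) *
      Complex.I) * ∫ v : Eucl n, Complex.exp (↑(2 * Real.pi * inner ℝ v ((2 : ℝ) ^ (-j) • η)) *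
        Complex.I) • φ v := by
    rw [← integral_const_mul]
    congr 1 with y
    simp only [hh, inner_add_left, smul_eq_mul]
    rw [mul_add, Complex.ofReal_add, add_mul, Complex.exp_add]
    ring
  simp only [h1]
  rw [integral_const_mul, integral_comp_smul_sub h, h2, ← mul_assoc, ← mul_assoc,
    ← Complex.ofReal_mul, ← Real.rpow_add two_pos]
  congr 4
  ring

end Atom

/-! ### Homogeneous multipliers with heat damping -/

section Multiplier

variable {n : ℕ}

/-- The symbol `e^{-τ|ξ|²} ρ`, at `ξ = 2πη`. -/
def heatSymbol (ρ : Eucl n → ℂ) (τ : ℝ) (η : Eucl n) : ℂ :=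
  Complex.exp (-(τ * (2 * Real.pi * ‖η‖) ^ 2 : ℝ)) * ρ η

/-- A symbol that is continuous, smooth off the origin, and homogeneous of degree one. -/
structure IsHomogeneousSymbol (ρ : Eucl n → ℂ) : Prop where
  continuous : Continuous ρ
  smooth : ∀ η, η ≠ 0 → ContDiffAt ℝ ∞ ρ η
  homogeneous : ∀ c : ℝ, 0 < c → ∀ η, ρ (c • η) = c * ρ η

/-- Scaling: on functions of scale `j`, the multiplier acts as `2^j` times the one at the time `4^j τ`
on functions of scale `0`, since `ρ` is homogeneous of degree one. -/
theorem transposeMultiplier_atom {ρ : Eucl n → ℂ} (hρ : IsHomogeneousSymbol ρ) (τ : ℝ)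
    (φ : 𝓢(Eucl n, ℂ)) (j : ℤ) (k : Fin n → ℤ) (x : Eucl n) :
    transposeMultiplier (heatSymbol ρ τ) (atom φ j k) x =
      (((2 : ℝ) ^ (j : ℝ) * (2 : ℝ) ^ ((n : ℝ) * j / 2) : ℝ) : ℂ) *
        transposeMultiplier (heatSymbol ρ (4 ^ j * τ)) φ ((2 : ℝ) ^ j • x - lat k) := by
  unfold transposeMultiplier
  rw [Real.fourier_eq', Real.fourier_eq']
  set g : Eucl n → ℂ := fun ζ =>
    Complex.exp (↑(-2 * Real.pi * inner ℝ ζ ((2 : ℝ) ^ j • x - lat k)) * Complex.I) •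
      (heatSymbol ρ (4 ^ j * τ) ζ * (𝓕⁻ φ) ζ) with hg
  have h4 : (4 : ℝ) ^ j = 2 ^ j * 2 ^ j := by rw [← mul_zpow]; norm_num
  have hne : (2 : ℝ) ^ j ≠ 0 := by positivity
  have h1 : ∀ η : Eucl n,
      Complex.exp (↑(-2 * Real.pi * inner ℝ η x) * Complex.I) •
        (heatSymbol ρ τ η * (𝓕⁻ (atom φ j k)) η) =
      (((2 : ℝ) ^ (j : ℝ) * (2 : ℝ) ^ (-((n : ℝ) * j / 2)) : ℝ) : ℂ) *
        g ((2 : ℝ) ^ (-j) • η - 0) := by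
    intro η
    have e1 : heatSymbol ρ τ η = (((2 : ℝ) ^ (j : ℝ) : ℝ) : ℂ) *
        heatSymbol ρ (4 ^ j * τ) ((2 : ℝ) ^ (-j) • η) := by
      unfold heatSymbol
      have e2 : ρ η = (((2 : ℝ) ^ j : ℝ) : ℂ) * ρ ((2 : ℝ) ^ (-j) • η) := by
        have := hρ.homogeneous ((2 : ℝ) ^ j) (by positivity) ((2 : ℝ) ^ (-j) • η)
        rw [smul_smul, ← zpow_add₀ two_ne_zero, add_neg_cancel, zpow_zero, one_smul] at this
        exact this
      rw [e2, norm_smul, Real.norm_of_nonneg (by positivity), h4, Real.rpow_intCast]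
      have e3 : τ * (2 * Real.pi * ‖η‖) ^ 2 =
          2 ^ j * 2 ^ j * τ * (2 * Real.pi * (2 ^ (-j) * ‖η‖)) ^ 2 := by
        rw [zpow_neg]; field_simp
      rw [e3]; push_cast; ring
    rw [fourierInv_atom, e1]
    simp only [hg, sub_zero, smul_eq_mul, inner_sub_right, inner_smul_left, inner_smul_right,
      conj_trivial]
    have e4 : (2 : ℝ) ^ j * ((2 : ℝ) ^ (-j) * inner ℝ η x) = inner ℝ η x := by
      rw [zpow_neg]; field_simp
    rw [e4, mul_sub, Complex.ofReal_sub, sub_mul, Complex.exp_sub, real_inner_comm]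
    have e5 : Complex.exp (↑(2 * Real.pi * (2 ^ (-j) * inner ℝ η (lat k))) * Complex.I) =
        (Complex.exp (↑(-2 * Real.pi * (2 ^ (-j) * inner ℝ η (lat k))) * Complex.I))⁻¹ := by
      rw [← Complex.exp_neg]; congr 1; push_cast; ring
    rw [real_inner_comm η (lat k), e5]
    push_cast
    field_simp
  simp only [h1]
  rw [integral_const_mul, integral_comp_smul_sub g, ← mul_assoc, ← Complex.ofReal_mul]
  congr 2
  rw [mul_assoc, ← Real.rpow_add two_pos]
  congr 2
  push_cast; ring

end Multiplier

section HeatKernel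

variable {n : ℕ}

/-- Derivatives of `exp(-τ q) g` for a compactly supported `g` such that `q ≥ c` on the support
of `g`: the loss of powers of `τ` is made up for by the exponential. -/
theorem exists_iteratedFDeriv_exp_smul_le {q : Eucl n → ℝ} (hq : ContDiff ℝ ∞ q) {g : Eucl n → ℂ}
    (hg : ContDiff ℝ ∞ g) (hgc : HasCompactSupport g) {c : ℝ} (hc : 0 < c)
    (hqc : ∀ η ∈ tsupport g, c ≤ q η) (K N : ℕ) :
    ∃ C : ℝ, 0 ≤ C ∧ ∀ τ : ℝ, 0 ≤ τ → ∀ η,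
      (1 + τ) ^ K * ‖iteratedFDeriv ℝ N (fun η => Real.exp (-τ * q η) • g η) η‖ ≤ C := by
  have hbq : ∀ i, ∃ B : ℝ, ∀ η ∈ tsupport g, ‖iteratedFDeriv ℝ i q η‖ ≤ B := fun i =>
    IsCompact.exists_bound_of_continuousOn hgc
      (hq.continuous_iteratedFDeriv (m := i) (mod_cast le_top)).continuousOn
  have hbg : ∀ i, ∃ B : ℝ, ∀ η ∈ tsupport g, ‖iteratedFDeriv ℝ i g η‖ ≤ B := fun i =>
    IsCompact.exists_bound_of_continuousOn hgc
      (hg.continuous_iteratedFDeriv (m := i) (mod_cast le_top)).continuousOn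
  choose Bq hBq using hbq
  choose Bg hBg using hbg
  set D : ℝ := 1 + ∑ i ∈ Finset.range (N + 1), |Bq i| with hD
  have hD1 : 1 ≤ D := by
    have : 0 ≤ ∑ i ∈ Finset.range (N + 1), |Bq i| := Finset.sum_nonneg fun _ _ => abs_nonneg _
    linarith
  have hDi : ∀ i ≤ N, |Bq i| ≤ D := by
    intro i hi
    have := Finset.single_le_sum (f := fun i => |Bq i|) (fun _ _ => abs_nonneg _)
      (Finset.mem_range.mpr (Nat.lt_succ_of_le hi))
    linarith
  set S : ℝ := ∑ i ∈ Finset.range (N + 1), (N.choose i : ℝ) * (i.factorial * D ^ i) * |Bg (N - i)|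
    with hS
  have hS0 : 0 ≤ S := Finset.sum_nonneg fun _ _ => by positivity
  set F : ℝ := (K + N).factorial * Real.exp c / c ^ (K + N) with hF
  have hF0 : 0 ≤ F := by positivity
  refine ⟨F * S, by positivity, fun τ hτ η => ?_⟩
  -- off the support of `g` the function vanishes with all its derivatives
  by_cases hη : η ∈ tsupport g
  swap
  · have hsub : tsupport (fun η => Real.exp (-τ * q η) • g η) ⊆ tsupport g :=
      tsupport_smul_subset_right _ _
    have : iteratedFDeriv ℝ N (fun η => Real.exp (-τ * q η) • g η) η = 0 := by
      by_contra h
      exact hη (hsub (support_iteratedFDeriv_subset N h))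
    rw [this]; simp; positivity
  have hqs : ContDiff ℝ ∞ fun η => -τ * q η := contDiff_const.mul hq
  have hes : ContDiff ℝ ∞ fun η => Real.exp (-τ * q η) := Real.contDiff_exp.comp hqs
  have hexp : ∀ i ≤ N, ‖iteratedFDeriv ℝ i (fun η => Real.exp (-τ * q η)) η‖ ≤
      i.factorial * Real.exp (-τ * c) * ((1 + τ) * D) ^ i := by
    intro i hi
    refine norm_iteratedFDeriv_comp_le (g := Real.exp) (f := fun η => -τ * q η)
      (N := ∞) Real.contDiff_exp hqs (mod_cast le_top) η ?_ ?_
    · intro l _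
      rw [norm_iteratedFDeriv_eq_norm_iteratedDeriv, iteratedDeriv_eq_iterate, Real.iter_deriv_exp,
        Real.norm_eq_abs, abs_of_pos (Real.exp_pos _)]
      refine Real.exp_le_exp.mpr ?_
      have := mul_le_mul_of_nonneg_left (hqc η hη) hτ
      linarith
    · intro l hl1 hl2
      have : iteratedFDeriv ℝ l (fun η => -τ * q η) η = (-τ) • iteratedFDeriv ℝ l q η := by
        have := iteratedFDeriv_const_smul_apply (𝕜 := ℝ) (i := l) (a := -τ) (f := q) (x := η)
          (hq.contDiffAt.of_le (mod_cast le_top))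
        exact this
      rw [this, norm_smul, norm_neg, Real.norm_of_nonneg hτ]
      have h1 : (1 : ℝ) ≤ (1 + τ) * D := by nlinarith
      calc τ * ‖iteratedFDeriv ℝ l q η‖ ≤ (1 + τ) * D := by
            have h2 := ((hBq l η hη).trans (le_abs_self _)).trans (hDi l (hl2.trans hi))
            have h3 := norm_nonneg (iteratedFDeriv ℝ l q η)
            nlinarith
        _ = ((1 + τ) * D) ^ 1 := (pow_one _).symm
        _ ≤ _ := pow_le_pow_right₀ h1 hl1
  -- `y ^ (K + N) ≤ (K + N)! exp y` at `y = c (1 + τ)`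
  have hpow : (1 + τ) ^ (K + N) * Real.exp (-τ * c) ≤ F := by
    have h1 := Real.pow_div_factorial_le_exp (c * (1 + τ)) (by positivity) (K + N)
    rw [div_le_iff₀ (by positivity), mul_pow] at h1
    have h2 : Real.exp (c * (1 + τ)) = Real.exp c * Real.exp (c * τ) := by
      rw [← Real.exp_add]; congr 1; ring
    have h3 : Real.exp (-τ * c) * Real.exp (c * τ) = 1 := by
      rw [← Real.exp_add]; simp; ring
    rw [hF, le_div_iff₀ (by positivity)]
    calc (1 + τ) ^ (K + N) * Real.exp (-τ * c) * c ^ (K + N)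
        = (c ^ (K + N) * (1 + τ) ^ (K + N)) * Real.exp (-τ * c) := by ring
      _ ≤ (Real.exp (c * (1 + τ)) * (K + N).factorial) * Real.exp (-τ * c) := by gcongr
      _ = (K + N).factorial * Real.exp c * (Real.exp (-τ * c) * Real.exp (c * τ)) := by
          rw [h2]; ring
      _ = _ := by rw [h3, mul_one]
  have hmul := norm_iteratedFDeriv_smul_le (𝕜 := ℝ) hes hg η (n := N) (mod_cast le_top)
  calc (1 + τ) ^ K * ‖iteratedFDeriv ℝ N (fun η => Real.exp (-τ * q η) • g η) η‖
      ≤ (1 + τ) ^ K * ∑ i ∈ Finset.range (N + 1), (N.choose i : ℝ) *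
        ((i.factorial * Real.exp (-τ * c) * ((1 + τ) * D) ^ i)) * |Bg (N - i)| := by
        gcongr
        refine hmul.trans (Finset.sum_le_sum fun i hi => ?_)
        have hi' : i ≤ N := Nat.lt_succ_iff.mp (Finset.mem_range.mp hi)
        gcongr
        · exact hexp i hi'
        · exact (hBg _ η hη).trans (le_abs_self _)
    _ = ∑ i ∈ Finset.range (N + 1), ((1 + τ) ^ K * (1 + τ) ^ i * Real.exp (-τ * c)) *
        ((N.choose i : ℝ) * (i.factorial * D ^ i) * |Bg (N - i)|) := by
        rw [Finset.mul_sum]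
        refine Finset.sum_congr rfl fun i _ => ?_
        rw [mul_pow]; ring
    _ ≤ ∑ i ∈ Finset.range (N + 1), F *
        ((N.choose i : ℝ) * (i.factorial * D ^ i) * |Bg (N - i)|) := by
        refine Finset.sum_le_sum fun i hi => ?_
        have hi' : i ≤ N := Nat.lt_succ_iff.mp (Finset.mem_range.mp hi)
        gcongr
        refine le_trans ?_ hpow
        rw [← pow_add]
        gcongr
        linarith
    _ = F * S := by rw [hS, Finset.mul_sum]

/-- A cutoff that vanishes near the origin removes the singularity of a homogeneous symbol. -/
theorem contDiff_mul_of_eq_zero_near {ρ : Eucl n → ℂ} (hρ : ∀ η, η ≠ 0 → ContDiffAt ℝ ∞ ρ η)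
    {g : Eucl n → ℂ} (hg : ContDiff ℝ ∞ g) {r : ℝ} (hr : 0 < r) (h0 : ∀ η, ‖η‖ < r → g η = 0) :
    ContDiff ℝ ∞ fun η => ρ η * g η := by
  rw [contDiff_iff_contDiffAt]
  intro η
  rcases eq_or_ne η 0 with rfl | hη
  · refine (contDiffAt_const (c := (0 : ℂ))).congr_of_eventuallyEq ?_
    filter_upwards [Metric.ball_mem_nhds (0 : Eucl n) hr] with ζ hζ
    rw [h0 ζ (by simpa using hζ), mul_zero]
  · exact (hρ η hη).mul hg.contDiffAt

/-- The Fourier transform of a Schwartz function decays faster than the profile, with a bound by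
finitely many seminorms. -/
theorem exists_norm_fourier_le (n : ℕ) : ∃ (s : Finset (ℕ × ℕ)) (C : ℝ), 0 ≤ C ∧
    ∀ (f : 𝓢(Eucl n, ℂ)) (y : Eucl n), ‖(𝓕 f) y‖ ≤
      C * (∑ i ∈ s, SchwartzMap.seminorm ℝ i.1 i.2 f) * (1 + ‖y‖) ^ (-((n : ℝ) + 1)) := by
  set Q : Seminorm ℝ 𝓢(Eucl n, ℂ) :=
    ((Finset.Iic ((n + 1, 0) : ℕ × ℕ)).sup (fun m => SchwartzMap.seminorm ℝ m.1 m.2)).comp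
      (SchwartzMap.fourierTransformCLM ℝ : 𝓢(Eucl n, ℂ) →L[ℝ] 𝓢(Eucl n, ℂ)).toLinearMap with hQ
  have hQc : Continuous Q := by
    have h1 : Continuous ((Finset.Iic ((n + 1, 0) : ℕ × ℕ)).sup
        (fun m => SchwartzMap.seminorm ℝ m.1 m.2) : Seminorm ℝ 𝓢(Eucl n, ℂ)) := by
      exact Seminorm.continuous_finsetSup fun i _ =>
        (schwartz_withSeminorms ℝ (Eucl n) ℂ).continuous_seminorm i
    exact h1.comp (SchwartzMap.fourierTransformCLM ℝ : 𝓢(Eucl n, ℂ) →L[ℝ] 𝓢(Eucl n, ℂ)).continuous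
  obtain ⟨s, C, -, hsC⟩ := Seminorm.bound_of_continuous (schwartz_withSeminorms ℝ (Eucl n) ℂ) Q hQc
  refine ⟨s, 2 ^ (n + 1) * C, by positivity, fun f y => ?_⟩
  have h1 : Q f ≤ C * ∑ i ∈ s, SchwartzMap.seminorm ℝ i.1 i.2 f := by
    refine (hsC f).trans ?_
    rw [smul_apply, NNReal.smul_def, smul_eq_mul]
    gcongr
    have := Seminorm.finset_sup_le_sum (schwartzSeminormFamily ℝ (Eucl n) ℂ) s f
    rwa [show (∑ i ∈ s, schwartzSeminormFamily ℝ (Eucl n) ℂ i) f =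
      ∑ i ∈ s, schwartzSeminormFamily ℝ (Eucl n) ℂ i f from
        by simp] at this
  have hy := SchwartzMap.one_add_le_sup_seminorm_apply (𝕜 := ℝ) (m := (n + 1, 0)) (k := n + 1)
    (n := 0) le_rfl le_rfl (𝓕 f) y
  rw [norm_iteratedFDeriv_zero] at hy
  have hy' : (1 + ‖y‖) ^ (n + 1) * ‖(𝓕 f) y‖ ≤ 2 ^ (n + 1) * Q f := hy
  have hpy : 0 < 1 + ‖y‖ := by positivity
  have e1 : (1 + ‖y‖) ^ ((n : ℝ) + 1) = (1 + ‖y‖) ^ (n + 1) := by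
    rw [← Real.rpow_natCast]; push_cast; rfl
  rw [Real.rpow_neg hpy.le, e1, ← div_eq_mul_inv, le_div_iff₀ (by positivity), mul_comm ‖_‖,
    mul_assoc]
  exact hy'.trans (by gcongr)

/-- The Schwartz seminorms of `exp(-τ q) g` decay faster than any power of `τ`. -/
theorem exists_seminorm_exp_smul_le {q : Eucl n → ℝ} (hq : ContDiff ℝ ∞ q) {g : Eucl n → ℂ}
    (hg : ContDiff ℝ ∞ g) (hgc : HasCompactSupport g) {c : ℝ} (hc : 0 < c)
    (hqc : ∀ η ∈ tsupport g, c ≤ q η) (G : ℝ → 𝓢(Eucl n, ℂ))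
    (hG : ∀ τ η, G τ η = Real.exp (-τ * q η) • g η) (K k N : ℕ) :
    ∃ C : ℝ, 0 ≤ C ∧ ∀ τ : ℝ, 0 ≤ τ → (1 + τ) ^ K * SchwartzMap.seminorm ℝ k N (G τ) ≤ C := by
  obtain ⟨R, hR⟩ := hgc.isCompact.isBounded.exists_norm_le
  have hR0 : ∀ η ∈ tsupport g, ‖η‖ ≤ |R| := fun η hη => (hR η hη).trans (le_abs_self R)
  obtain ⟨C, hC0, hC⟩ := exists_iteratedFDeriv_exp_smul_le hq hg hgc hc hqc K N
  refine ⟨|R| ^ k * C, by positivity, fun τ hτ => ?_⟩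
  have hGτ : (G τ : Eucl n → ℂ) = fun η => Real.exp (-τ * q η) • g η := funext (hG τ)
  have hpos : 0 < (1 + τ) ^ K := by positivity
  rw [mul_comm, ← le_div_iff₀ hpos]
  refine SchwartzMap.seminorm_le_bound ℝ k N _ (by positivity) fun η => ?_
  rw [le_div_iff₀ hpos, hGτ]
  by_cases hη : η ∈ tsupport g
  · rw [mul_assoc, mul_comm ‖_‖ ((1 + τ) ^ K)]
    gcongr
    · exact hR0 η hη
    · exact hC τ hτ η
  · have hsub : tsupport (fun η => Real.exp (-τ * q η) • g η) ⊆ tsupport g :=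
      tsupport_smul_subset_right _ _
    have : iteratedFDeriv ℝ N (fun η => Real.exp (-τ * q η) • g η) η = 0 := by
      by_contra h
      exact hη (hsub (support_iteratedFDeriv_subset N h))
    rw [this]; simp; positivity

/-- Kernel estimate: a heat-damped homogeneous multiplier applied to a Schwartz function whose
spectrum is compact and avoids a ball around the origin. -/
theorem exists_transposeMultiplier_le {ρ : Eucl n → ℂ} (hρ : IsHomogeneousSymbol ρ)
    {φ : 𝓢(Eucl n, ℂ)} (hcs : HasCompactSupport (𝓕⁻ φ : 𝓢(Eucl n, ℂ))) {r : ℝ} (hr : 0 < r)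
    (h0 : ∀ η, ‖η‖ < r → (𝓕⁻ φ) η = 0) (K : ℕ) :
    ∃ C : ℝ≥0, ∀ τ : ℝ, 0 ≤ τ → ∀ y,
      ‖transposeMultiplier (heatSymbol ρ τ) φ y‖ₑ ≤
        C * ENNReal.ofReal ((1 + τ) ^ K)⁻¹ * prof y := by
  set g : Eucl n → ℂ := fun η => ρ η * (𝓕⁻ φ) η with hg
  set q : Eucl n → ℝ := fun η => (2 * Real.pi * ‖η‖) ^ 2 with hq
  have hgs : ContDiff ℝ ∞ g := contDiff_mul_of_eq_zero_near hρ.smooth ((𝓕⁻ φ).smooth ⊤) hr h0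
  have hqs : ContDiff ℝ ∞ q := by
    have : q = fun η => (2 * Real.pi) ^ 2 * ‖η‖ ^ 2 := by ext η; simp only [hq]; ring
    rw [this]
    exact contDiff_const.mul (contDiff_norm_sq ℝ)
  have hgc : HasCompactSupport g := hcs.mul_left
  have hsupp : ∀ η ∈ tsupport g, (2 * Real.pi * r) ^ 2 ≤ q η := by
    have hcl : IsClosed {η : Eucl n | r ≤ ‖η‖} := isClosed_le continuous_const continuous_norm
    have : tsupport g ⊆ {η : Eucl n | r ≤ ‖η‖} := by
      refine closure_minimal (fun η hη => ?_) hcl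
      by_contra hlt
      exact hη (by simp only [hg, h0 η (not_le.mp hlt), mul_zero])
    intro η hη
    have h1 : r ≤ ‖η‖ := this hη
    have := Real.pi_pos
    simp only [hq]
    gcongr
  have hc : 0 < (2 * Real.pi * r) ^ 2 := by have := Real.pi_pos; positivity
  have hes : ∀ τ, ContDiff ℝ ∞ fun η => Real.exp (-τ * q η) := fun τ =>
    Real.contDiff_exp.comp (contDiff_const.mul hqs)
  have hfs : ∀ τ, ContDiff ℝ ∞ fun η => Real.exp (-τ * q η) • g η := by
    intro τ
    exact (hes τ).smul hgs
  have hfc : ∀ τ, HasCompactSupport fun η => Real.exp (-τ * q η) • g η := by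
    intro τ
    exact HasCompactSupport.smul_left (f := fun η => Real.exp (-τ * q η)) hgc
  obtain ⟨G, hGapp⟩ : ∃ G : ℝ → 𝓢(Eucl n, ℂ), ∀ τ η, G τ η = Real.exp (-τ * q η) • g η :=
    ⟨fun τ => (hfc τ).toSchwartzMap (hfs τ), fun _ _ => rfl⟩
  have heq : ∀ τ y, transposeMultiplier (heatSymbol ρ τ) φ y = (𝓕 (G τ)) y := by
    intro τ y
    rw [SchwartzMap.fourier_coe]
    unfold transposeMultiplier
    refine congrFun (congrArg _ (funext fun η => ?_)) y
    rw [hGapp]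
    simp only [heatSymbol, hg, hq, Complex.real_smul]
    push_cast
    ring_nf
  obtain ⟨s, C, hC, hsC⟩ := exists_norm_fourier_le n
  choose B hB0 hB using exists_seminorm_exp_smul_le hqs hgs hgc hc hsupp G hGapp K
  set T : ℝ := C * ∑ i ∈ s, B i.1 i.2 with hT
  have hT0 : 0 ≤ T := mul_nonneg hC (Finset.sum_nonneg fun i _ => hB0 _ _)
  refine ⟨T.toNNReal, fun τ hτ y => ?_⟩
  have hpos : 0 < (1 + τ) ^ K := by positivity
  have hmain : ‖(𝓕 (G τ)) y‖ ≤ T * ((1 + τ) ^ K)⁻¹ * (1 + ‖y‖) ^ (-((n : ℝ) + 1)) := by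
    refine (hsC (G τ) y).trans (mul_le_mul_of_nonneg_right ?_ (by positivity))
    rw [← div_eq_mul_inv, le_div_iff₀ hpos, mul_assoc, Finset.sum_mul, hT]
    gcongr with i _
    rw [mul_comm]
    exact hB i.1 i.2 τ hτ
  rw [heq, prof, ← ENNReal.ofReal, ← ENNReal.ofReal_mul hT0, ← ENNReal.ofReal_mul (by positivity),
    ← ofReal_norm]
  exact ENNReal.ofReal_le_ofReal hmain

end HeatKernel

/-! ### Spectra of the Meyer wavelets -/

section Spectrum

variable {n : ℕ} (M : MeyerFunction)

theorem band_eq_zero {ξ : ℝ} (h : |ξ| ≤ 2 * Real.pi / 3) : band M.Φ ξ = 0 := by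
  have h1 := M.eq_one ξ h
  have h2 := M.eq_one (ξ / 2) (by rw [abs_div, abs_two]; linarith [abs_nonneg ξ])
  simp [band, h1, h2]

theorem abs_le_of_symbol_ne_zero {e : Fin 2} {y : ℝ} (h : M.symbol e (2 * Real.pi * y) ≠ 0) :
    |y| ≤ 4 / 3 := by
  have hpi := Real.pi_pos
  by_contra hlt
  refine h (M.symbol_eq_zero e ?_)
  rw [abs_mul, abs_of_pos (by positivity : (0 : ℝ) < 2 * Real.pi)]
  nlinarith [not_le.mp hlt]

theorem abs_le_of_symbol_zero_ne_zero {y : ℝ} (h : M.symbol 0 (2 * Real.pi * y) ≠ 0) :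
    |y| ≤ 2 / 3 := by
  have hpi := Real.pi_pos
  have h1 : M.Φ (2 * Real.pi * y) ≠ 0 := by
    intro h0
    exact h (by simp [MeyerFunction.symbol, h0])
  have := M.support_subset _ h1
  rw [abs_mul, abs_of_pos (by positivity : (0 : ℝ) < 2 * Real.pi)] at this
  by_contra hlt
  nlinarith [not_le.mp hlt]

theorem lt_abs_of_symbol_ne_zero {e : Fin 2} (he : e ≠ 0) {y : ℝ}
    (h : M.symbol e (2 * Real.pi * y) ≠ 0) : 1 / 3 < |y| := by
  have hpi := Real.pi_pos
  by_contra hlt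
  refine h ?_
  have : band M.Φ (2 * Real.pi * y) = 0 := by
    refine band_eq_zero M ?_
    rw [abs_mul, abs_of_pos (by positivity : (0 : ℝ) < 2 * Real.pi)]
    nlinarith [not_lt.mp hlt]
  simp [MeyerFunction.symbol, he, this]

theorem symbol_ne_zero_of_symbolProd {ε : Fin n → Fin 2} {η : Eucl n} (h : M.symbolProd ε η ≠ 0)
    (i : Fin n) : M.symbol (ε i) (2 * Real.pi * η i) ≠ 0 :=
  (Finset.prod_ne_zero_iff.mp h) i (Finset.mem_univ i)

theorem fourier_mother (ε : Fin n → Fin 2) (η : Eucl n) :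
    (𝓕 (M.mother ε)) η = M.symbolProd ε η := by
  unfold MeyerFunction.mother
  rw [FourierTransform.fourier_fourierInv_eq]
  rfl

theorem fourierInv_apply_eq_fourier_neg (f : 𝓢(Eucl n, ℂ)) (η : Eucl n) :
    (𝓕⁻ f) η = (𝓕 f) (-η) := by
  rw [SchwartzMap.fourierInv_apply_eq]; rfl

theorem fourierInv_mother (ε : Fin n → Fin 2) (η : Eucl n) :
    (𝓕⁻ (M.mother ε)) η = M.symbolProd ε (-η) := by
  rw [fourierInv_apply_eq_fourier_neg, fourier_mother]

/-- The spectrum of a Schwartz function is compact and avoids a ball around the origin. -/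
def HasAnnularSpectrum (φ : 𝓢(Eucl n, ℂ)) : Prop :=
  HasCompactSupport (𝓕⁻ φ : 𝓢(Eucl n, ℂ)) ∧ ∃ r : ℝ, 0 < r ∧ ∀ η, ‖η‖ < r → (𝓕⁻ φ) η = 0

theorem hasAnnularSpectrum_mother {ε : Fin n → Fin 2} (hε : ε ≠ 0) :
    HasAnnularSpectrum (M.mother ε) := by
  refine ⟨?_, 1 / 3, by norm_num, fun η hη => ?_⟩
  · have : ((𝓕⁻ (M.mother ε) : 𝓢(Eucl n, ℂ)) : Eucl n → ℂ) =
        M.symbolProd ε ∘ (Homeomorph.neg (Eucl n)) := by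
      ext η; exact fourierInv_mother M ε η
    rw [this]
    exact (M.symbolProd_hasCompactSupport ε).comp_homeomorph _
  · rw [fourierInv_mother]
    by_contra h
    obtain ⟨i, hi⟩ := Function.ne_iff.mp hε
    have h1 := lt_abs_of_symbol_ne_zero M hi (symbol_ne_zero_of_symbolProd M h i)
    have h2 : |(-η) i| ≤ ‖η‖ := by
      rw [← norm_neg η, ← Real.norm_eq_abs]; exact PiLp.norm_apply_le _ i
    linarith

/-- The kernel estimate, rescaled to wavelets: a factor `2^j` for the derivative, rapid decay in
`4^j τ`, and concentration near the point `2^{-j} k`. -/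
theorem exists_transposeMultiplier_wavelet_le {ρ : Eucl n → ℂ} (hρ : IsHomogeneousSymbol ρ)
    (K : ℕ) : ∃ C : ℝ≥0, ∀ (ε : Dir n) (τ : ℝ), 0 ≤ τ → ∀ (j : ℤ) (k : Fin n → ℤ) (x : Eucl n),
      ‖transposeMultiplier (heatSymbol ρ τ) (M.wavelet ε j k) x‖ₑ ≤
        C * 2 ^ (j : ℝ) * ENNReal.ofReal ((1 + 4 ^ j * τ) ^ K)⁻¹ *
          (2 ^ ((n : ℝ) * j / 2) * prof ((2 : ℝ) ^ j • x - lat k)) := by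
  have h : ∀ ε : Dir n, ∃ C : ℝ≥0, ∀ τ : ℝ, 0 ≤ τ → ∀ y,
      ‖transposeMultiplier (heatSymbol ρ τ) (M.mother ε.1) y‖ₑ ≤
        C * ENNReal.ofReal ((1 + τ) ^ K)⁻¹ * prof y := by
    intro ε
    obtain ⟨hc, r, hr, h0⟩ := hasAnnularSpectrum_mother M ε.2
    exact exists_transposeMultiplier_le hρ hc hr h0 K
  choose C hC using h
  refine ⟨∑ ε, C ε, fun ε τ hτ j k x => ?_⟩
  rw [MeyerFunction.wavelet_eq_atom, transposeMultiplier_atom hρ, enorm_mul]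
  have h1 := hC ε (4 ^ j * τ) (by positivity) ((2 : ℝ) ^ j • x - lat k)
  have h2 : (C ε : ℝ≥0∞) ≤ ((∑ ε, C ε : ℝ≥0) : ℝ≥0∞) := by
    exact_mod_cast Finset.single_le_sum (fun i _ => zero_le) (Finset.mem_univ ε)
  rw [Complex.ofReal_mul, enorm_mul, enorm_two_rpow, enorm_two_rpow]
  calc _ ≤ 2 ^ (j : ℝ) * 2 ^ ((n : ℝ) * j / 2) * (((∑ ε, C ε : ℝ≥0) : ℝ≥0∞) *
        ENNReal.ofReal ((1 + 4 ^ j * τ) ^ K)⁻¹ * prof ((2 : ℝ) ^ j • x - lat k)) := by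
        gcongr
        exact h1.trans (by gcongr)
    _ = _ := by ring

theorem exists_tsum_enorm_wavelet_le (n : ℕ) : ∃ C : ℝ≥0, ∀ (ε : Fin n → Fin 2) (j : ℤ)
    (x : Eucl n), ∑' k : Fin n → ℤ, ‖M.wavelet ε j k x‖ₑ ≤ C * 2 ^ ((n : ℝ) * j / 2) := by
  choose C hC using fun ε : Fin n → Fin 2 => exists_tsum_enorm_atom_le (M.mother ε)
  refine ⟨∑ ε, C ε, fun ε j x => (hC ε j x).trans ?_⟩
  gcongr
  exact Finset.single_le_sum (fun i _ => zero_le) (Finset.mem_univ ε)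

theorem exists_enorm_wavelet_le (n : ℕ) : ∃ C : ℝ≥0, ∀ (ε : Fin n → Fin 2) (j : ℤ)
    (k : Fin n → ℤ) (x : Eucl n), ‖M.wavelet ε j k x‖ₑ ≤
      C * 2 ^ ((n : ℝ) * j / 2) * prof ((2 : ℝ) ^ j • x - lat k) := by
  choose C hC using fun ε : Fin n → Fin 2 => exists_enorm_le_prof (M.mother ε)
  refine ⟨∑ ε, C ε, fun ε j k x => ?_⟩
  rw [MeyerFunction.wavelet_eq_atom, enorm_atom]
  have h2 : (C ε : ℝ≥0∞) ≤ ((∑ ε, C ε : ℝ≥0) : ℝ≥0∞) := by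
    exact_mod_cast Finset.single_le_sum (fun i _ => zero_le) (Finset.mem_univ ε)
  calc _ ≤ 2 ^ ((n : ℝ) * j / 2) * (((∑ ε, C ε : ℝ≥0) : ℝ≥0∞) *
        prof ((2 : ℝ) ^ j • x - lat k)) := by
        gcongr
        exact (hC ε _).trans (by gcongr)
    _ = _ := by ring

theorem exists_lintegral_enorm_wavelet_le (n : ℕ) : ∃ C : ℝ≥0, ∀ (ε : Fin n → Fin 2) (j : ℤ)
    (k : Fin n → ℤ), ∫⁻ x, ‖M.wavelet ε j k x‖ₑ ≤ C * 2 ^ (-((n : ℝ) * j / 2)) := by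
  refine ⟨∑ ε : Fin n → Fin 2, (∫⁻ x, ‖M.mother ε x‖ₑ).toNNReal, fun ε j k => ?_⟩
  rw [MeyerFunction.wavelet_eq_atom, lintegral_enorm_atom, mul_comm]
  gcongr
  have : ∫⁻ x, ‖M.mother ε x‖ₑ ≠ ⊤ := (M.mother ε).integrable.2.ne
  rw [← ENNReal.coe_toNNReal this]
  exact_mod_cast Finset.single_le_sum (f := fun ε => (∫⁻ x, ‖M.mother ε x‖ₑ).toNNReal)
    (fun i _ => zero_le) (Finset.mem_univ ε)

end Spectrum

/-! ### Wavelet coefficients of Schwartz functions -/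

section TestCoeff

variable {n : ℕ} (M : MeyerFunction)

/-- Without vanishing moments, the coefficients at a scale are bounded by the `L¹` norm. -/
theorem exists_tsum_atom_coeff_le (φ : 𝓢(Eucl n, ℂ)) : ∃ C : ℝ≥0, ∀ (j : ℤ) (ψ : 𝓢(Eucl n, ℂ)),
    ∑' k : Fin n → ℤ, ‖∫ x, atom φ j k x * ψ x‖ₑ ≤ C * 2 ^ ((n : ℝ) * j / 2) * ∫⁻ x, ‖ψ x‖ₑ := by
  obtain ⟨C, hC⟩ := exists_tsum_enorm_atom_le φ
  refine ⟨C, fun j ψ => ?_⟩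
  calc ∑' k : Fin n → ℤ, ‖∫ x, atom φ j k x * ψ x‖ₑ
      ≤ ∑' k : Fin n → ℤ, ∫⁻ x, ‖atom φ j k x‖ₑ * ‖ψ x‖ₑ := by
        refine ENNReal.tsum_le_tsum fun k => (enorm_integral_le_lintegral_enorm _).trans_eq ?_
        simp only [enorm_mul]
    _ = ∫⁻ x, (∑' k : Fin n → ℤ, ‖atom φ j k x‖ₑ) * ‖ψ x‖ₑ := by
        have hm : ∀ k : Fin n → ℤ, AEMeasurable (fun x => ‖atom φ j k x‖ₑ * ‖ψ x‖ₑ) volume :=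
          fun k => ((atom φ j k).continuous.enorm.measurable.mul
            ψ.continuous.enorm.measurable).aemeasurable
        rw [← lintegral_tsum hm]
        simp only [ENNReal.tsum_mul_right]
    _ ≤ ∫⁻ x, (C * 2 ^ ((n : ℝ) * j / 2)) * ‖ψ x‖ₑ := by
        gcongr with x
        exact hC j x
    _ = _ := lintegral_const_mul _ ψ.continuous.enorm.measurable

/-- The power `(-Δ/4π²)^N` of the Laplacian, as a Fourier multiplier. -/
def lapPow (n N : ℕ) : 𝓢(Eucl n, ℂ) →L[ℂ] 𝓢(Eucl n, ℂ) :=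
  SchwartzMap.fourierMultiplierCLM ℂ (fun η : Eucl n => ((‖η‖ ^ 2 : ℝ) : ℂ) ^ N)

theorem fourier_lapPow (N : ℕ) (ψ : 𝓢(Eucl n, ℂ)) (η : Eucl n) :
    (𝓕 (lapPow n N ψ)) η = ((‖η‖ ^ 2 : ℝ) : ℂ) ^ N * (𝓕 ψ) η := by
  have hg : (fun η : Eucl n => ((‖η‖ ^ 2 : ℝ) : ℂ) ^ N).HasTemperateGrowth := by
    fun_prop
  rw [lapPow, SchwartzMap.fourierMultiplierCLM_apply, FourierTransform.fourier_fourierInv_eq,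
    SchwartzMap.smulLeftCLM_apply_apply hg, smul_eq_mul]

theorem integral_mul_eq_fourier (f g : 𝓢(Eucl n, ℂ)) :
    ∫ x, f x * g x = ∫ η, (𝓕⁻ f) η * (𝓕 g) η := by
  have := SchwartzMap.integral_fourierInv_mul_eq f (𝓕 g)
  rw [FourierTransform.fourierInv_fourier_eq] at this
  exact this.symm

/-- Vanishing moments: coefficients against functions with annular spectrum gain powers of the
scale at the price of derivatives of the test function. -/
theorem exists_atom_coeff_eq {φ : 𝓢(Eucl n, ℂ)} (h : HasAnnularSpectrum φ) (N : ℕ) :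
    ∃ φ' : 𝓢(Eucl n, ℂ), ∀ (j : ℤ) (k : Fin n → ℤ) (ψ : 𝓢(Eucl n, ℂ)),
      ∫ x, atom φ j k x * ψ x =
        ((2 : ℝ) ^ (-(2 * N * j : ℝ)) : ℝ) * ∫ x, atom φ' j k x * lapPow n N ψ x := by
  obtain ⟨hc, r, hr, h0⟩ := h
  set g : Eucl n → ℂ := fun η => (((‖η‖ ^ 2 : ℝ) : ℂ) ^ N)⁻¹ * (𝓕⁻ φ) η with hg
  have hgs : ContDiff ℝ ∞ g := by
    refine contDiff_mul_of_eq_zero_near (fun η hη => ?_) ((𝓕⁻ φ).smooth ⊤) hr h0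
    refine ContDiffAt.inv ?_ ?_
    · exact (Complex.ofRealCLM.contDiff.contDiffAt.comp η (contDiff_norm_sq ℝ).contDiffAt).pow N
    · simp [hη]
  have hgc : HasCompactSupport g := HasCompactSupport.mul_left hc
  refine ⟨𝓕 (hgc.toSchwartzMap hgs), fun j k ψ => ?_⟩
  have hφ : ∀ η, (𝓕⁻ φ) η = ((‖η‖ ^ 2 : ℝ) : ℂ) ^ N * g η := by
    intro η
    rcases eq_or_ne η 0 with rfl | hη
    · -- at the origin the inverse is a junk value, but `𝓕⁻ φ` vanishes there
      have : (𝓕⁻ φ) 0 = 0 := h0 0 (by simpa using hr)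
      simp [hg, this]
    · simp only [hg]
      rw [← mul_assoc, mul_inv_cancel₀, one_mul]
      simp [hη]
  rw [integral_mul_eq_fourier (atom φ j k), integral_mul_eq_fourier (atom _ j k),
    ← integral_const_mul]
  congr 1 with η
  rw [fourierInv_atom, fourierInv_atom, fourier_lapPow, FourierTransform.fourierInv_fourier_eq,
    hφ, HasCompactSupport.toSchwartzMap_toFun, norm_smul, Real.norm_of_nonneg (by positivity)]
  have : (2 : ℝ) ^ (-(2 * N * j : ℝ)) = (((2 : ℝ) ^ (-j)) ^ 2) ^ N := by
    rw [← pow_mul, ← Real.rpow_natCast, ← Real.rpow_intCast, ← Real.rpow_mul two_pos.le]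
    congr 1; push_cast; ring
  rw [this, mul_pow]
  push_cast
  ring

theorem exists_lintegral_enorm_le_seminorm (n : ℕ) : ∃ P : Seminorm ℝ 𝓢(Eucl n, ℂ), Continuous P ∧
    ∀ ψ : 𝓢(Eucl n, ℂ), ∫⁻ x, ‖ψ x‖ₑ ≤ ENNReal.ofReal (P ψ) := by
  obtain ⟨k, C, hC⟩ := SchwartzMap.eLpNorm_le_seminorm (E := Eucl n) ℝ ℂ 1 volume
  have h1 : Continuous ((Finset.Iic ((k, 0) : ℕ × ℕ)).sup
        (schwartzSeminormFamily ℝ (Eucl n) ℂ) : Seminorm ℝ 𝓢(Eucl n, ℂ)) :=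
      Seminorm.continuous_finsetSup fun i _ =>
        (schwartz_withSeminorms ℝ (Eucl n) ℂ).continuous_seminorm i
  refine ⟨C • (Finset.Iic (k, 0)).sup (schwartzSeminormFamily ℝ (Eucl n) ℂ), ?_, fun ψ => ?_⟩
  · exact h1.const_smul C
  · have := hC ψ
    rw [eLpNorm_one_eq_lintegral_enorm] at this
    refine this.trans_eq ?_
    rw [smul_apply, NNReal.smul_def, smul_eq_mul, ENNReal.ofReal_mul C.coe_nonneg,
      ENNReal.ofReal_coe_nnreal]

/-- The wavelet coefficients of a Schwartz function at level `j` are summable, with rapid decay as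
`j → ∞`. -/
theorem exists_tsum_wavelet_coeff_le (n N : ℕ) : ∃ P : Seminorm ℝ 𝓢(Eucl n, ℂ), Continuous P ∧
    ∀ (ε : Dir n) (j : ℤ) (ψ : 𝓢(Eucl n, ℂ)),
      ∑' k : Fin n → ℤ, ‖∫ x, M.wavelet ε j k x * ψ x‖ₑ ≤
        2 ^ ((n : ℝ) * j / 2) * 2 ^ (-(2 * N * max (j : ℝ) 0)) * ENNReal.ofReal (P ψ) := by
  obtain ⟨P, hP, hPle⟩ := exists_lintegral_enorm_le_seminorm n
  choose C hC using fun ε : Dir n => exists_tsum_atom_coeff_le (M.mother ε.1)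
  choose φ' hφ' using fun ε : Dir n => exists_atom_coeff_eq (hasAnnularSpectrum_mother M ε.2) N
  choose C' hC' using fun ε : Dir n => exists_tsum_atom_coeff_le (φ' ε)
  set B : ℝ≥0 := ∑ ε, (C ε + C' ε) with hB
  have hCB : ∀ ε, C ε ≤ B := fun ε => (le_add_of_nonneg_right zero_le).trans
    (Finset.single_le_sum (f := fun ε => C ε + C' ε) (fun i _ => zero_le) (Finset.mem_univ ε))
  have hCB' : ∀ ε, C' ε ≤ B := fun ε => (le_add_of_nonneg_left zero_le).trans
    (Finset.single_le_sum (f := fun ε => C ε + C' ε) (fun i _ => zero_le) (Finset.mem_univ ε))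
  set Q : Seminorm ℝ 𝓢(Eucl n, ℂ) :=
    P.comp ((lapPow n N).restrictScalars ℝ).toLinearMap with hQ
  have hQc : Continuous Q := hP.comp (lapPow n N).continuous
  refine ⟨B • (P + Q), (hP.add hQc).const_smul B, fun ε j ψ => ?_⟩
  have hPQ : ENNReal.ofReal ((B • (P + Q)) ψ) =
      B * (ENNReal.ofReal (P ψ) + ENNReal.ofReal (Q ψ)) := by
    rw [smul_apply, NNReal.smul_def, smul_eq_mul, ENNReal.ofReal_mul B.coe_nonneg,
      ENNReal.ofReal_coe_nnreal, add_apply,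
      ENNReal.ofReal_add (apply_nonneg _ _) (apply_nonneg _ _)]
  rw [hPQ]
  rcases le_total (j : ℝ) 0 with hj | hj
  · rw [max_eq_right hj, mul_zero, neg_zero, ENNReal.rpow_zero, mul_one]
    calc _ ≤ C ε * 2 ^ ((n : ℝ) * j / 2) * ∫⁻ x, ‖ψ x‖ₑ := hC ε j ψ
      _ ≤ B * 2 ^ ((n : ℝ) * j / 2) * (ENNReal.ofReal (P ψ) + ENNReal.ofReal (Q ψ)) := by
          gcongr
          · exact hCB ε
          · exact (hPle ψ).trans le_self_add
      _ = _ := by ring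
  · rw [max_eq_left hj]
    have h1 : ∀ k, ‖∫ x, M.wavelet ε j k x * ψ x‖ₑ =
        2 ^ (-(2 * N * j : ℝ)) * ‖∫ x, atom (φ' ε) j k x * lapPow n N ψ x‖ₑ := by
      intro k
      rw [MeyerFunction.wavelet_eq_atom, hφ' ε j k ψ, enorm_mul, enorm_two_rpow]
    simp only [h1]
    rw [ENNReal.tsum_mul_left]
    calc _ ≤ 2 ^ (-(2 * N * j : ℝ)) * (C' ε * 2 ^ ((n : ℝ) * j / 2) *
          ∫⁻ x, ‖lapPow n N ψ x‖ₑ) := by gcongr; exact hC' ε j _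
      _ ≤ 2 ^ (-(2 * N * j : ℝ)) * (B * 2 ^ ((n : ℝ) * j / 2) *
          (ENNReal.ofReal (P ψ) + ENNReal.ofReal (Q ψ))) := by
          gcongr
          · exact hCB' ε
          · exact (hPle (lapPow n N ψ)).trans le_add_self
      _ = _ := by ring

end TestCoeff

/-! ### Poisson summation on `ℤⁿ` -/

section Poisson

variable {n : ℕ}

theorem summable_of_tsum_enorm_ne_top {ι E : Type*} [NormedAddCommGroup E] [CompleteSpace E]
    {f : ι → E} (h : ∑' i, ‖f i‖ₑ ≠ ⊤) : Summable f := by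
  refine Summable.of_nnnorm ?_
  exact ENNReal.tsum_coe_ne_top_iff_summable.mp h

/-- The profile is slowly varying, by Peetre's inequality. -/
theorem prof_le_mul_prof (a b : Eucl n) :
    prof a ≤ ENNReal.ofReal ((1 + ‖a - b‖) ^ ((n : ℝ) + 1)) * prof b := by
  unfold prof
  rw [← ENNReal.ofReal_mul (by positivity)]
  refine ENNReal.ofReal_le_ofReal ?_
  have h1 : 1 + ‖b‖ ≤ (1 + ‖a - b‖) * (1 + ‖a‖) := by
    have : ‖b‖ ≤ ‖a‖ + ‖a - b‖ := by
      calc ‖b‖ = ‖a - (a - b)‖ := by congr 1; abel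
        _ ≤ _ := norm_sub_le _ _
    nlinarith [norm_nonneg a, norm_nonneg (a - b)]
  have h2 := Real.rpow_le_rpow_of_nonpos (z := -((n : ℝ) + 1)) (by positivity) h1
    (by linarith [(Nat.cast_nonneg n : (0 : ℝ) ≤ n)])
  rw [Real.mul_rpow (by positivity) (by positivity)] at h2
  calc (1 + ‖a‖) ^ (-((n : ℝ) + 1)) = (1 + ‖a - b‖) ^ ((n : ℝ) + 1) *
        ((1 + ‖a - b‖) ^ (-((n : ℝ) + 1)) * (1 + ‖a‖) ^ (-((n : ℝ) + 1))) := by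
        rw [← mul_assoc, ← Real.rpow_add (by positivity), add_neg_cancel, Real.rpow_zero, one_mul]
    _ ≤ _ := by gcongr

theorem tsum_prof_lat_ne_top : ∑' k : Fin n → ℤ, prof (lat k) ≠ ⊤ := by
  obtain ⟨C, hC⟩ := exists_tsum_prof_le n
  have h := hC 0
  rw [← (Equiv.neg (Fin n → ℤ)).tsum_eq (fun k => prof (0 - lat k))] at h
  have : ∀ k : Fin n → ℤ, (0 : Eucl n) - lat ((Equiv.neg (Fin n → ℤ)) k) = lat k := by
    intro k; ext i; simp
  simp only [this] at h
  exact (h.trans_lt ENNReal.coe_lt_top).ne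

theorem lat_add (k l : Fin n → ℤ) : lat (k + l) = lat k + lat l := by
  ext i; simp

theorem continuous_tsum_translate (H : 𝓢(Eucl n, ℂ)) :
    Continuous fun y : Eucl n => ∑' l : Fin n → ℤ, H (y + lat l) := by
  obtain ⟨C, hC⟩ := exists_enorm_le_prof H
  rw [continuous_iff_continuousAt]
  intro y₀
  set R : ℝ := ‖y₀‖ + 1
  have hon : ContinuousOn (fun y : Eucl n => ∑' l : Fin n → ℤ, H (y + lat l))
      (Metric.ball 0 R) := by
    refine continuousOn_tsum (u := fun l => ((C : ℝ≥0∞) *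
      (ENNReal.ofReal ((1 + R) ^ ((n : ℝ) + 1)) * prof (lat l))).toReal)
      (fun l => (H.continuous.comp (continuous_id.add continuous_const)).continuousOn) ?_ ?_
    · refine ENNReal.summable_toReal ?_
      rw [ENNReal.tsum_mul_left, ENNReal.tsum_mul_left]
      exact ENNReal.mul_ne_top ENNReal.coe_ne_top
        (ENNReal.mul_ne_top ENNReal.ofReal_ne_top tsum_prof_lat_ne_top)
    · intro l y hy
      have hy' : ‖y‖ < R := by simpa using hy
      rw [← toReal_enorm]
      refine ENNReal.toReal_mono (ENNReal.mul_ne_top ENNReal.coe_ne_top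
        (ENNReal.mul_ne_top ENNReal.ofReal_ne_top (prof_ne_top _))) ((hC _).trans ?_)
      gcongr
      refine (prof_le_mul_prof _ (lat l)).trans ?_
      rw [add_sub_cancel_right]
      gcongr
  exact hon.continuousAt (Metric.isOpen_ball.mem_nhds (by simp [R]))

theorem iUnion_Ioc_box : ⋃ l : Fin n → ℤ,
    {x : Fin n → ℝ | ∀ i, x i ∈ Ioc (l i : ℝ) (l i + 1)} = univ := by
  refine eq_univ_of_forall fun x => mem_iUnion.mpr ⟨fun i => ⌈x i⌉ - 1, fun i => ?_⟩
  have h1 := Int.ceil_lt_add_one (x i)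
  have h2 := Int.le_ceil (x i)
  push_cast
  constructor <;> linarith

theorem pairwise_disjoint_Ioc_box : Pairwise (Function.onFun Disjoint
    fun l : Fin n → ℤ => {x : Fin n → ℝ | ∀ i, x i ∈ Ioc (l i : ℝ) (l i + 1)}) := by
  intro l l' hl
  refine Set.disjoint_left.mpr fun x hx hx' => hl (funext fun i => ?_)
  have h1 := hx i
  have h2 := hx' i
  have h3 : (l i : ℝ) < l' i + 1 := h1.1.trans_le h2.2
  have h4 : (l' i : ℝ) < l i + 1 := h2.1.trans_le h1.2
  have h3' : l i < l' i + 1 := by exact_mod_cast h3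
  have h4' : l' i < l i + 1 := by exact_mod_cast h4
  omega

theorem measurableSet_Ioc_box (l : Fin n → ℤ) :
    MeasurableSet {x : Fin n → ℝ | ∀ i, x i ∈ Ioc (l i : ℝ) (l i + 1)} :=
  MeasurableSet.univ_pi' fun _ => measurableSet_Ioc

/-- The integral over space as a sum over the translates of the unit box. -/
theorem hasSum_integral_box {E : Type*} [NormedAddCommGroup E] [NormedSpace ℝ E]
    {g : (Fin n → ℝ) → E} (hg : Integrable g) :
    HasSum (fun l : Fin n → ℤ => ∫ x in {x : Fin n → ℝ | ∀ i, x i ∈ Ioc (0 : ℝ) (0 + 1)},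
      g (x + fun i => (l i : ℝ))) (∫ x, g x) := by
  have h := hasSum_integral_iUnion (f := g) (μ := volume) measurableSet_Ioc_box
    pairwise_disjoint_Ioc_box hg.integrableOn
  rw [iUnion_Ioc_box, Measure.restrict_univ] at h
  convert h using 2 with l
  have hpre : {x : Fin n → ℝ | ∀ i, x i ∈ Ioc (0 : ℝ) (0 + 1)} =
      (fun x => x + fun i => (l i : ℝ)) ⁻¹' {x : Fin n → ℝ | ∀ i, x i ∈ Ioc (l i : ℝ) (l i + 1)} := by
    ext x
    simp only [mem_ofPred_eq, mem_preimage, Pi.add_apply, mem_Ioc]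
    refine forall_congr' fun i => ?_
    constructor <;> rintro ⟨h1, h2⟩ <;> constructor <;> linarith
  rw [hpre]
  exact (measurePreserving_add_right volume (fun i => (l i : ℝ))).setIntegral_preimage_emb
    (measurableEmbedding_addRight _) g _

theorem mFourier_coe (k : Fin n → ℤ) (x : Fin n → ℝ) :
    UnitAddTorus.mFourier k (fun i => (x i : UnitAddCircle)) =
      Complex.exp (↑(2 * Real.pi * inner ℝ (lat k) (WithLp.toLp 2 x : Eucl n)) * Complex.I) := by
  simp only [UnitAddTorus.mFourier, ContinuousMap.coe_mk, fourier_coe_apply]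
  rw [← Complex.exp_sum]
  congr 1
  simp only [PiLp.inner_apply, lat_apply, RCLike.inner_apply, conj_trivial]
  push_cast
  rw [Finset.mul_sum, Finset.sum_mul]
  refine Finset.sum_congr rfl fun i _ => ?_
  simp
  ring

/-- Poisson summation for Schwartz functions on `ℝⁿ`. -/
theorem hasSum_poisson (H : 𝓢(Eucl n, ℂ)) (y : Eucl n) :
    HasSum (fun k : Fin n → ℤ => (𝓕 H) (lat k) *
      Complex.exp (↑(2 * Real.pi * inner ℝ (lat k) y) * Complex.I))
      (∑' l : Fin n → ℤ, H (y + lat l)) := by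
  -- the periodization of `H`
  set G : (Fin n → ℝ) → ℂ := fun x => ∑' l : Fin n → ℤ, H (WithLp.toLp 2 x + lat l) with hG
  have hGc : Continuous G :=
    (continuous_tsum_translate H).comp (PiLp.continuous_toLp 2 _)
  have hq : IsOpenQuotientMap (Pi.map fun _ : Fin n => ((↑) : ℝ → UnitAddCircle)) :=
    IsOpenQuotientMap.piMap fun _ => QuotientAddGroup.isOpenQuotientMap_mk
  have hper : ∀ a b : Fin n → ℝ, (Pi.map fun _ : Fin n => ((↑) : ℝ → UnitAddCircle)) a =
      (Pi.map fun _ : Fin n => ((↑) : ℝ → UnitAddCircle)) b → G a = G b := by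
    intro a b hab
    have hz : ∀ i, ∃ z : ℤ, a i - b i = z := by
      intro i
      have : ((a i : ℝ) : UnitAddCircle) = (b i : ℝ) := congrFun hab i
      have h0 : ((a i - b i : ℝ) : UnitAddCircle) = 0 := by
        rw [AddCircle.coe_sub, this, sub_self]
      obtain ⟨z, hz⟩ := (AddCircle.coe_eq_zero_iff (1 : ℝ)).mp h0
      exact ⟨z, by rw [← hz]; simp⟩
    choose z hz using hz
    have : (WithLp.toLp 2 a : Eucl n) = WithLp.toLp 2 b + lat z := by
      ext i; simp [← hz i]
    simp only [hG]
    rw [this, ← (Equiv.addLeft z).tsum_eq (fun l => H (WithLp.toLp 2 b + lat l))]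
    simp only [Equiv.coe_addLeft, lat_add, add_assoc]
  -- it descends to a continuous function on the torus, `ℝⁿ → (ℝ/ℤ)ⁿ` being an open quotient map
  obtain ⟨f, hf⟩ : ∃ f : C(UnitAddTorus (Fin n), ℂ), ∀ x : Fin n → ℝ,
      f (fun i => (x i : UnitAddCircle)) = G x := by
    have hcomp : (fun t => G (Function.surjInv hq.surjective t)) ∘
        (Pi.map fun _ : Fin n => ((↑) : ℝ → UnitAddCircle)) = G :=
      funext fun x => hper _ _ (Function.surjInv_eq hq.surjective _)
    refine ⟨⟨fun t => G (Function.surjInv hq.surjective t), ?_⟩, fun x => congrFun hcomp x⟩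
    rw [hq.isQuotientMap.continuous_iff, hcomp]
    exact hGc
  set g : (Fin n → ℤ) → (Fin n → ℝ) → ℂ := fun k x =>
    UnitAddTorus.mFourier (-k) (fun i => (x i : UnitAddCircle)) * H (WithLp.toLp 2 x) with hg
  have hgc : ∀ k, Continuous (g k) := by
    intro k
    refine Continuous.mul ((UnitAddTorus.mFourier (-k)).continuous.comp ?_)
      (H.continuous.comp (PiLp.continuous_toLp 2 _))
    exact continuous_pi fun i => (AddCircle.continuous_mk' 1).comp (continuous_apply i)
  have hmnorm : ∀ k t, ‖UnitAddTorus.mFourier (d := Fin n) k t‖ = 1 := by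
    intro k t
    simp only [UnitAddTorus.mFourier, ContinuousMap.coe_mk, fourier_apply, norm_prod]
    exact Finset.prod_eq_one fun i _ => Circle.norm_coe _
  have hHint : Integrable fun x : Fin n → ℝ => H (WithLp.toLp 2 x) :=
    ((PiLp.volume_preserving_toLp (Fin n)).integrable_comp_emb
      (MeasurableEquiv.toLp 2 (Fin n → ℝ)).measurableEmbedding).mpr H.integrable
  have hgint : ∀ k, Integrable (g k) := by
    intro k
    refine hHint.norm.mono' (hgc k).aestronglyMeasurable (Filter.Eventually.of_forall fun x => ?_)
    simp only [hg, norm_mul, hmnorm, one_mul, le_refl]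
  have hgshift : ∀ k x (l : Fin n → ℤ), g k (x + fun i => (l i : ℝ)) =
      UnitAddTorus.mFourier (-k) (fun i => (x i : UnitAddCircle)) *
        H (WithLp.toLp 2 x + lat l) := by
    intro k x l
    simp only [hg]
    congr 2
    funext i
    have : (((l i : ℤ) : ℝ) : UnitAddCircle) = 0 :=
      (AddCircle.coe_eq_zero_iff (1 : ℝ)).mpr ⟨l i, by simp⟩
    rw [Pi.add_apply, AddCircle.coe_add, this, add_zero]
  have hfour : ∀ k, ∫ x, g k x = (𝓕 H) (lat k) := by
    intro k
    rw [SchwartzMap.fourier_coe, Real.fourier_eq',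
      ← (PiLp.volume_preserving_toLp (Fin n)).integral_comp
        (MeasurableEquiv.toLp 2 (Fin n → ℝ)).measurableEmbedding]
    congr 1 with x
    simp only [hg, mFourier_coe, smul_eq_mul]
    have e : lat (-k) = -lat k := by ext i; simp
    rw [e, inner_neg_left, real_inner_comm]
    congr 4
    ring
  -- unfolding: the integral over the box of the periodization is the integral over space
  have hcoeff : ∀ k, UnitAddTorus.mFourierCoeff f k = (𝓕 H) (lat k) := by
    intro k
    have h1 := hasSum_integral_box (hgint k)
    have h2 := hasSum_integral_box (hgint k).norm
    rw [hfour] at h1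
    have h3 := hasSum_integral_of_summable_integral_norm
      (μ := volume.restrict {x : Fin n → ℝ | ∀ i, x i ∈ Ioc (0 : ℝ) (0 + 1)})
      (F := fun (l : Fin n → ℤ) x => g k (x + fun i => (l i : ℝ)))
      (fun l => ((hgint k).comp_add_right _).integrableOn) h2.summable
    rw [h1.unique h3, UnitAddTorus.mFourierCoeff_eq_integral _ _ 0]
    refine integral_congr_ae (Filter.Eventually.of_forall fun x => ?_)
    simp only [hf, hG, hgshift, smul_eq_mul, tsum_mul_left]
  have hsum : Summable (UnitAddTorus.mFourierCoeff f) := by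
    obtain ⟨C, hC⟩ := exists_enorm_le_prof (𝓕 H)
    refine summable_of_tsum_enorm_ne_top (ne_top_of_le_ne_top (ENNReal.mul_ne_top
      (ENNReal.coe_ne_top (r := C)) (tsum_prof_lat_ne_top (n := n))) ?_)
    rw [← ENNReal.tsum_mul_left]
    refine ENNReal.tsum_le_tsum fun k => ?_
    rw [hcoeff]
    exact hC _
  have hfin := UnitAddTorus.hasSum_mFourier_series_apply_of_summable hsum
    (fun i => (y i : UnitAddCircle))
  rw [hf] at hfin
  simp only [hcoeff, mFourier_coe, smul_eq_mul] at hfin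
  exact hfin

end Poisson

/-! ### Completeness of the Meyer wavelets -/

section Meyer

variable (M : MeyerFunction)

theorem band_neg (ξ : ℝ) : band M.Φ (-ξ) = band M.Φ ξ := by
  unfold band; rw [neg_div, M.even, M.even]

theorem Φ_eq_zero {ξ : ℝ} (h : 4 * Real.pi / 3 < |ξ|) : M.Φ ξ = 0 := by
  by_contra hne
  exact absurd (M.support_subset ξ hne) (not_le.mpr h)

/-- The endpoints are included, by continuity. -/
theorem Φ_eq_zero_of_le {ξ : ℝ} (h : 4 * Real.pi / 3 ≤ |ξ|) : M.Φ ξ = 0 := by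
  have hcl : IsClosed {x : ℝ | M.Φ x = 0} := isClosed_eq M.smooth.continuous continuous_const
  have key : ∀ x : ℝ, 4 * Real.pi / 3 ≤ x → M.Φ x = 0 := by
    intro x hx
    have : x ∈ closure (Ioi (4 * Real.pi / 3)) := by rw [closure_Ioi]; exact hx
    refine hcl.closure_subset_iff.mpr (fun y hy => ?_) this
    exact Φ_eq_zero M (lt_of_lt_of_le hy (le_abs_self y))
  rcases le_total 0 ξ with h0 | h0
  · rw [abs_of_nonneg h0] at h; exact key ξ h
  · rw [abs_of_nonpos h0] at h; rw [← M.even]; exact key _ h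

/-- The square root in the definition of `band` is never taken of a negative number. -/
theorem band_sq {ξ : ℝ} : band M.Φ ξ ^ 2 + M.Φ ξ ^ 2 = M.Φ (ξ / 2) ^ 2 := by
  unfold band
  rw [Real.sq_sqrt, sub_add_cancel]
  have hpi := Real.pi_pos
  rw [sub_nonneg]
  by_cases h : |ξ| ≤ 4 * Real.pi / 3
  · have : M.Φ (ξ / 2) = 1 := M.eq_one _ (by rw [abs_div, abs_two]; linarith)
    rw [this]
    exact pow_le_pow_left₀ (M.nonneg ξ) (M.le_one ξ) 2
  · rw [Φ_eq_zero M (not_le.mp h)]; simpa using sq_nonneg _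

theorem band_nonneg (ξ : ℝ) : 0 ≤ band M.Φ ξ := Real.sqrt_nonneg _

theorem band_eq_zero_of_le {ξ : ℝ} (h : 8 * Real.pi / 3 ≤ |ξ|) : band M.Φ ξ = 0 := by
  have hpi := Real.pi_pos
  have h1 : M.Φ ξ = 0 := Φ_eq_zero_of_le M (by linarith)
  have h2 : M.Φ (ξ / 2) = 0 := Φ_eq_zero_of_le M (by rw [abs_div, abs_two]; linarith)
  simp [band, h1, h2]

theorem band_eq_Φ_half {ξ : ℝ} (h : 4 * Real.pi / 3 ≤ |ξ|) : band M.Φ ξ = M.Φ (ξ / 2) := by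
  unfold band
  rw [Φ_eq_zero_of_le M h]
  simp [Real.sqrt_sq (M.nonneg _)]

/-- The reflection identity `φ(2π - ξ) = Φ(ξ)` on `[2π/3, 4π/3]`. -/
theorem band_two_pi_sub {ξ : ℝ} (h1 : 2 * Real.pi / 3 ≤ ξ) (h2 : ξ ≤ 4 * Real.pi / 3) :
    band M.Φ (2 * Real.pi - ξ) = M.Φ ξ := by
  have hpi := Real.pi_pos
  have hb := M.band_sq_add ξ h1 h2
  have hs := band_sq M (ξ := ξ)
  have : M.Φ (ξ / 2) = 1 := M.eq_one _ (by
    rw [abs_div, abs_two, abs_of_nonneg (by linarith)]; linarith)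
  rw [this] at hs
  have hsq : band M.Φ (2 * Real.pi - ξ) ^ 2 = M.Φ ξ ^ 2 := by linarith
  exact (pow_left_inj₀ (band_nonneg M _) (M.nonneg _) two_ne_zero).mp hsq

/-- `φ(ξ) φ(ξ - 2π) = Φ(ξ) Φ(ξ - 2π)` for all `ξ`. -/
theorem band_mul_band_two_pi (ξ : ℝ) :
    band M.Φ ξ * band M.Φ (ξ - 2 * Real.pi) = M.Φ ξ * M.Φ (ξ - 2 * Real.pi) := by
  have hpi := Real.pi_pos
  have hneg : ∀ x, band M.Φ (x - 2 * Real.pi) = band M.Φ (2 * Real.pi - x) := by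
    intro x; rw [← band_neg]; congr 1; ring
  have hneg' : ∀ x, M.Φ (x - 2 * Real.pi) = M.Φ (2 * Real.pi - x) := by
    intro x; rw [← M.even]; congr 1; ring
  rw [hneg, hneg']
  rcases lt_or_ge ξ (2 * Real.pi / 3) with h1 | h1
  · have hΦ : M.Φ (2 * Real.pi - ξ) = 0 := Φ_eq_zero_of_le M (by
      rw [abs_of_nonneg (by linarith)]; linarith)
    rw [hΦ, mul_zero]
    by_cases h2 : |ξ| ≤ 2 * Real.pi / 3
    · rw [band_eq_zero M h2, zero_mul]
    · have h3 : ξ < -(2 * Real.pi / 3) := by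
        by_contra hcon
        exact h2 (abs_le.mpr ⟨not_lt.mp hcon, h1.le⟩)
      rw [band_eq_zero_of_le M (ξ := 2 * Real.pi - ξ), mul_zero]
      rw [abs_of_nonneg (by linarith)]; linarith
  rcases le_or_gt ξ (4 * Real.pi / 3) with h2 | h2
  · rw [band_two_pi_sub M h1 h2]
    have := band_two_pi_sub M (ξ := 2 * Real.pi - ξ) (by linarith) (by linarith)
    rw [sub_sub_cancel] at this
    rw [this, mul_comm]
  · have hΦ : M.Φ ξ = 0 := Φ_eq_zero_of_le M (by
      rw [abs_of_nonneg (by linarith)]; linarith)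
    rw [hΦ, zero_mul]
    rcases le_or_gt ξ (8 * Real.pi / 3) with h3 | h3
    · rw [band_eq_zero M (ξ := 2 * Real.pi - ξ), mul_zero]
      rw [abs_le]; constructor <;> linarith
    · rw [band_eq_zero_of_le M (ξ := ξ), zero_mul]
      rw [abs_of_nonneg (by linarith)]; linarith

/-- Products of translates: only even translates survive in the sum over the two filters. -/
theorem band_translate (l : ℤ) (ξ : ℝ) :
    M.Φ ξ * M.Φ (ξ + 2 * Real.pi * l) +
      (if Even l then 1 else -1) * (band M.Φ ξ * band M.Φ (ξ + 2 * Real.pi * l)) =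
    if Even l then M.Φ (ξ / 2) * M.Φ ((ξ + 2 * Real.pi * l) / 2) else 0 := by
  have hpi := Real.pi_pos
  have hbig : ∀ a b : ℝ, 16 * Real.pi / 3 ≤ |b - a| →
      band M.Φ a * band M.Φ b = 0 := by
    intro a b hab
    have htri : |b - a| ≤ |b| + |a| := abs_sub _ _
    rcases le_total (8 * Real.pi / 3) |a| with h | h
    · rw [band_eq_zero_of_le M h, zero_mul]
    · rw [band_eq_zero_of_le M (ξ := b) (by linarith), mul_zero]
  have hbigΦ : ∀ a b : ℝ, 8 * Real.pi / 3 ≤ |b - a| → M.Φ a * M.Φ b = 0 := by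
    intro a b hab
    have htri : |b - a| ≤ |b| + |a| := abs_sub _ _
    rcases le_total (4 * Real.pi / 3) |a| with h | h
    · rw [Φ_eq_zero_of_le M h, zero_mul]
    · rw [Φ_eq_zero_of_le M (ξ := b) (by linarith), mul_zero]
  have hdiff : ∀ c : ℝ, |ξ + c - ξ| = |c| := fun c => by rw [add_sub_cancel_left]
  have habs : |2 * Real.pi * (l : ℝ)| = 2 * Real.pi * |(l : ℝ)| := by
    rw [abs_mul, abs_of_pos (by positivity : (0 : ℝ) < 2 * Real.pi)]
  rcases Int.even_or_odd l with hl | hl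
  · simp only [hl, if_true, one_mul]
    rcases eq_or_ne l 0 with rfl | hl0
    · simp only [Int.cast_zero, mul_zero, add_zero]
      have := band_sq M (ξ := ξ)
      nlinarith
    · have h2 : (2 : ℝ) ≤ |(l : ℝ)| := by
        obtain ⟨m, rfl⟩ := hl
        have : 2 ≤ |m + m| := by
          rcases lt_trichotomy m 0 with h | h | h
          · rw [abs_of_neg (by omega)]; omega
          · exact absurd (by omega) hl0
          · rw [abs_of_pos (by omega)]; omega
        exact_mod_cast this
      rw [hbigΦ ξ _ (by rw [hdiff, habs]; nlinarith), zero_add]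
      by_cases h3 : |(l : ℝ)| ≤ 2
      · have hl2 : |(l : ℝ)| = 2 := le_antisymm h3 h2
        -- for `|l| = 2` both sides vanish unless `ξ` and `ξ + 2πl` are in the outer annulus
        by_cases ha : 4 * Real.pi / 3 ≤ |ξ|
        · by_cases hb : 4 * Real.pi / 3 ≤ |ξ + 2 * Real.pi * l|
          · rw [band_eq_Φ_half M ha, band_eq_Φ_half M hb]
          · have htri : 4 * Real.pi ≤ |ξ + 2 * Real.pi * l| + |ξ| := by
              have := abs_sub (ξ + 2 * Real.pi * l) ξ
              rw [hdiff, habs, hl2] at this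
              linarith
            have hx : 8 * Real.pi / 3 ≤ |ξ| := by linarith [not_le.mp hb]
            rw [band_eq_zero_of_le M hx, Φ_eq_zero_of_le M (ξ := ξ / 2), zero_mul, zero_mul]
            rw [abs_div, abs_two]; linarith
        · have htri : 4 * Real.pi ≤ |ξ + 2 * Real.pi * l| + |ξ| := by
            have := abs_sub (ξ + 2 * Real.pi * l) ξ
            rw [hdiff, habs, hl2] at this
            linarith
          have hx : 8 * Real.pi / 3 ≤ |ξ + 2 * Real.pi * l| := by linarith [not_le.mp ha]
          rw [band_eq_zero_of_le M hx, Φ_eq_zero_of_le M (ξ := (ξ + 2 * Real.pi * l) / 2), mul_zero,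
            mul_zero]
          rw [abs_div, abs_two]; linarith
      · have h4 : (3 : ℝ) ≤ |(l : ℝ)| := by
          have : 2 < |l| := by
            have := not_le.mp h3
            exact_mod_cast this
          exact_mod_cast this
        rw [hbig ξ _ (by rw [hdiff, habs]; nlinarith), hbigΦ]
        have e : (ξ + 2 * Real.pi * l) / 2 - ξ / 2 = Real.pi * l := by ring
        rw [e, abs_mul, abs_of_pos hpi]
        nlinarith
  · have hne : ¬ Even l := Int.not_even_iff_odd.mpr hl
    simp only [hne, if_false]
    rcases lt_or_ge |(l : ℝ)| 3 with h3 | h3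
    · have hl1 : l = 1 ∨ l = -1 := by
        have h3' : |l| < 3 := by exact_mod_cast h3
        rw [abs_lt] at h3'
        obtain ⟨m, rfl⟩ := hl
        omega
      rcases hl1 with rfl | rfl
      · have := band_mul_band_two_pi M (ξ + 2 * Real.pi)
        rw [add_sub_cancel_right] at this
        push_cast
        rw [mul_one]
        linarith [mul_comm (M.Φ ξ) (M.Φ (ξ + 2 * Real.pi)),
          mul_comm (band M.Φ ξ) (band M.Φ (ξ + 2 * Real.pi))]
      · have := band_mul_band_two_pi M ξ
        push_cast
        rw [mul_neg, mul_one, ← sub_eq_add_neg]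
        linarith
    · rw [hbigΦ ξ _ (by rw [hdiff, habs]; nlinarith), hbig ξ _ (by rw [hdiff, habs]; nlinarith)]
      simp

/-- The filter identity in one variable: the phases `e^{-iξ/2}` contribute the sign `(-1)^l` with which
the products of band functions enter `band_translate`. -/
theorem sum_symbol_mul_symbol (l : ℤ) (ξ : ℝ) :
    ∑ e : Fin 2, M.symbol e (-ξ) * M.symbol e (ξ + 2 * Real.pi * l) =
      if Even l then ((M.Φ (ξ / 2) * M.Φ ((ξ + 2 * Real.pi * l) / 2) : ℝ) : ℂ) else 0 := by
  have hexp : Complex.exp (-(Complex.I * ((-ξ : ℝ) : ℂ) / 2)) *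
      Complex.exp (-(Complex.I * ((ξ + 2 * Real.pi * l : ℝ) : ℂ) / 2)) =
      ((if Even l then 1 else -1 : ℝ) : ℂ) := by
    rw [← Complex.exp_add]
    have : -(Complex.I * ((-ξ : ℝ) : ℂ) / 2) + -(Complex.I * ((ξ + 2 * Real.pi * l : ℝ) : ℂ) / 2) =
        (-l : ℤ) * (Real.pi * Complex.I) := by push_cast; ring
    rw [this, Complex.exp_int_mul, Complex.exp_pi_mul_I]
    split_ifs with h
    · rw [Even.neg_one_zpow h.neg]; simp
    · rw [Odd.neg_one_zpow (Int.not_even_iff_odd.mp h).neg]; simp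
  have key := band_translate M l ξ
  rw [Fin.sum_univ_two]
  have e0 : ∀ x, M.symbol 0 x = M.Φ x := fun x => by simp [MeyerFunction.symbol]
  have e1 : ∀ x : ℝ, M.symbol 1 x = Complex.exp (-(Complex.I * x / 2)) * (band M.Φ x : ℂ) :=
    fun x => by simp [MeyerFunction.symbol]
  rw [e0, e0, e1, e1, M.even, band_neg]
  have : Complex.exp (-(Complex.I * ((-ξ : ℝ) : ℂ) / 2)) * (band M.Φ ξ : ℂ) *
      (Complex.exp (-(Complex.I * ((ξ + 2 * Real.pi * l : ℝ) : ℂ) / 2)) *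
        (band M.Φ (ξ + 2 * Real.pi * l) : ℂ)) =
      ((if Even l then 1 else -1 : ℝ) : ℂ) *
        ((band M.Φ ξ * band M.Φ (ξ + 2 * Real.pi * l) : ℝ) : ℂ) := by
    rw [← hexp]; push_cast; ring
  rw [this, ← Complex.ofReal_mul, ← Complex.ofReal_mul, ← Complex.ofReal_add, key]
  split_ifs <;> simp

end Meyer

section Completeness

variable {n : ℕ} (M : MeyerFunction)

/-- The compactly supported Schwartz function `z ↦ S^ε(z) 𝓕⁻ψ(2^j z)`, where `S^ε` is the symbol of
`φ^ε`; its Fourier coefficients are the wavelet coefficients of `ψ` at the scale `j`. -/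
def dilatedSample (ε : Fin n → Fin 2) (j : ℤ) (ψ : 𝓢(Eucl n, ℂ)) : 𝓢(Eucl n, ℂ) :=
  (((M.symbolProd_hasCompactSupport ε).mul_right
    (f' := fun z => (𝓕⁻ ψ : 𝓢(Eucl n, ℂ)) ((2 : ℝ) ^ j • z))).toSchwartzMap
    ((M.symbolProd_smooth ε).mul
      ((SchwartzMap.smooth (𝓕⁻ ψ : 𝓢(Eucl n, ℂ)) ⊤).comp (contDiff_const_smul ((2 : ℝ) ^ j)))))

theorem dilatedSample_apply (ε : Fin n → Fin 2) (j : ℤ) (ψ : 𝓢(Eucl n, ℂ)) (z : Eucl n) :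
    dilatedSample M ε j ψ z = M.symbolProd ε z * (𝓕⁻ ψ) ((2 : ℝ) ^ j • z) := rfl

/-- The wavelet coefficients at a fixed scale are the values of a Fourier transform on the lattice, to
which Poisson summation applies. -/
theorem wavelet_coeff_eq (ε : Fin n → Fin 2) (j : ℤ) (k : Fin n → ℤ) (ψ : 𝓢(Eucl n, ℂ)) :
    ∫ x, M.wavelet ε j k x * ψ x =
      ((2 : ℝ) ^ ((n : ℝ) * j / 2) : ℝ) * (𝓕 (dilatedSample M ε j ψ)) (lat k) := by
  have h1 : ∫ x, M.wavelet ε j k x * ψ x = ∫ x, ψ x * M.wavelet ε j k x := by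
    simp only [mul_comm]
  rw [h1, integral_mul_eq_fourier]
  have h2 : ∀ ζ : Eucl n, (𝓕 (M.wavelet ε j k)) ζ = ((2 : ℝ) ^ (-((n : ℝ) * j / 2)) : ℝ) *
      Complex.exp (↑(-(2 * Real.pi * inner ℝ ((2 : ℝ) ^ (-j) • ζ) (lat k))) * Complex.I) *
        M.symbolProd ε ((2 : ℝ) ^ (-j) • ζ) := by
    intro ζ
    have := fourierInv_apply_eq_fourier_neg (M.wavelet ε j k) (-ζ)
    rw [neg_neg] at this
    rw [← this, M.wavelet_eq_atom, fourierInv_atom, fourierInv_mother]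
    congr 3
    · rw [smul_neg, inner_neg_right, real_inner_comm]
      congr 2; ring
    · rw [smul_neg, neg_neg]
  set G : Eucl n → ℂ := fun z => ((2 : ℝ) ^ (-((n : ℝ) * j / 2)) : ℝ) *
    (Complex.exp (↑(-(2 * Real.pi * inner ℝ z (lat k))) * Complex.I) *
      dilatedSample M ε j ψ z) with hG
  have h3 : ∀ ζ : Eucl n, (𝓕⁻ ψ) ζ * (𝓕 (M.wavelet ε j k)) ζ = G ((2 : ℝ) ^ (-j) • ζ - 0) := by
    intro ζ
    rw [h2, sub_zero, hG]
    simp only [dilatedSample_apply]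
    rw [smul_smul, ← zpow_add₀ two_ne_zero, add_neg_cancel, zpow_zero, one_smul]
    ring
  simp only [h3]
  rw [integral_comp_smul_sub, hG, integral_const_mul, ← mul_assoc, ← Complex.ofReal_mul,
    ← Real.rpow_add two_pos]
  refine congrArg₂ (· * ·) ?_ ?_
  · congr 2; push_cast; ring
  · rw [SchwartzMap.fourier_coe]
    refine Eq.trans ?_ (Real.fourier_eq' _ _).symm
    simp only [smul_eq_mul, neg_mul]

/-- The contribution of all translates at the scale `j` in the direction `ε` to the wavelet
expansion of `𝓕⁻ψ`, at the frequency `η`. -/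
def scaleSum (ε : Fin n → Fin 2) (j : ℤ) (ψ : 𝓢(Eucl n, ℂ)) (η : Eucl n) : ℂ :=
  ∑' l : Fin n → ℤ, M.symbolProd ε (-((2 : ℝ) ^ (-j) • η)) *
    dilatedSample M ε j ψ ((2 : ℝ) ^ (-j) • η + lat l)

/-- Poisson summation over the translates at a fixed scale. -/
theorem hasSum_scaleSum (ε : Fin n → Fin 2) (j : ℤ) (ψ : 𝓢(Eucl n, ℂ)) (η : Eucl n) :
    HasSum (fun k : Fin n → ℤ => (∫ x, M.wavelet ε j k x * ψ x) * (𝓕⁻ (M.wavelet ε j k)) η)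
      (scaleSum M ε j ψ η) := by
  have h := (hasSum_poisson (dilatedSample M ε j ψ) ((2 : ℝ) ^ (-j) • η)).mul_left
    (M.symbolProd ε (-((2 : ℝ) ^ (-j) • η)))
  unfold scaleSum
  rw [tsum_mul_left]
  refine h.congr_fun ?_
  intro k
  rw [wavelet_coeff_eq, M.wavelet_eq_atom, fourierInv_atom, fourierInv_mother]
  have e : (((2 : ℝ) ^ ((n : ℝ) * j / 2) : ℝ) : ℂ) * ((2 : ℝ) ^ (-((n : ℝ) * j / 2)) : ℝ) = 1 := by
    rw [← Complex.ofReal_mul, ← Real.rpow_add two_pos, add_neg_cancel, Real.rpow_zero,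
      Complex.ofReal_one]
  linear_combination (M.symbolProd ε (-((2 : ℝ) ^ (-j) • η)) *
    (𝓕 (dilatedSample M ε j ψ)) (lat k) *
      Complex.exp (↑(2 * Real.pi * inner ℝ (lat k) ((2 : ℝ) ^ (-j) • η)) * Complex.I)) * e

theorem summable_translate (H : 𝓢(Eucl n, ℂ)) (y : Eucl n) :
    Summable fun l : Fin n → ℤ => H (y + lat l) := by
  obtain ⟨C, hC⟩ := exists_enorm_le_prof H
  obtain ⟨B, hB⟩ := exists_tsum_prof_le n
  have hneg : ∀ l : Fin n → ℤ, y + lat l = y - lat (-l) := by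
    intro l; ext i; simp [lat_apply]
  refine summable_of_tsum_enorm_ne_top (ne_top_of_le_ne_top
    (ENNReal.mul_ne_top ENNReal.coe_ne_top ENNReal.coe_ne_top) (?_ : _ ≤ (C : ℝ≥0∞) * B))
  calc ∑' l : Fin n → ℤ, ‖H (y + lat l)‖ₑ ≤ ∑' l : Fin n → ℤ, C * prof (y - lat (-l)) := by
        refine ENNReal.tsum_le_tsum fun l => ?_
        rw [← hneg]; exact hC _
    _ = C * ∑' l : Fin n → ℤ, prof (y - lat l) := by
        rw [ENNReal.tsum_mul_left]
        congr 1
        exact (Equiv.neg (Fin n → ℤ)).tsum_eq fun l => prof (y - lat l)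
    _ ≤ C * B := by gcongr; exact hB y

/-- The two-scale relation: the sum over all filters of the products of a symbol with its
translate by a lattice point. -/
theorem sum_symbolProd_mul (y : Eucl n) (l : Fin n → ℤ) :
    ∑ ε : Fin n → Fin 2, M.symbolProd ε (-y) * M.symbolProd ε (y + lat l) =
      if (∀ i, Even (l i)) then M.symbolProd 0 (-((2 : ℝ)⁻¹ • y)) *
        M.symbolProd 0 ((2 : ℝ)⁻¹ • (y + lat l)) else 0 := by
  unfold MeyerFunction.symbolProd
  simp only [← Finset.prod_mul_distrib]
  rw [← Fintype.prod_sum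
    (fun i e => M.symbol e (2 * Real.pi * (-y) i) * M.symbol e (2 * Real.pi * (y + lat l) i))]
  have h : ∀ i, ∑ e : Fin 2, M.symbol e (2 * Real.pi * (-y) i) *
      M.symbol e (2 * Real.pi * (y + lat l) i) =
      if Even (l i) then M.symbol 0 (2 * Real.pi * (-((2 : ℝ)⁻¹ • y)) i) *
        M.symbol 0 (2 * Real.pi * ((2 : ℝ)⁻¹ • (y + lat l)) i) else 0 := by
    intro i
    have e1 : 2 * Real.pi * (-y) i = -(2 * Real.pi * y i) := by simp
    have e2 : 2 * Real.pi * (y + lat l) i = 2 * Real.pi * y i + 2 * Real.pi * l i := by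
      simp [lat_apply]; ring
    rw [e1, e2, sum_symbol_mul_symbol]
    have e3 : M.symbol 0 (2 * Real.pi * (-((2 : ℝ)⁻¹ • y)) i) =
        (M.Φ (2 * Real.pi * y i / 2) : ℂ) := by
      rw [← M.even]
      simp only [MeyerFunction.symbol, if_true]
      congr 2; simp; ring
    have e4 : M.symbol 0 (2 * Real.pi * ((2 : ℝ)⁻¹ • (y + lat l)) i) =
        (M.Φ ((2 * Real.pi * y i + 2 * Real.pi * l i) / 2) : ℂ) := by
      simp only [MeyerFunction.symbol, if_true]
      congr 2; simp [lat_apply]; ring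
    rw [e3, e4]; push_cast; rfl
  rw [Finset.prod_congr rfl fun i _ => h i]
  split_ifs with hl
  · exact Finset.prod_congr rfl fun i _ => by rw [if_pos (hl i)]; rfl
  · obtain ⟨i, hi⟩ := not_forall.mp hl
    exact Finset.prod_eq_zero (Finset.mem_univ i) (if_neg hi)

/-- The low frequency sum at the scale `j + 1` splits into the sums over all filters at the
scale `j`. -/
theorem sum_scaleSum (j : ℤ) (ψ : 𝓢(Eucl n, ℂ)) (η : Eucl n) :
    ∑ ε : Fin n → Fin 2, scaleSum M ε j ψ η = scaleSum M 0 (j + 1) ψ η := by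
  unfold scaleSum
  rw [← Summable.tsum_finsetSum fun ε _ => (summable_translate _ _).mul_left _]
  set y := (2 : ℝ) ^ (-j) • η with hy
  have hhalf : (2 : ℝ) ^ (-(j + 1)) • η = (2 : ℝ)⁻¹ • y := by
    rw [hy, smul_smul, neg_add, zpow_add₀ two_ne_zero, mul_comm, zpow_neg_one]
  have hinj : Function.Injective fun l : Fin n → ℤ => fun i => 2 * l i := by
    intro a b hab
    funext i
    have := congrFun hab i
    simp only at this
    omega
  rw [hhalf]
  set T : (Fin n → ℤ) → ℂ := fun l => ∑ ε : Fin n → Fin 2, M.symbolProd ε (-y) *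
    dilatedSample M ε j ψ (y + lat l) with hT
  have hTe : ∀ l, T l = (if (∀ i, Even (l i)) then M.symbolProd 0 (-((2 : ℝ)⁻¹ • y)) *
        M.symbolProd 0 ((2 : ℝ)⁻¹ • (y + lat l)) else 0) * (𝓕⁻ ψ) ((2 : ℝ) ^ j • (y + lat l)) := by
    intro l
    rw [hT, ← sum_symbolProd_mul]
    simp only [dilatedSample_apply, ← mul_assoc]
    rw [← Finset.sum_mul]
  have hsupp : Function.support T ⊆ range fun l : Fin n → ℤ => fun i => 2 * l i := by
    intro l hl
    rw [Function.mem_support, hTe] at hl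
    have he : ∀ i, Even (l i) := by
      by_contra hne
      rw [if_neg hne, zero_mul] at hl
      exact hl rfl
    choose r hr using he
    exact ⟨r, by funext i; exact (two_mul _).trans (hr i).symm⟩
  rw [← hinj.tsum_eq hsupp]
  refine tsum_congr fun l => ?_
  have hlat : y + lat (fun i => 2 * l i) = (2 : ℝ) • ((2 : ℝ)⁻¹ • y + lat l) := by
    ext i
    simp only [PiLp.add_apply, PiLp.smul_apply, lat_apply, smul_eq_mul]
    push_cast
    ring
  rw [hTe, if_pos (fun i => even_two_mul _), hlat, dilatedSample_apply,
    smul_smul 2⁻¹ 2, inv_mul_cancel₀ two_ne_zero, one_smul, zpow_add_one₀ two_ne_zero, mul_assoc,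
    smul_smul ((2 : ℝ) ^ j) 2]

/-- At a fixed frequency, the low frequency sums of fine scales reproduce the function. -/
theorem scaleSum_zero_of_lt {j : ℤ} {η : Eucl n} (h : ∀ i, |η i| < 2 ^ j * (1 / 3))
    (ψ : 𝓢(Eucl n, ℂ)) : scaleSum M 0 j ψ η = (𝓕⁻ ψ) η := by
  unfold scaleSum
  set y := (2 : ℝ) ^ (-j) • η with hy
  have h2 : (0 : ℝ) < 2 ^ j := by positivity
  have hyi : ∀ i, |y i| < 1 / 3 := by
    intro i
    rw [hy, PiLp.smul_apply, smul_eq_mul, abs_mul, abs_of_pos (by positivity), zpow_neg,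
      inv_mul_lt_iff₀ h2]
    exact h i
  have hone : ∀ z : Eucl n, (∀ i, |z i| < 1 / 3) → M.symbolProd 0 z = 1 := by
    intro z hz
    refine Finset.prod_eq_one fun i _ => ?_
    have hpi := Real.pi_pos
    have : M.Φ (2 * Real.pi * z i) = 1 := M.eq_one _ (by
      rw [abs_mul, abs_of_pos (by positivity : 0 < 2 * Real.pi)]; nlinarith [hz i])
    simp [MeyerFunction.symbol, this]
  rw [tsum_eq_single 0]
  · have h0 : y + lat 0 = y := by ext i; simp [lat_apply]
    rw [h0, dilatedSample_apply, hone y hyi, hone (-y) (fun i => by simpa using hyi i), one_mul,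
      one_mul, hy, smul_smul, ← zpow_add₀ two_ne_zero, add_neg_cancel, zpow_zero, one_smul]
  · intro l hl
    obtain ⟨i, hi⟩ := Function.ne_iff.mp hl
    have : M.symbolProd 0 (y + lat l) = 0 := by
      by_contra hne
      have hb := abs_le_of_symbol_zero_ne_zero M (symbol_ne_zero_of_symbolProd M hne i)
      have hl1 : (1 : ℝ) ≤ |(l i : ℝ)| := by
        have : 1 ≤ |l i| := Int.one_le_abs hi
        exact_mod_cast this
      have htri : |(l i : ℝ)| ≤ |(y + lat l) i| + |y i| := by
        have := abs_sub ((y + lat l) i) (y i)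
        simpa [lat_apply] using this
      linarith [hyi i]
    rw [dilatedSample_apply, this, zero_mul, mul_zero]

theorem symbolProd_eq_zero_of_lt (ε : Fin n → Fin 2) {z : Eucl n} {i : Fin n}
    (h : 4 / 3 < |z i|) : M.symbolProd ε z = 0 := by
  by_contra hne
  exact absurd (abs_le_of_symbol_ne_zero M (symbol_ne_zero_of_symbolProd M hne i)) (not_le.mpr h)

theorem symbolProd_eq_zero_of_le {ε : Fin n → Fin 2} (hε : ε ≠ 0) {z : Eucl n}
    (h : ∀ i, |z i| ≤ 1 / 3) : M.symbolProd ε z = 0 := by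
  by_contra hne
  obtain ⟨i, hi⟩ := Function.ne_iff.mp hε
  exact absurd (lt_abs_of_symbol_ne_zero M hi (symbol_ne_zero_of_symbolProd M hne i))
    (not_lt.mpr (h i))

/-- The wavelet expansion on the frequency side, away from the zero frequency. -/
theorem hasSum_fourierInv_wavelet (ψ : 𝓢(Eucl n, ℂ)) {η : Eucl n} (hη : η ≠ 0) :
    HasSum (fun γ : Dir n × ℤ × (Fin n → ℤ) =>
      (∫ x, M.wavelet γ.1.1 γ.2.1 γ.2.2 x * ψ x) * (𝓕⁻ (M.wavelet γ.1.1 γ.2.1 γ.2.2)) η)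
      ((𝓕⁻ ψ) η) := by
  obtain ⟨i₀, hi₀⟩ : ∃ i, η i ≠ 0 := by
    by_contra hcon
    push Not at hcon
    exact hη (by ext i; simpa using hcon i)
  have habs : ∀ (j : ℤ) (i : Fin n), |((2 : ℝ) ^ (-j) • η) i| = (2 ^ j)⁻¹ * |η i| := by
    intro j i
    rw [PiLp.smul_apply, smul_eq_mul, abs_mul, abs_of_pos (by positivity), zpow_neg]
  -- up to the scale `a` the frequency `η` is too high, from the scale `b` on it is too low
  obtain ⟨a, ha⟩ : ∃ a : ℤ, ∀ j ≤ a, ∀ ε : Fin n → Fin 2,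
      M.symbolProd ε (-((2 : ℝ) ^ (-j) • η)) = 0 := by
    obtain ⟨N, hN⟩ := exists_nat_gt (4 / 3 / |η i₀|)
    refine ⟨-N, fun j hj ε => symbolProd_eq_zero_of_lt M ε (i := i₀) ?_⟩
    rw [PiLp.neg_apply, abs_neg, PiLp.smul_apply, smul_eq_mul, abs_mul,
      abs_of_pos (by positivity)]
    rw [div_lt_iff₀ (abs_pos.mpr hi₀)] at hN
    refine hN.trans_le (mul_le_mul_of_nonneg_right ?_ (abs_nonneg _))
    calc (N : ℝ) ≤ 2 ^ N := by exact_mod_cast Nat.lt_two_pow_self.le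
      _ = (2 : ℝ) ^ (N : ℤ) := by simp
      _ ≤ 2 ^ (-j) := zpow_le_zpow_right₀ one_le_two (by omega)
  obtain ⟨b, hb⟩ : ∃ b : ℤ, ∀ j ≥ b, ∀ i, |η i| < 2 ^ j * (1 / 3) := by
    obtain ⟨N, hN⟩ := exists_nat_gt (3 * ‖η‖)
    refine ⟨N, fun j hj i => ?_⟩
    have h1 : |η i| ≤ ‖η‖ := by simpa using PiLp.norm_apply_le η i
    have h2 : (N : ℝ) ≤ 2 ^ j := calc
      (N : ℝ) ≤ 2 ^ N := by exact_mod_cast Nat.lt_two_pow_self.le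
      _ = (2 : ℝ) ^ (N : ℤ) := by simp
      _ ≤ 2 ^ j := zpow_le_zpow_right₀ one_le_two hj
    linarith
  have hb0 : ∀ j ≥ b, ∀ ε : Dir n, M.symbolProd ε.1 (-((2 : ℝ) ^ (-j) • η)) = 0 := by
    intro j hj ε
    refine symbolProd_eq_zero_of_le M ε.2 fun i => ?_
    have h2 : (0 : ℝ) < 2 ^ j := by positivity
    rw [PiLp.neg_apply, abs_neg, habs, inv_mul_le_iff₀ h2]
    exact (hb j hj i).le
  have hab : a ≤ b := by
    by_contra hlt
    have h0 : M.symbolProd 0 (-((2 : ℝ) ^ (-b) • η)) = 0 := ha b (not_le.mp hlt).le 0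
    have h1 : M.symbolProd 0 (-((2 : ℝ) ^ (-b) • η)) ≠ 0 := by
      refine Finset.prod_ne_zero_iff.mpr fun i _ => ?_
      have hpi := Real.pi_pos
      have h2 : (0 : ℝ) < 2 ^ b := by positivity
      have h3 : |(-((2 : ℝ) ^ (-b) • η)) i| < 1 / 3 := by
        rw [PiLp.neg_apply, abs_neg, habs, inv_mul_lt_iff₀ h2]; exact hb b le_rfl i
      have : M.Φ (2 * Real.pi * (-((2 : ℝ) ^ (-b) • η)) i) = 1 := M.eq_one _ (by
        rw [abs_mul, abs_of_pos (by positivity : 0 < 2 * Real.pi)]; nlinarith)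
      simp only [MeyerFunction.symbol, Pi.zero_apply, if_true, this]
      simp
    exact h1 h0
  have hzero : ∀ (ε : Dir n) (j : ℤ), j ∉ Finset.Ico a b →
      M.symbolProd ε.1 (-((2 : ℝ) ^ (-j) • η)) = 0 := by
    intro ε j hj
    rw [Finset.mem_Ico, not_and_or, not_le, not_lt] at hj
    rcases hj with h | h
    · exact ha j h.le _
    · exact hb0 j h ε
  have hterm : ∀ (ε : Dir n) (j : ℤ), j ∉ Finset.Ico a b → ∀ k : Fin n → ℤ,
      (𝓕⁻ (M.wavelet ε.1 j k)) η = 0 := by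
    intro ε j hj k
    rw [M.wavelet_eq_atom, fourierInv_atom, fourierInv_mother, hzero ε j hj, mul_zero]
  have hrow : ∀ (ε : Dir n) (j : ℤ), HasSum (fun k : Fin n → ℤ =>
      (∫ x, M.wavelet ε.1 j k x * ψ x) * (𝓕⁻ (M.wavelet ε.1 j k)) η) (scaleSum M ε.1 j ψ η) :=
    fun ε j => hasSum_scaleSum M ε.1 j ψ η
  have hsum : Summable (fun γ : Dir n × ℤ × (Fin n → ℤ) =>
      (∫ x, M.wavelet γ.1.1 γ.2.1 γ.2.2 x * ψ x) * (𝓕⁻ (M.wavelet γ.1.1 γ.2.1 γ.2.2)) η) := by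
    refine summable_of_tsum_enorm_ne_top ?_
    rw [ENNReal.tsum_prod', tsum_fintype]
    refine ENNReal.sum_ne_top.mpr fun ε _ => ?_
    rw [ENNReal.tsum_prod', tsum_eq_sum (s := Finset.Ico a b)]
    · refine ENNReal.sum_ne_top.mpr fun j _ => ?_
      exact ENNReal.tsum_coe_ne_top_iff_summable.mpr (NNReal.summable_coe.mp (hrow ε j).summable.norm)
    · intro j hj
      simp [hterm ε j hj]
  -- the two-scale relation makes the sum over the scales telescope
  have htel : ∀ j : ℤ, ∑ ε : Dir n, scaleSum M ε.1 j ψ η =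
      scaleSum M 0 (j + 1) ψ η - scaleSum M 0 j ψ η := by
    intro j
    rw [← sum_scaleSum, ← Fintype.sum_subtype_add_sum_subtype (fun ε : Fin n → Fin 2 => ε ≠ 0)]
    have : ∑ ε : {ε : Fin n → Fin 2 // ¬ ε ≠ 0}, scaleSum M ε.1 j ψ η = scaleSum M 0 j ψ η := by
      rw [Fintype.sum_eq_single (⟨0, by simp⟩ : {ε : Fin n → Fin 2 // ¬ ε ≠ 0})]
      intro ε hε
      exact absurd (Subtype.ext (not_not.mp ε.2)) hε
    rw [this, add_sub_cancel_right]
  have hval : ∑' γ : Dir n × ℤ × (Fin n → ℤ),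
      (∫ x, M.wavelet γ.1.1 γ.2.1 γ.2.2 x * ψ x) * (𝓕⁻ (M.wavelet γ.1.1 γ.2.1 γ.2.2)) η =
      (𝓕⁻ ψ) η := by
    have hj : ∀ ε : Dir n, ∑' x : ℤ × (Fin n → ℤ),
        (∫ y, M.wavelet ε.1 x.1 x.2 y * ψ y) * (𝓕⁻ (M.wavelet ε.1 x.1 x.2)) η =
        ∑ j ∈ Finset.Ico a b, scaleSum M ε.1 j ψ η := by
      intro ε
      rw [(hsum.prod_factor ε).tsum_prod, tsum_eq_sum (s := Finset.Ico a b)]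
      · exact Finset.sum_congr rfl fun j _ => (hrow ε j).tsum_eq
      · intro j hj
        simp [hterm ε j hj]
    rw [hsum.tsum_prod, tsum_fintype, Finset.sum_congr rfl fun ε _ => hj ε, Finset.sum_comm,
      Finset.sum_congr rfl fun j _ => htel j]
    have hsumIco : ∀ N : ℕ, ∑ j ∈ Finset.Ico a (a + N),
        (scaleSum M 0 (j + 1) ψ η - scaleSum M 0 j ψ η) =
        scaleSum M 0 (a + N) ψ η - scaleSum M 0 a ψ η := by
      intro N
      induction N with
      | zero => simp
      | succ N ih =>
        have : Finset.Ico a (a + ((N + 1 : ℕ) : ℤ)) = insert (a + (N : ℤ)) (Finset.Ico a (a + N)) := by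
          ext x; simp only [Finset.mem_Ico, Finset.mem_insert]; push_cast; omega
        rw [this, Finset.sum_insert (by simp), ih]
        push_cast
        rw [← add_assoc]
        ring
    obtain ⟨N, hN⟩ := Int.eq_ofNat_of_zero_le (sub_nonneg.mpr hab)
    have hbN : b = a + N := by rw [← hN]; ring
    rw [hbN, hsumIco, ← hbN, scaleSum_zero_of_lt M (hb b le_rfl)]
    have : scaleSum M 0 a ψ η = 0 := by
      unfold scaleSum
      rw [ha a le_rfl 0]
      simp
    rw [this, sub_zero]
  exact hval ▸ hsum.hasSum

end Completeness

/-! ### Termwise integration and multipliers on the wavelet expansion -/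

/-- Termwise integration of a series, the summability being measured by `∑ ∫ ‖F i‖`. -/
theorem hasSum_integral_of_tsum_lintegral {α ι E : Type*} [MeasurableSpace α] {μ : Measure α}
    [Countable ι] [NormedAddCommGroup E] [NormedSpace ℝ E] [CompleteSpace E] {F : ι → α → E}
    {g : α → E} (hF : ∀ i, AEStronglyMeasurable (F i) μ) (hfin : ∑' i, ∫⁻ a, ‖F i a‖ₑ ∂μ ≠ ⊤)
    (hg : ∀ᵐ a ∂μ, HasSum (fun i => F i a) (g a)) :
    Integrable g μ ∧ HasSum (fun i => ∫ a, F i a ∂μ) (∫ a, g a ∂μ) := by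
  have hint : ∀ i, Integrable (F i) μ := fun i =>
    ⟨hF i, lt_top_iff_ne_top.mpr (ENNReal.ne_top_of_tsum_ne_top hfin i)⟩
  have hsum : Summable fun i => ∫ a, ‖F i a‖ ∂μ := by
    refine summable_of_tsum_enorm_ne_top (ne_top_of_le_ne_top hfin ?_)
    refine ENNReal.tsum_le_tsum fun i => ?_
    refine (enorm_integral_le_lintegral_enorm _).trans_eq ?_
    simp
  have h := hasSum_integral_of_summable_integral_norm hint hsum
  have hae : (fun a => ∑' i, F i a) =ᵐ[μ] g := by
    filter_upwards [hg] with a ha using ha.tsum_eq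
  rw [integral_congr_ae hae] at h
  refine ⟨?_, h⟩
  have hgm : AEStronglyMeasurable g μ := by
    have hcount : ∀ᵐ a ∂μ, Filter.Tendsto (fun s : Finset ι => ∑ i ∈ s, F i a) Filter.atTop
        (nhds (g a)) := hg
    exact aestronglyMeasurable_of_tendsto_ae Filter.atTop
      (fun s => Finset.aestronglyMeasurable_fun_sum s fun i _ => hF i) hcount
  refine ⟨hgm, lt_of_le_of_lt (lintegral_mono_ae ?_)
    (lt_of_le_of_lt (lintegral_tsum fun i => (hF i).enorm).le (lt_top_iff_ne_top.mpr hfin))⟩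
  filter_upwards [hg] with a ha
  rw [← ha.tsum_eq]
  exact enorm_tsum_le_tsum_enorm

section Expansion

variable {n : ℕ} (M : MeyerFunction)

/-- The index set of the Meyer wavelet basis: a direction, a scale and a translation. -/
abbrev Idx (n : ℕ) : Type := Dir n × ℤ × (Fin n → ℤ)

/-- The Meyer wavelet with a given index. -/
abbrev wav (γ : Idx n) : 𝓢(Eucl n, ℂ) := M.wavelet γ.1.1 γ.2.1 γ.2.2

/-- Sums of the wavelet coefficients of a Schwartz function against a weight that depends only on
the scale. -/
theorem exists_tsum_coeff_mul_le (n N : ℕ) : ∃ P : Seminorm ℝ 𝓢(Eucl n, ℂ), Continuous P ∧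
    ∀ (b : ℤ → ℝ≥0∞) (ψ : 𝓢(Eucl n, ℂ)),
      ∑' γ : Idx n, ‖∫ x, wav M γ x * ψ x‖ₑ * b γ.2.1 ≤
        (∑' j : ℤ, 2 ^ ((n : ℝ) * j / 2) * 2 ^ (-(2 * N * max (j : ℝ) 0)) * b j) *
          ENNReal.ofReal (P ψ) := by
  obtain ⟨P, hPc, hP⟩ := exists_tsum_wavelet_coeff_le M n N
  refine ⟨(Fintype.card (Dir n) : ℝ≥0) • P, hPc.const_smul _, fun b ψ => ?_⟩
  rw [ENNReal.tsum_prod', tsum_fintype]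
  calc ∑ ε : Dir n, ∑' x : ℤ × (Fin n → ℤ), ‖∫ y, M.wavelet ε.1 x.1 x.2 y * ψ y‖ₑ * b x.1
      ≤ ∑ _ε : Dir n, (∑' j : ℤ, 2 ^ ((n : ℝ) * j / 2) * 2 ^ (-(2 * N * max (j : ℝ) 0)) * b j) *
          ENNReal.ofReal (P ψ) := by
        refine Finset.sum_le_sum fun ε _ => ?_
        rw [ENNReal.tsum_prod', ← ENNReal.tsum_mul_right]
        refine ENNReal.tsum_le_tsum fun j => ?_
        dsimp only
        rw [ENNReal.tsum_mul_right]
        calc _ ≤ (2 ^ ((n : ℝ) * j / 2) * 2 ^ (-(2 * N * max (j : ℝ) 0)) *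
              ENNReal.ofReal (P ψ)) * b j := by gcongr; exact hP ε j ψ
          _ = _ := by ring
    _ = _ := by
        rw [Finset.sum_const, Finset.card_univ, nsmul_eq_mul, smul_apply, NNReal.smul_def,
          smul_eq_mul, ENNReal.ofReal_mul (NNReal.coe_nonneg _), ENNReal.ofReal_coe_nnreal]
        push_cast
        ring

/-- The weight `2^{aj}` is admissible as long as it does not undo the factor `2^{nj/2}` of the coarse
scales and the decay of the fine scales. -/
theorem tsum_scale_weight_lt_top {N : ℕ} {a : ℝ} (ha : 0 < (n : ℝ) / 2 + a)
    (hN : (n : ℝ) / 2 + a < 2 * N) :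
    ∑' j : ℤ, (2 : ℝ≥0∞) ^ ((n : ℝ) * j / 2) * 2 ^ (-(2 * N * max (j : ℝ) 0)) * 2 ^ (a * j) < ⊤ := by
  set r := min ((n : ℝ) / 2 + a) (2 * N - ((n : ℝ) / 2 + a)) with hr
  have hr0 : 0 < r := lt_min ha (by linarith)
  refine lt_of_le_of_lt (ENNReal.tsum_le_tsum fun j => ?_) (tsum_two_rpow_neg_abs_lt_top hr0)
  rw [← two_rpow_add, ← two_rpow_add]
  refine ENNReal.rpow_le_rpow_of_exponent_le one_le_two ?_
  rcases le_total (j : ℝ) 0 with hj | hj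
  · rw [max_eq_right hj, abs_of_nonpos hj]
    nlinarith [min_le_left ((n : ℝ) / 2 + a) (2 * N - ((n : ℝ) / 2 + a))]
  · rw [max_eq_left hj, abs_of_nonneg hj]
    nlinarith [min_le_right ((n : ℝ) / 2 + a) (2 * N - ((n : ℝ) / 2 + a))]

theorem norm_heatSymbol_le (ρ : Eucl n → ℂ) {τ : ℝ} (hτ : 0 ≤ τ) (η : Eucl n) :
    ‖heatSymbol ρ τ η‖ ≤ ‖ρ η‖ := by
  unfold heatSymbol
  rw [norm_mul, Complex.norm_exp]
  refine mul_le_of_le_one_left (norm_nonneg _) (Real.exp_le_one_iff.mpr ?_)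
  rw [Complex.neg_re, Complex.ofReal_re, neg_nonpos]
  positivity

theorem continuous_heatSymbol {ρ : Eucl n → ℂ} (hρ : Continuous ρ) :
    Continuous fun z : ℝ × Eucl n => heatSymbol ρ z.1 z.2 := by
  unfold heatSymbol; fun_prop

theorem exists_lintegral_symbol_mul_wavelet_le {ρ : Eucl n → ℂ} (hρ : IsHomogeneousSymbol ρ) :
    ∃ C : ℝ≥0, ∀ (ε : Dir n) (j : ℤ) (k : Fin n → ℤ),
      ∫⁻ η, ‖ρ η‖ₑ * ‖(𝓕⁻ (M.wavelet ε.1 j k)) η‖ₑ ≤ C * 2 ^ (((n : ℝ) / 2 + 1) * j) := by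
  have hfin : ∀ ε : Dir n, ∫⁻ η : Eucl n, ‖ρ η‖ₑ * ‖M.symbolProd ε.1 (-η)‖ₑ ≠ ⊤ := by
    intro ε
    have hc : Continuous fun η : Eucl n => ρ η * M.symbolProd ε.1 (-η) :=
      hρ.continuous.mul ((M.symbolProd_smooth ε.1).continuous.comp continuous_neg)
    have hcs : HasCompactSupport fun η : Eucl n => ρ η * M.symbolProd ε.1 (-η) :=
      ((M.symbolProd_hasCompactSupport ε.1).comp_homeomorph (Homeomorph.neg _)).mul_left
    have := (hc.integrable_of_hasCompactSupport hcs (μ := volume)).2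
    simp only [HasFiniteIntegral, enorm_mul] at this
    exact this.ne
  set C : ℝ≥0 := ∑ ε : Dir n, (∫⁻ η : Eucl n, ‖ρ η‖ₑ * ‖M.symbolProd ε.1 (-η)‖ₑ).toNNReal with hC
  refine ⟨C, fun ε j k => ?_⟩
  have hscale : ∀ η : Eucl n, ‖ρ η‖ₑ * ‖(𝓕⁻ (M.wavelet ε.1 j k)) η‖ₑ =
      2 ^ ((j : ℝ) - (n : ℝ) * j / 2) * (fun z : Eucl n => ‖ρ z‖ₑ * ‖M.symbolProd ε.1 (-z)‖ₑ)
        ((2 : ℝ) ^ (-j) • η - 0) := by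
    intro η
    have h1 : η = (2 : ℝ) ^ j • ((2 : ℝ) ^ (-j) • η) := by
      rw [smul_smul, ← zpow_add₀ two_ne_zero, add_neg_cancel, zpow_zero, one_smul]
    have h2 : ρ η = ((2 : ℝ) ^ j : ℝ) * ρ ((2 : ℝ) ^ (-j) • η) := by
      conv_lhs => rw [h1]
      rw [hρ.homogeneous _ (by positivity)]
    rw [h2, M.wavelet_eq_atom, fourierInv_atom, fourierInv_mother, sub_zero, ← Real.rpow_intCast 2 j]
    simp only [enorm_mul, enorm_two_rpow]
    have h3 : ‖Complex.exp (↑(2 * Real.pi * inner ℝ (lat k) ((2 : ℝ) ^ (-j) • η)) * Complex.I)‖ₑ =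
        1 := by
      rw [← ofReal_norm, Complex.norm_exp_ofReal_mul_I, ENNReal.ofReal_one]
    rw [h3, sub_eq_add_neg, two_rpow_add]
    ring
  rw [lintegral_congr hscale, lintegral_const_mul' _ _ (two_rpow_ne_top _),
    lintegral_comp_smul_sub (fun z : Eucl n => ‖ρ z‖ₑ * ‖M.symbolProd ε.1 (-z)‖ₑ), ← mul_assoc,
    ← two_rpow_add, mul_comm]
  refine mul_le_mul' ?_ (le_of_eq ?_)
  · rw [← ENNReal.coe_toNNReal (hfin ε)]
    exact_mod_cast Finset.single_le_sum
      (f := fun ε : Dir n => (∫⁻ η : Eucl n, ‖ρ η‖ₑ * ‖M.symbolProd ε.1 (-η)‖ₑ).toNNReal)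
      (fun _ _ => zero_le) (Finset.mem_univ ε)
  · congr 1; push_cast; ring

/-- The transposed multiplier may be applied termwise to the wavelet expansion of a Schwartz
function. -/
theorem hasSum_transposeMultiplier {ρ : Eucl n → ℂ} (hρ : IsHomogeneousSymbol ρ) (hn : 0 < n)
    {τ : ℝ} (hτ : 0 ≤ τ) (ψ : 𝓢(Eucl n, ℂ)) (x : Eucl n) :
    HasSum (fun γ : Idx n => (∫ y, wav M γ y * ψ y) *
      transposeMultiplier (heatSymbol ρ τ) (wav M γ) x)
      (transposeMultiplier (heatSymbol ρ τ) ψ x) := by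
  obtain ⟨C, hC⟩ := exists_lintegral_symbol_mul_wavelet_le M hρ
  obtain ⟨P, -, hP⟩ := exists_tsum_coeff_mul_le M n (n + 1)
  have hσ : Continuous (heatSymbol ρ τ) :=
    (continuous_heatSymbol hρ.continuous).comp (Continuous.prodMk_right τ)
  set F : Idx n → Eucl n → ℂ := fun γ η => (∫ y, wav M γ y * ψ y) *
    (Complex.exp (↑(-2 * Real.pi * inner ℝ η x) * Complex.I) •
      (heatSymbol ρ τ η * (𝓕⁻ (wav M γ)) η)) with hF
  -- for `n = 0` the zero frequency would be all there is
  have hnull : ∀ᵐ η : Eucl n, η ≠ 0 := by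
    have : Nonempty (Fin n) := ⟨⟨0, hn⟩⟩
    have : Nontrivial (Eucl n) := inferInstance
    exact Measure.ae_ne volume 0
  have key := hasSum_integral_of_tsum_lintegral (μ := (volume : Measure (Eucl n))) (F := F)
    (g := fun η => Complex.exp (↑(-2 * Real.pi * inner ℝ η x) * Complex.I) •
      (heatSymbol ρ τ η * (𝓕⁻ ψ) η)) ?_ ?_ ?_
  · have h2 := key.2
    simp only [hF, integral_const_mul] at h2
    simp only [transposeMultiplier, Real.fourier_eq']
    exact h2
  · intro γ
    have : Continuous fun η => (𝓕⁻ (wav M γ)) η := (𝓕⁻ (wav M γ)).continuous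
    exact Continuous.aestronglyMeasurable (by rw [hF]; fun_prop)
  · refine ne_top_of_le_ne_top ?_ ((ENNReal.tsum_le_tsum (fun γ => ?_)).trans
      (hP (fun j => C * 2 ^ (((n : ℝ) / 2 + 1) * j)) ψ))
    · refine ENNReal.mul_ne_top ?_ ENNReal.ofReal_ne_top
      simp only [mul_left_comm _ (C : ℝ≥0∞)]
      rw [ENNReal.tsum_mul_left]
      refine ENNReal.mul_ne_top ENNReal.coe_ne_top (tsum_scale_weight_lt_top ?_ ?_).ne
      · positivity
      · push_cast; linarith
    · calc ∫⁻ η, ‖F γ η‖ₑ ≤ ∫⁻ η, ‖∫ y, wav M γ y * ψ y‖ₑ *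
            (‖ρ η‖ₑ * ‖(𝓕⁻ (wav M γ)) η‖ₑ) := by
            refine lintegral_mono fun η => ?_
            rw [hF]
            simp only [enorm_mul, smul_eq_mul]
            have h3 : ‖Complex.exp (↑(-2 * Real.pi * inner ℝ η x) * Complex.I)‖ₑ = 1 := by
              rw [← ofReal_norm, Complex.norm_exp_ofReal_mul_I, ENNReal.ofReal_one]
            rw [h3, one_mul]
            gcongr
            exact enorm_le_iff_norm_le.mpr (norm_heatSymbol_le ρ hτ η)
        _ = ‖∫ y, wav M γ y * ψ y‖ₑ * ∫⁻ η, ‖ρ η‖ₑ * ‖(𝓕⁻ (wav M γ)) η‖ₑ :=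
            lintegral_const_mul' _ _ enorm_ne_top
        _ ≤ _ := by gcongr; exact hC γ.1 γ.2.1 γ.2.2
  · filter_upwards [hnull] with η hη
    have h := (hasSum_fourierInv_wavelet M ψ hη).mul_left
      (Complex.exp (↑(-2 * Real.pi * inner ℝ η x) * Complex.I) * heatSymbol ρ τ η)
    rw [smul_eq_mul, ← mul_assoc]
    refine h.congr_fun fun γ => ?_
    rw [hF]
    simp only [smul_eq_mul]
    ring

end Expansion

/-! ### Frequency localization -/

section Orthogonality

variable {n : ℕ} (M : MeyerFunction)

/-- The frequency support of a wavelet, in every coordinate. -/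
theorem abs_le_of_fourierInv_wavelet_ne_zero {ε : Fin n → Fin 2} {j : ℤ} {k : Fin n → ℤ}
    {η : Eucl n} (h : (𝓕⁻ (M.wavelet ε j k)) η ≠ 0) (i : Fin n) : |η i| ≤ 2 ^ j * (4 / 3) := by
  rw [M.wavelet_eq_atom, fourierInv_atom, fourierInv_mother] at h
  have h2 : (0 : ℝ) < 2 ^ j := by positivity
  have := abs_le_of_symbol_ne_zero M (symbol_ne_zero_of_symbolProd M (right_ne_zero_of_mul h) i)
  rwa [PiLp.neg_apply, abs_neg, PiLp.smul_apply, smul_eq_mul, abs_mul, abs_of_pos (by positivity),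
    zpow_neg, inv_mul_le_iff₀ h2] at this

theorem abs_le_of_fourierInv_wavelet_zero_ne_zero {j : ℤ} {k : Fin n → ℤ}
    {η : Eucl n} (h : (𝓕⁻ (M.wavelet 0 j k)) η ≠ 0) (i : Fin n) : |η i| ≤ 2 ^ j * (2 / 3) := by
  rw [M.wavelet_eq_atom, fourierInv_atom, fourierInv_mother] at h
  have h2 : (0 : ℝ) < 2 ^ j := by positivity
  have := abs_le_of_symbol_zero_ne_zero M
    (symbol_ne_zero_of_symbolProd M (right_ne_zero_of_mul h) i)
  rwa [PiLp.neg_apply, abs_neg, PiLp.smul_apply, smul_eq_mul, abs_mul, abs_of_pos (by positivity),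
    zpow_neg, inv_mul_le_iff₀ h2] at this

theorem exists_lt_abs_of_fourierInv_wavelet_ne_zero {ε : Dir n} {j : ℤ} {k : Fin n → ℤ}
    {η : Eucl n} (h : (𝓕⁻ (M.wavelet ε.1 j k)) η ≠ 0) : ∃ i, 2 ^ j * (1 / 3) < |η i| := by
  rw [M.wavelet_eq_atom, fourierInv_atom, fourierInv_mother] at h
  have h2 : (0 : ℝ) < 2 ^ j := by positivity
  obtain ⟨i, hi⟩ := Function.ne_iff.mp ε.2
  refine ⟨i, ?_⟩
  have := lt_abs_of_symbol_ne_zero M hi (symbol_ne_zero_of_symbolProd M (right_ne_zero_of_mul h) i)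
  rwa [PiLp.neg_apply, abs_neg, PiLp.smul_apply, smul_eq_mul, abs_mul, abs_of_pos (by positivity),
    zpow_neg, lt_inv_mul_iff₀ h2] at this

/-- Wavelets are orthogonal to the low frequency functions of coarser scales. -/
theorem integral_wavelet_mul_low_eq_zero (γ : Idx n) {j : ℤ} (hj : j < γ.2.1) (k : Fin n → ℤ) :
    ∫ x, wav M γ x * M.wavelet 0 j k x = 0 := by
  rw [integral_mul_eq_fourier]
  have : ∀ η : Eucl n, (𝓕⁻ (wav M γ)) η * (𝓕 (M.wavelet 0 j k)) η = 0 := by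
    intro η
    by_contra hne
    obtain ⟨i, hi⟩ := exists_lt_abs_of_fourierInv_wavelet_ne_zero M (left_ne_zero_of_mul hne)
    have h0 : (𝓕⁻ (M.wavelet 0 j k)) (-η) ≠ 0 := by
      rw [fourierInv_apply_eq_fourier_neg, neg_neg]
      exact right_ne_zero_of_mul hne
    have h1 := abs_le_of_fourierInv_wavelet_zero_ne_zero M h0 i
    rw [PiLp.neg_apply, abs_neg] at h1
    have h2 : (2 : ℝ) ^ j * 2 ≤ 2 ^ γ.2.1 := by
      rw [← zpow_add_one₀ two_ne_zero]
      exact zpow_le_zpow_right₀ one_le_two (by omega)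
    linarith
  simp [this]

/-- The inverse Fourier transform of a product is a convolution. -/
theorem fourierInv_mul_eq (a b : 𝓢(Eucl n, ℂ)) (η : Eucl n) :
    (𝓕⁻ (SchwartzMap.pairing (ContinuousLinearMap.mul ℂ ℂ) a b)) η =
      ∫ z, (𝓕⁻ a) z * (𝓕⁻ b) (η - z) := by
  have h : 𝓕⁻ (SchwartzMap.pairing (ContinuousLinearMap.mul ℂ ℂ) a b) =
      SchwartzMap.convolution (ContinuousLinearMap.mul ℂ ℂ) (𝓕⁻ a) (𝓕⁻ b) := by
    simp [SchwartzMap.convolution]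
  rw [h, SchwartzMap.convolution_apply]
  rfl

theorem integrable_heatSymbol_mul_wavelet {ρ : Eucl n → ℂ} (hρ : IsHomogeneousSymbol ρ) {τ : ℝ}
    (hτ : 0 ≤ τ) (γ : Idx n) : Integrable fun η => heatSymbol ρ τ η * (𝓕⁻ (wav M γ)) η := by
  obtain ⟨C, hC⟩ := exists_lintegral_symbol_mul_wavelet_le M hρ
  have hσ : Continuous (heatSymbol ρ τ) :=
    (continuous_heatSymbol hρ.continuous).comp (Continuous.prodMk_right τ)
  refine ⟨(hσ.mul (𝓕⁻ (wav M γ)).continuous).aestronglyMeasurable, ?_⟩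
  refine lt_of_le_of_lt (lintegral_mono fun η => ?_) ((hC γ.1 γ.2.1 γ.2.2).trans_lt
    (ENNReal.mul_lt_top ENNReal.coe_lt_top (two_rpow_ne_top _).lt_top))
  rw [enorm_mul]
  gcongr
  exact enorm_le_iff_norm_le.mpr (norm_heatSymbol_le ρ hτ η)

/-- The product of a low frequency function two scales below with a wavelet has its frequencies in
an annulus, so that it is only seen by wavelets of neighbouring scales. -/
theorem integral_mul_transposeMultiplier_eq_zero {ρ : Eucl n → ℂ} (hρ : IsHomogeneousSymbol ρ)
    {τ : ℝ} (hτ : 0 ≤ τ) (ε : Dir n) (γ : Idx n) {j : ℤ} (hj : 2 < |γ.2.1 - j|)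
    (k k' : Fin n → ℤ) :
    ∫ x, M.wavelet 0 (j - 2) k x * M.wavelet ε.1 j k' x *
      transposeMultiplier (heatSymbol ρ τ) (wav M γ) x = 0 := by
  set a := M.wavelet (n := n) 0 (j - 2) k
  set b := M.wavelet ε.1 j k'
  set m := SchwartzMap.pairing (ContinuousLinearMap.mul ℂ ℂ) a b with hm
  set g : Eucl n → ℂ := fun η => heatSymbol ρ τ η * (𝓕⁻ (wav M γ)) η with hg
  have hflip : ∫ η, (𝓕 m) η * g η = ∫ x, m x * 𝓕 g x := by
    have h := VectorFourier.integral_bilin_fourierIntegral_eq_flip (ContinuousLinearMap.mul ℂ ℂ)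
      (L := innerₗ (Eucl n)) (μ := volume) (ν := volume) Real.continuous_fourierChar
      continuous_inner m.integrable (integrable_heatSymbol_mul_wavelet M hρ hτ γ)
    rw [flip_innerₗ] at h
    exact h
  have hz : ∀ η, (𝓕 m) η * g η = 0 := by
    intro η
    by_contra hne
    have hg0 : (𝓕⁻ (wav M γ)) η ≠ 0 := right_ne_zero_of_mul (right_ne_zero_of_mul hne)
    have hm0 : (𝓕⁻ m) (-η) ≠ 0 := by
      rw [fourierInv_apply_eq_fourier_neg, neg_neg]
      exact left_ne_zero_of_mul hne
    rw [hm, fourierInv_mul_eq] at hm0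
    obtain ⟨z, hzne⟩ : ∃ z, (𝓕⁻ a) z * (𝓕⁻ b) (-η - z) ≠ 0 := by
      by_contra hcon
      push Not at hcon
      exact hm0 (by simp [hcon])
    -- `z` is a low frequency, `-η - z` a frequency at the scale `j`, `η` one at the scale of `γ`
    have ha : ∀ i, |z i| ≤ (2 : ℝ) ^ (j - 2) * (2 / 3) :=
      abs_le_of_fourierInv_wavelet_zero_ne_zero M (left_ne_zero_of_mul hzne)
    have hb := abs_le_of_fourierInv_wavelet_ne_zero M (right_ne_zero_of_mul hzne)
    obtain ⟨i, hi⟩ := exists_lt_abs_of_fourierInv_wavelet_ne_zero M (right_ne_zero_of_mul hzne)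
    have hc := abs_le_of_fourierInv_wavelet_ne_zero M hg0
    obtain ⟨i', hi'⟩ := exists_lt_abs_of_fourierInv_wavelet_ne_zero M hg0
    have hj2 : (2 : ℝ) ^ (j - 2) = 2 ^ j / 4 := by
      rw [zpow_sub₀ two_ne_zero]; norm_num
    rw [hj2] at ha
    have hw : ∀ i, (-η - z) i = -η i - z i := fun i => rfl
    have htri : ∀ i, |-η i - z i| ≤ |η i| + |z i| := fun i => by
      have := abs_sub (-η i) (z i); rwa [abs_neg] at this
    have htri' : ∀ i, |η i| ≤ |-η i - z i| + |z i| := fun i => by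
      have := abs_add_le (-η i - z i) (z i)
      rwa [sub_add_cancel, abs_neg] at this
    rw [hw] at hi
    have hpj : (0 : ℝ) < 2 ^ j := by positivity
    have hpg : (0 : ℝ) < 2 ^ γ.2.1 := by positivity
    rcases lt_abs.mp hj with h | h
    · have : (2 : ℝ) ^ j * 8 ≤ 2 ^ γ.2.1 := by
        have e : (2 : ℝ) ^ j * 8 = 2 ^ (j + 3) := by rw [zpow_add₀ two_ne_zero]; norm_num
        rw [e]; exact zpow_le_zpow_right₀ one_le_two (by omega)
      have h1 := hb i'
      rw [hw] at h1
      linarith [htri' i', ha i']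
    · have : (2 : ℝ) ^ γ.2.1 * 8 ≤ 2 ^ j := by
        have e : (2 : ℝ) ^ γ.2.1 * 8 = 2 ^ (γ.2.1 + 3) := by rw [zpow_add₀ two_ne_zero]; norm_num
        rw [e]; exact zpow_le_zpow_right₀ one_le_two (by omega)
      linarith [htri i, ha i, hc i]
  have : ∫ x, m x * 𝓕 g x = 0 := by rw [← hflip]; simp [hz]
  exact this

end Orthogonality

section Transpose

variable {n : ℕ}

/-- Joint measurability in time and space of the transposed heat multiplier. -/
theorem stronglyMeasurable_transposeMultiplier {ρ : Eucl n → ℂ} (hρ : Continuous ρ)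
    (ψ : 𝓢(Eucl n, ℂ)) :
    StronglyMeasurable fun z : ℝ × Eucl n => transposeMultiplier (heatSymbol ρ z.1) ψ z.2 := by
  have h : Continuous fun z : (ℝ × Eucl n) × Eucl n =>
      Complex.exp (↑(-2 * Real.pi * inner ℝ z.2 z.1.2) * Complex.I) •
        (heatSymbol ρ z.1.1 z.2 * (𝓕⁻ ψ) z.2) := by
    have h1 : Continuous fun z : (ℝ × Eucl n) × Eucl n => heatSymbol ρ z.1.1 z.2 :=
      (continuous_heatSymbol hρ).comp (by fun_prop : Continuous fun z : (ℝ × Eucl n) × Eucl n =>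
        (z.1.1, z.2))
    have h2 : Continuous fun z : (ℝ × Eucl n) × Eucl n => (𝓕⁻ ψ) z.2 :=
      (𝓕⁻ ψ).continuous.comp continuous_snd
    fun_prop
  simp only [transposeMultiplier, Real.fourier_eq']
  exact h.stronglyMeasurable.integral_prod_right

theorem measurable_transposeMultiplier {ρ : Eucl n → ℂ} (hρ : Continuous ρ) (τ : ℝ)
    (ψ : 𝓢(Eucl n, ℂ)) : Measurable fun x => transposeMultiplier (heatSymbol ρ τ) ψ x := by
  have h := (stronglyMeasurable_transposeMultiplier hρ ψ).measurable.comp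
    (measurable_prodMk_left (x := τ))
  simpa only [Function.comp_def] using h

theorem exists_lintegral_transposeMultiplier_wavelet_le (M : MeyerFunction) {ρ : Eucl n → ℂ}
    (hρ : IsHomogeneousSymbol ρ) : ∃ C : ℝ≥0, ∀ (γ : Idx n) (τ : ℝ), 0 ≤ τ →
      ∫⁻ x, ‖transposeMultiplier (heatSymbol ρ τ) (wav M γ) x‖ₑ ≤
        C * 2 ^ ((1 - (n : ℝ) / 2) * γ.2.1) := by
  obtain ⟨C, hC⟩ := exists_transposeMultiplier_wavelet_le M hρ 0
  have hp : (∫⁻ x : Eucl n, prof x) ≠ ⊤ := lintegral_prof_lt_top.ne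
  refine ⟨C * (∫⁻ x : Eucl n, prof x).toNNReal, fun γ τ hτ => ?_⟩
  rw [ENNReal.coe_mul, ENNReal.coe_toNNReal hp]
  obtain ⟨ε, j, k⟩ := γ
  calc ∫⁻ x, ‖transposeMultiplier (heatSymbol ρ τ) (wav M (ε, j, k)) x‖ₑ
      ≤ ∫⁻ x, (C * 2 ^ (j : ℝ) * 2 ^ ((n : ℝ) * j / 2)) * prof ((2 : ℝ) ^ j • x - lat k) := by
        refine lintegral_mono fun x => (hC ε τ hτ j k x).trans_eq ?_
        simp only [pow_zero, inv_one, ENNReal.ofReal_one, mul_one]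
        ring
    _ = (C * 2 ^ (j : ℝ) * 2 ^ ((n : ℝ) * j / 2)) *
        (2 ^ (-((n : ℝ) * j)) * ∫⁻ x : Eucl n, prof x) := by
        rw [lintegral_const_mul' _ _ (ENNReal.mul_ne_top (ENNReal.mul_ne_top ENNReal.coe_ne_top
          (two_rpow_ne_top _)) (two_rpow_ne_top _)), lintegral_comp_smul_sub]
    _ = C * (∫⁻ x : Eucl n, prof x) *
        (2 ^ (j : ℝ) * 2 ^ ((n : ℝ) * j / 2) * 2 ^ (-((n : ℝ) * j))) := by ring
    _ = _ := by
        rw [← two_rpow_add, ← two_rpow_add]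
        congr 2; ring

end Transpose

/-! ### Pointwise estimates for the projections of a flow -/

section Flow

variable {n : ℕ} (M : MeyerFunction)

/-- The exponent `α x` for `x ≤ 0` and `-β x` for `x ≥ 0`: relative to `2^{jt}`, the coefficients of
a flow at the scale `j` are bounded by `2` to the power `decay α β (j - jt)`, where
`α = 1 - 2m'` and `β = 2m - 1`. -/
def decay (α β x : ℝ) : ℝ := α * min x 0 - β * max x 0

theorem exists_mem_ring {s : ℝ} (hs : 0 < s) : ∃ jt : ℤ, s ∈ ring jt := by
  obtain ⟨i, h1, h2⟩ := exists_mem_Ico_zpow hs (by norm_num : (1 : ℝ) < 4)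
  have h4 : ∀ i : ℤ, (4 : ℝ) ^ i = 2 ^ (2 * i) := fun i => by
    rw [zpow_mul]; norm_num
  rw [h4] at h1 h2
  refine ⟨-i, ?_, ?_⟩
  · convert! h1 using 2; ring
  · convert! h2 using 2; ring

/-- Finiteness of the flow norm in terms of the discrete norms of the coefficients. -/
theorem exists_seqNorm_ringSeq_le {p m' m : ℝ} {q : ℝ≥0∞} (hp : 1 < p) (hq : 1 ≤ q)
    {f : ℝ → 𝓢'(Eucl n, ℂ)} (hf : flowNorm M p q m' m f < ⊤) :
    ∃ C : ℝ≥0, ∀ j jt : ℤ, seqNorm (1 - 1 / p) (ringSeq M f j jt) ≤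
      C * 2 ^ (jt : ℝ) * 2 ^ decay (1 - 2 * m') (2 * m - 1) ((j : ℝ) - jt) := by
  obtain ⟨C, hC⟩ := exists_ringNorm_le M hq hf
  refine ⟨(1 - 1 / p)⁻¹.toNNReal * C, fun j jt => ?_⟩
  refine (seqNorm_le_ringNorm M hp (if jt ≤ j then m else m') f j jt).trans ?_
  calc _ ≤ ENNReal.ofReal (1 - 1 / p)⁻¹ *
        (2 ^ (-(2 * ((j : ℝ) - jt) * (if jt ≤ j then m else m'))) * 2 ^ (j : ℝ) * C) := by
        gcongr; exact hC j jt
    _ = (ENNReal.ofReal (1 - 1 / p)⁻¹ * C) *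
        2 ^ (-(2 * ((j : ℝ) - jt) * (if jt ≤ j then m else m')) + j) := by
        rw [two_rpow_add]; ring
    _ = (ENNReal.ofReal (1 - 1 / p)⁻¹ * C) *
        2 ^ ((jt : ℝ) + decay (1 - 2 * m') (2 * m - 1) ((j : ℝ) - jt)) := by
        congr 2
        unfold decay
        split_ifs with h
        · have : (0 : ℝ) ≤ (j : ℝ) - jt := sub_nonneg.mpr (by exact_mod_cast h)
          rw [min_eq_right this, max_eq_left this]; ring
        · have : (j : ℝ) - jt ≤ 0 := sub_nonpos.mpr (by exact_mod_cast (not_le.mp h).le)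
          rw [min_eq_left this, max_eq_right this]; ring
    _ = _ := by
        rw [two_rpow_add, ENNReal.coe_mul, ← mul_assoc]
        rfl

/-- Bounds for the series of absolute values of `Q^ε_j f(s, x)`. -/
theorem exists_tsum_coeff_wavelet_le (n : ℕ) : ∃ C : ℝ≥0, ∀ (f : ℝ → 𝓢'(Eucl n, ℂ)) (ε : Dir n)
    (j jt : ℤ) (s : ℝ), s ∈ ring jt → ∀ x : Eucl n,
      ∑' k, ‖coeff M (f s) ε j k * M.wavelet ε j k x‖ₑ ≤
        C * ∑' k, ringSeq M f j jt k * prof ((2 : ℝ) ^ j • x - lat k) := by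
  obtain ⟨C, hC⟩ := exists_enorm_wavelet_le M n
  refine ⟨C, fun f ε j jt s hs x => ?_⟩
  rw [← ENNReal.tsum_mul_left]
  refine ENNReal.tsum_le_tsum fun k => ?_
  rw [enorm_mul]
  calc ‖coeff M (f s) ε j k‖ₑ * ‖M.wavelet ε j k x‖ₑ
      ≤ ‖coeff M (f s) ε j k‖ₑ * (C * 2 ^ ((n : ℝ) * j / 2) * prof ((2 : ℝ) ^ j • x - lat k)) := by
        gcongr; exact hC ε j k x
    _ = C * ((2 ^ ((n : ℝ) * j / 2) * ‖coeff M (f s) ε j k‖ₑ) *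
        prof ((2 : ℝ) ^ j • x - lat k)) := by ring
    _ ≤ _ := by
        gcongr
        refine le_trans ?_ (cellSeq_le_ringSeq M f j hs k)
        unfold cellSeq
        gcongr
        exact ENNReal.le_tsum (f := fun ε : Dir n => ‖coeff M (f s) ε j k‖ₑ) ε

/-- Only the uniform bound of the coefficients enters here, `le_seqNorm`. -/
theorem exists_tsum_mul_prof_le (n : ℕ) : ∃ C : ℝ≥0, ∀ (θ : ℝ) (a : (Fin n → ℤ) → ℝ≥0∞)
    (y : Eucl n), ∑' k, a k * prof (y - lat k) ≤ C * seqNorm θ a := by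
  obtain ⟨C, hC⟩ := exists_tsum_prof_le n
  refine ⟨C, fun θ a y => ?_⟩
  calc ∑' k, a k * prof (y - lat k) ≤ ∑' k, seqNorm θ a * prof (y - lat k) := by
        gcongr with k; exact le_seqNorm θ a k
    _ = seqNorm θ a * ∑' k, prof (y - lat k) := ENNReal.tsum_mul_left
    _ ≤ seqNorm θ a * C := by gcongr; exact hC y
    _ = _ := mul_comm _ _

/-- A geometric sum, cut at `j`. -/
theorem exists_tsum_decay_le {α β : ℝ} (hα : 0 < α) (hβ : 0 < β) : ∃ C : ℝ≥0, ∀ j jt : ℤ,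
    ∑' i : ℤ, (if i ≤ j then (2 : ℝ≥0∞) ^ decay α β ((i : ℝ) - jt) else 0) ≤
      C * 2 ^ (α * min ((j : ℝ) - jt) 0) := by
  set δ := min α β with hδ
  have hδ0 : 0 < δ := lt_min hα hβ
  have hfin := tsum_two_rpow_neg_abs_lt_top hδ0
  refine ⟨_, fun j jt => le_of_le_of_eq ?_
    (congrArg (· * _) (ENNReal.coe_toNNReal hfin.ne).symm)⟩
  have hterm : ∀ i : ℤ, (if i ≤ j then (2 : ℝ≥0∞) ^ decay α β ((i : ℝ) - jt) else 0) ≤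
      2 ^ (-(δ * |((i - min j jt : ℤ) : ℝ)|)) * 2 ^ (α * min ((j : ℝ) - jt) 0) := by
    intro i
    split_ifs with h
    · rw [← two_rpow_add]
      refine ENNReal.rpow_le_rpow_of_exponent_le one_le_two ?_
      have h' : (i : ℝ) ≤ j := by exact_mod_cast h
      have h1 : δ ≤ α := min_le_left _ _
      have h2 : δ ≤ β := min_le_right _ _
      push_cast
      unfold decay
      rcases le_total (j : ℝ) jt with hj | hj
      · rw [min_eq_left hj, min_eq_left (by linarith), min_eq_left (by linarith),
          max_eq_right (by linarith), abs_of_nonpos (by linarith)]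
        nlinarith
      · rw [min_eq_right hj, min_eq_right (a := (j : ℝ) - jt) (by linarith)]
        rcases le_total (i : ℝ) jt with hi | hi
        · rw [min_eq_left (by linarith), max_eq_right (by linarith), abs_of_nonpos (by linarith)]
          nlinarith
        · rw [min_eq_right (by linarith), max_eq_left (by linarith), abs_of_nonneg (by linarith)]
          nlinarith
    · exact zero_le
  refine (ENNReal.tsum_le_tsum hterm).trans_eq ?_
  rw [ENNReal.tsum_mul_right]
  congr 1
  exact (Equiv.subRight (min j jt)).tsum_eq fun i : ℤ => (2 : ℝ≥0∞) ^ (-(δ * |(i : ℝ)|))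

/-- Bounds for the series of absolute values of `P_j f(s, x)`: the low frequency coefficients are
recovered from the wavelet coefficients at the coarser scales. -/
theorem exists_tsum_coeff_low_le {θ α β : ℝ} (hα : 0 < α) (hβ : 0 < β)
    {f : ℝ → 𝓢'(Eucl n, ℂ)} {C₀ : ℝ≥0}
    (hexp : ∀ t : ℝ, 0 < t → ∀ ψ : 𝓢(Eucl n, ℂ),
      HasSum (fun γ : Idx n => coeff M (f t) γ.1 γ.2.1 γ.2.2 * ∫ x, wav M γ x * ψ x) (f t ψ))
    (hseq : ∀ j jt : ℤ, seqNorm θ (ringSeq M f j jt) ≤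
      C₀ * 2 ^ (jt : ℝ) * 2 ^ decay α β ((j : ℝ) - jt)) :
    ∃ C : ℝ≥0, ∀ (j jt : ℤ) (s : ℝ), s ∈ ring jt → ∀ x : Eucl n,
      ∑' k, ‖coeff M (f s) 0 j k * M.wavelet 0 j k x‖ₑ ≤
        C * 2 ^ (jt : ℝ) * 2 ^ (α * min ((j : ℝ) - jt) 0) := by
  obtain ⟨C₁, hC₁⟩ := exists_tsum_enorm_wavelet_le M n
  obtain ⟨C₂, hC₂⟩ := exists_lintegral_enorm_wavelet_le M n
  obtain ⟨C₃, hC₃⟩ := exists_tsum_decay_le hα hβ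
  set D : ℝ≥0 := (Fintype.card (Dir n) : ℝ≥0) with hD
  have hs0 : ∀ {jt : ℤ} {s : ℝ}, s ∈ ring jt → 0 < s := fun hs =>
    lt_of_lt_of_le (by positivity) hs.1
  -- the coefficients of `f(s)` against the wavelets
  have hco : ∀ (γ : Idx n) (jt : ℤ) (s : ℝ), s ∈ ring jt →
      ‖coeff M (f s) γ.1 γ.2.1 γ.2.2‖ₑ ≤ 2 ^ (-((n : ℝ) * γ.2.1 / 2)) *
        (C₀ * 2 ^ (jt : ℝ) * 2 ^ decay α β ((γ.2.1 : ℝ) - jt)) := by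
    intro γ jt s hs
    have h1 : 2 ^ ((n : ℝ) * γ.2.1 / 2) * ‖coeff M (f s) γ.1 γ.2.1 γ.2.2‖ₑ ≤
        C₀ * 2 ^ (jt : ℝ) * 2 ^ decay α β ((γ.2.1 : ℝ) - jt) := by
      refine le_trans ?_ (hseq γ.2.1 jt)
      refine le_trans ?_ (le_seqNorm θ _ γ.2.2)
      refine le_trans ?_ (cellSeq_le_ringSeq M f γ.2.1 hs γ.2.2)
      unfold cellSeq
      gcongr
      exact ENNReal.le_tsum (f := fun ε : Dir n => ‖coeff M (f s) ε γ.2.1 γ.2.2‖ₑ) γ.1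
    calc ‖coeff M (f s) γ.1 γ.2.1 γ.2.2‖ₑ = 2 ^ (-((n : ℝ) * γ.2.1 / 2)) *
          (2 ^ ((n : ℝ) * γ.2.1 / 2) * ‖coeff M (f s) γ.1 γ.2.1 γ.2.2‖ₑ) := by
          rw [← mul_assoc, ← two_rpow_add, neg_add_cancel, ENNReal.rpow_zero, one_mul]
      _ ≤ _ := by gcongr
  -- sums of inner products of wavelets at the scale `i` with one function at the scale `j`
  have hin : ∀ (ε : Dir n) (i j : ℤ) (k : Fin n → ℤ),
      ∑' k' : Fin n → ℤ, ‖∫ x, M.wavelet ε i k' x * M.wavelet 0 j k x‖ₑ ≤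
        C₁ * C₂ * 2 ^ ((n : ℝ) * i / 2) * 2 ^ (-((n : ℝ) * j / 2)) := by
    intro ε i j k
    have hm : ∀ k' : Fin n → ℤ, AEMeasurable fun x => ‖M.wavelet ε.1 i k' x * M.wavelet 0 j k x‖ₑ :=
      fun k' => ((M.wavelet ε.1 i k').continuous.mul
        (M.wavelet 0 j k).continuous).enorm.measurable.aemeasurable
    calc ∑' k' : Fin n → ℤ, ‖∫ x, M.wavelet ε i k' x * M.wavelet 0 j k x‖ₑ
        ≤ ∑' k' : Fin n → ℤ, ∫⁻ x, ‖M.wavelet ε.1 i k' x * M.wavelet 0 j k x‖ₑ := by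
          gcongr; exact enorm_integral_le_lintegral_enorm _
      _ = ∫⁻ x, ∑' k' : Fin n → ℤ, ‖M.wavelet ε.1 i k' x * M.wavelet 0 j k x‖ₑ :=
          (lintegral_tsum hm).symm
      _ ≤ ∫⁻ x, (C₁ * 2 ^ ((n : ℝ) * i / 2)) * ‖M.wavelet 0 j k x‖ₑ := by
          refine lintegral_mono fun x => ?_
          simp only [enorm_mul]
          rw [ENNReal.tsum_mul_right]
          gcongr
          exact hC₁ ε.1 i x
      _ = (C₁ * 2 ^ ((n : ℝ) * i / 2)) * ∫⁻ x, ‖M.wavelet 0 j k x‖ₑ :=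
          lintegral_const_mul' _ _ (ENNReal.mul_ne_top ENNReal.coe_ne_top (two_rpow_ne_top _))
      _ ≤ (C₁ * 2 ^ ((n : ℝ) * i / 2)) * (C₂ * 2 ^ (-((n : ℝ) * j / 2))) := by
          gcongr; exact hC₂ 0 j k
      _ = _ := by ring
  -- the wavelets of scales finer than `j` are orthogonal to the low frequency functions
  have hlow : ∀ (j jt : ℤ) (s : ℝ), s ∈ ring jt → ∀ k : Fin n → ℤ, ‖coeff M (f s) 0 j k‖ₑ ≤
      2 ^ (-((n : ℝ) * j / 2)) *
        (D * (C₀ * C₁ * C₂ * C₃) * 2 ^ (jt : ℝ) * 2 ^ (α * min ((j : ℝ) - jt) 0)) := by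
    intro j jt s hs k
    have h1 : coeff M (f s) 0 j k = ∑' γ : Idx n, coeff M (f s) γ.1 γ.2.1 γ.2.2 *
        ∫ x, wav M γ x * M.wavelet 0 j k x := (hexp s (hs0 hs) (M.wavelet 0 j k)).tsum_eq.symm
    rw [h1]
    refine enorm_tsum_le_tsum_enorm.trans ?_
    rw [ENNReal.tsum_prod', tsum_fintype]
    calc ∑ ε : Dir n, ∑' b : ℤ × (Fin n → ℤ), ‖coeff M (f s) ε b.1 b.2 *
          ∫ x, M.wavelet ε b.1 b.2 x * M.wavelet 0 j k x‖ₑ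
        ≤ ∑ _ε : Dir n, ((C₀ : ℝ≥0∞) * C₁ * C₂ * 2 ^ (jt : ℝ) * 2 ^ (-((n : ℝ) * j / 2))) *
          ∑' i : ℤ, (if i ≤ j then (2 : ℝ≥0∞) ^ decay α β ((i : ℝ) - jt) else 0) := by
          refine Finset.sum_le_sum fun ε _ => ?_
          rw [ENNReal.tsum_prod', ← ENNReal.tsum_mul_left]
          refine ENNReal.tsum_le_tsum fun i => ?_
          split_ifs with hij
          · calc _ ≤ ∑' k' : Fin n → ℤ, 2 ^ (-((n : ℝ) * i / 2)) *
                  (C₀ * 2 ^ (jt : ℝ) * 2 ^ decay α β ((i : ℝ) - jt)) *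
                  ‖∫ x, M.wavelet ε i k' x * M.wavelet 0 j k x‖ₑ := by
                  refine ENNReal.tsum_le_tsum fun k' => ?_
                  rw [enorm_mul]
                  gcongr
                  exact hco (ε, i, k') jt s hs
              _ ≤ 2 ^ (-((n : ℝ) * i / 2)) *
                  (C₀ * 2 ^ (jt : ℝ) * 2 ^ decay α β ((i : ℝ) - jt)) *
                  (C₁ * C₂ * 2 ^ ((n : ℝ) * i / 2) * 2 ^ (-((n : ℝ) * j / 2))) := by
                  rw [ENNReal.tsum_mul_left]
                  gcongr
                  exact hin ε i j k
              _ = (2 ^ (-((n : ℝ) * i / 2)) * 2 ^ ((n : ℝ) * i / 2)) *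
                  ((C₀ * C₁ * C₂ * 2 ^ (jt : ℝ) * 2 ^ (-((n : ℝ) * j / 2))) *
                    2 ^ decay α β ((i : ℝ) - jt)) := by ring
              _ = _ := by
                  rw [← two_rpow_add, neg_add_cancel, ENNReal.rpow_zero, one_mul]
          · have : ∀ k' : Fin n → ℤ, ∫ x, M.wavelet ε.1 i k' x * M.wavelet 0 j k x = 0 := fun k' =>
              integral_wavelet_mul_low_eq_zero M (ε, i, k') (not_le.mp hij) k
            simp [this]
      _ ≤ ∑ _ε : Dir n, ((C₀ : ℝ≥0∞) * C₁ * C₂ * 2 ^ (jt : ℝ) * 2 ^ (-((n : ℝ) * j / 2))) *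
          (C₃ * 2 ^ (α * min ((j : ℝ) - jt) 0)) := by
          gcongr; exact hC₃ j jt
      _ = _ := by
          rw [Finset.sum_const, Finset.card_univ, nsmul_eq_mul, hD]
          push_cast
          ring
  refine ⟨D * (C₀ * C₁ * C₂ * C₃) * C₁, fun j jt s hs x => ?_⟩
  calc ∑' k, ‖coeff M (f s) 0 j k * M.wavelet 0 j k x‖ₑ
      ≤ ∑' k, 2 ^ (-((n : ℝ) * j / 2)) *
        (D * (C₀ * C₁ * C₂ * C₃) * 2 ^ (jt : ℝ) * 2 ^ (α * min ((j : ℝ) - jt) 0)) *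
          ‖M.wavelet 0 j k x‖ₑ := by
        refine ENNReal.tsum_le_tsum fun k => ?_
        rw [enorm_mul]
        gcongr
        exact hlow j jt s hs k
    _ ≤ 2 ^ (-((n : ℝ) * j / 2)) *
        (D * (C₀ * C₁ * C₂ * C₃) * 2 ^ (jt : ℝ) * 2 ^ (α * min ((j : ℝ) - jt) 0)) *
          (C₁ * 2 ^ ((n : ℝ) * j / 2)) := by
        rw [ENNReal.tsum_mul_left]
        gcongr
        exact hC₁ 0 j x
    _ = (2 ^ (-((n : ℝ) * j / 2)) * 2 ^ ((n : ℝ) * j / 2)) *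
        (D * (C₀ * C₁ * C₂ * C₃) * C₁ * 2 ^ (jt : ℝ) * 2 ^ (α * min ((j : ℝ) - jt) 0)) := by ring
    _ = _ := by
        rw [← two_rpow_add, neg_add_cancel, ENNReal.rpow_zero, one_mul]
        push_cast
        ring

end Flow

/-! ### The terms of the paraproduct -/

section Para

variable {n : ℕ} (M : MeyerFunction)

/-- The properties of a flow that enter the paraproduct estimate: measurability, the wavelet
expansion, and a bound for the discrete norm of its coefficients, relative to the scale of time. -/
structure FlowBound (θ α β : ℝ) (f : ℝ → 𝓢'(Eucl n, ℂ)) : Prop where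
  measurable : ∀ ψ : 𝓢(Eucl n, ℂ),
    AEStronglyMeasurable (fun t => f t ψ) (volume.restrict (Ioi (0 : ℝ)))
  expansion : ∀ t : ℝ, 0 < t → ∀ ψ : 𝓢(Eucl n, ℂ),
    HasSum (fun γ : Idx n => coeff M (f t) γ.1 γ.2.1 γ.2.2 * ∫ x, wav M γ x * ψ x) (f t ψ)
  bound : ∃ C : ℝ≥0, ∀ j jt : ℤ, seqNorm θ (ringSeq M f j jt) ≤
    C * 2 ^ (jt : ℝ) * 2 ^ decay α β ((j : ℝ) - jt)

variable {M} {θ α β : ℝ} {u v : ℝ → 𝓢'(Eucl n, ℂ)}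

/-- The low frequency factor is bounded uniformly in space, and the high frequency factor is kept as a
sum over the lattice. -/
theorem exists_enorm_paraTerm_le_tsum (hα : 0 < α) (hβ : 0 < β) (hu : FlowBound M θ α β u)
    (v : ℝ → 𝓢'(Eucl n, ℂ)) (ε : Dir n) : ∃ C : ℝ≥0, ∀ (j jt : ℤ) (s : ℝ), s ∈ ring jt →
      ∀ x : Eucl n, (∑' k, ‖coeff M (u s) 0 (j - 2) k * M.wavelet 0 (j - 2) k x‖ₑ) *
        (∑' k, ‖coeff M (v s) ε j k * M.wavelet ε j k x‖ₑ) ≤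
        C * 2 ^ (jt : ℝ) * 2 ^ (α * min ((j : ℝ) - jt) 0) *
          ∑' k, ringSeq M v j jt k * prof ((2 : ℝ) ^ j • x - lat k) := by
  obtain ⟨C₀, hC₀⟩ := hu.bound
  obtain ⟨C₁, hC₁⟩ := exists_tsum_coeff_low_le M hα hβ hu.expansion hC₀
  obtain ⟨C₂, hC₂⟩ := exists_tsum_coeff_wavelet_le M n
  refine ⟨C₁ * C₂, fun j jt s hs x => ?_⟩
  have hmin : (2 : ℝ≥0∞) ^ (α * min (((j - 2 : ℤ) : ℝ) - jt) 0) ≤ 2 ^ (α * min ((j : ℝ) - jt) 0) := by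
    refine ENNReal.rpow_le_rpow_of_exponent_le one_le_two (mul_le_mul_of_nonneg_left ?_ hα.le)
    exact min_le_min_right _ (by push_cast; linarith)
  calc _ ≤ (C₁ * 2 ^ (jt : ℝ) * 2 ^ (α * min (((j - 2 : ℤ) : ℝ) - jt) 0)) *
        (C₂ * ∑' k, ringSeq M v j jt k * prof ((2 : ℝ) ^ j • x - lat k)) :=
        mul_le_mul' (hC₁ (j - 2) jt s hs x) (hC₂ v ε j jt s hs x)
    _ ≤ (C₁ * 2 ^ (jt : ℝ) * 2 ^ (α * min ((j : ℝ) - jt) 0)) *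
        (C₂ * ∑' k, ringSeq M v j jt k * prof ((2 : ℝ) ^ j • x - lat k)) := by gcongr
    _ = _ := by push_cast; ring

theorem exists_tsum_mul_tsum_le (hα : 0 < α) (hβ : 0 < β) (hu : FlowBound M θ α β u)
    (hv : FlowBound M θ α β v) (ε : Dir n) : ∃ C : ℝ≥0, ∀ (j jt : ℤ) (s : ℝ), s ∈ ring jt →
      ∀ x : Eucl n, (∑' k, ‖coeff M (u s) 0 (j - 2) k * M.wavelet 0 (j - 2) k x‖ₑ) *
        (∑' k, ‖coeff M (v s) ε j k * M.wavelet ε j k x‖ₑ) ≤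
        C * 2 ^ (2 * jt : ℝ) * 2 ^ decay (2 * α) β ((j : ℝ) - jt) := by
  obtain ⟨C₁, hC₁⟩ := exists_enorm_paraTerm_le_tsum hα hβ hu v ε
  obtain ⟨C₂, hC₂⟩ := exists_tsum_mul_prof_le n
  obtain ⟨C₃, hC₃⟩ := hv.bound
  refine ⟨C₁ * C₂ * C₃, fun j jt s hs x => (hC₁ j jt s hs x).trans ?_⟩
  calc _ ≤ (C₁ : ℝ≥0∞) * 2 ^ (jt : ℝ) * 2 ^ (α * min ((j : ℝ) - jt) 0) *
        (C₂ * (C₃ * 2 ^ (jt : ℝ) * 2 ^ decay α β ((j : ℝ) - jt))) := by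
        gcongr
        refine (hC₂ θ (ringSeq M v j jt) _).trans ?_
        gcongr
        exact hC₃ j jt
    _ = C₁ * C₂ * C₃ * (2 ^ (jt : ℝ) * 2 ^ (jt : ℝ)) *
        (2 ^ (α * min ((j : ℝ) - jt) 0) * 2 ^ decay α β ((j : ℝ) - jt)) := by ring
    _ = _ := by
        rw [← two_rpow_add, ← two_rpow_add]
        push_cast
        congr 2
        · congr 1; ring
        · unfold decay; ring

theorem enorm_paraTerm_le (ε : Fin n → Fin 2) (f g : 𝓢'(Eucl n, ℂ)) (x : Eucl n) (j : ℤ) :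
    ‖paraTerm M ε f g x j‖ₑ ≤
      (∑' k, ‖coeff M f 0 (j - 2) k * M.wavelet 0 (j - 2) k x‖ₑ) *
        (∑' k, ‖coeff M g ε j k * M.wavelet ε j k x‖ₑ) := by
  unfold paraTerm proj
  rw [enorm_mul]
  exact mul_le_mul' enorm_tsum_le_tsum_enorm enorm_tsum_le_tsum_enorm

theorem exists_enorm_paraTerm_le (hα : 0 < α) (hβ : 0 < β) (hu : FlowBound M θ α β u)
    (hv : FlowBound M θ α β v) (ε : Dir n) : ∃ C : ℝ≥0, ∀ (j jt : ℤ) (s : ℝ), s ∈ ring jt →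
      ∀ x : Eucl n, ‖paraTerm M ε.1 (u s) (v s) x j‖ₑ ≤
        C * 2 ^ (2 * jt : ℝ) * 2 ^ decay (2 * α) β ((j : ℝ) - jt) := by
  obtain ⟨C, hC⟩ := exists_tsum_mul_tsum_le hα hβ hu hv ε
  exact ⟨C, fun j jt s hs x => (enorm_paraTerm_le _ _ _ _ _).trans (hC j jt s hs x)⟩

theorem tsum_decay_lt_top (hα : 0 < α) (hβ : 0 < β) :
    ∑' i : ℤ, (2 : ℝ≥0∞) ^ decay α β (i : ℝ) < ⊤ := by
  refine lt_of_le_of_lt (ENNReal.tsum_le_tsum fun i => ?_)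
    (tsum_two_rpow_neg_abs_lt_top (lt_min hα hβ))
  refine ENNReal.rpow_le_rpow_of_exponent_le one_le_two ?_
  unfold decay
  have h1 : min α β ≤ α := min_le_left _ _
  have h2 : min α β ≤ β := min_le_right _ _
  rcases le_total (i : ℝ) 0 with hi | hi
  · rw [min_eq_left hi, max_eq_right hi, abs_of_nonpos hi]; nlinarith
  · rw [min_eq_right hi, max_eq_left hi, abs_of_nonneg hi]; nlinarith

theorem tsum_decay_sub (jt : ℤ) : ∑' j : ℤ, (2 : ℝ≥0∞) ^ decay α β ((j : ℝ) - jt) =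
    ∑' i : ℤ, (2 : ℝ≥0∞) ^ decay α β (i : ℝ) := by
  rw [← (Equiv.subRight jt).tsum_eq fun i : ℤ => (2 : ℝ≥0∞) ^ decay α β (i : ℝ)]
  simp

/-- The paraproduct is bounded by a multiple of `4^{jt}` at times of order `4^{-jt}`. -/
theorem exists_tsum_enorm_paraTerm_le (hα : 0 < α) (hβ : 0 < β) (hu : FlowBound M θ α β u)
    (hv : FlowBound M θ α β v) (ε : Dir n) : ∃ C : ℝ≥0, ∀ (jt : ℤ) (s : ℝ), s ∈ ring jt →
      ∀ x : Eucl n, ∑' j : ℤ, ‖paraTerm M ε.1 (u s) (v s) x j‖ₑ ≤ C * 2 ^ (2 * jt : ℝ) := by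
  obtain ⟨C, hC⟩ := exists_enorm_paraTerm_le hα hβ hu hv ε
  have hfin := tsum_decay_lt_top (by linarith : 0 < 2 * α) hβ
  refine ⟨C * (∑' i : ℤ, (2 : ℝ≥0∞) ^ decay (2 * α) β (i : ℝ)).toNNReal, fun jt s hs x => ?_⟩
  rw [ENNReal.coe_mul, ENNReal.coe_toNNReal hfin.ne, mul_right_comm, ← tsum_decay_sub jt,
    ← ENNReal.tsum_mul_left]
  exact ENNReal.tsum_le_tsum fun j => hC j jt s hs x

theorem summable_paraTerm (hα : 0 < α) (hβ : 0 < β) (hu : FlowBound M θ α β u)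
    (hv : FlowBound M θ α β v) (ε : Dir n) {s : ℝ} (hs : 0 < s) (x : Eucl n) :
    Summable (paraTerm M ε.1 (u s) (v s) x) := by
  obtain ⟨C, hC⟩ := exists_tsum_enorm_paraTerm_le hα hβ hu hv ε
  obtain ⟨jt, hjt⟩ := exists_mem_ring hs
  exact summable_of_tsum_enorm_ne_top (ne_top_of_le_ne_top
    (ENNReal.mul_ne_top ENNReal.coe_ne_top (two_rpow_ne_top _)) (hC jt s hjt x))

theorem enorm_paraproduct_le (ε : Fin n → Fin 2) (f g : 𝓢'(Eucl n, ℂ)) (x : Eucl n) :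
    ‖paraproduct M ε f g x‖ₑ ≤ ∑' j : ℤ, ‖paraTerm M ε f g x j‖ₑ :=
  enorm_tsum_le_tsum_enorm

/-- The measure on space-time, restricted to positive times. -/
abbrev spaceTime (n : ℕ) : Measure (ℝ × Eucl n) := (volume.restrict (Ioi (0 : ℝ))).prod volume

theorem ae_spaceTime_pos : ∀ᵐ z ∂spaceTime n, 0 < z.1 := by
  have h : ∀ᵐ s ∂(volume.restrict (Ioi (0 : ℝ))), 0 < s := ae_restrict_mem measurableSet_Ioi
  exact Measure.quasiMeasurePreserving_fst.ae h

theorem aestronglyMeasurable_tsum {X ι : Type*} [MeasurableSpace X] {μ : Measure X} [Countable ι]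
    {f : ι → X → ℂ} (hf : ∀ i, AEStronglyMeasurable (f i) μ)
    (hs : ∀ᵐ a ∂μ, Summable fun i => f i a) : AEStronglyMeasurable (fun a => ∑' i, f i a) μ := by
  have h : ∀ᵐ a ∂μ, Filter.Tendsto (fun s : Finset ι => ∑ i ∈ s, f i a) Filter.atTop
      (nhds (∑' i, f i a)) := by
    filter_upwards [hs] with a ha using ha.hasSum
  exact aestronglyMeasurable_of_tendsto_ae Filter.atTop
    (fun s => Finset.aestronglyMeasurable_fun_sum s fun i _ => hf i) h

theorem aestronglyMeasurable_proj {f : ℝ → 𝓢'(Eucl n, ℂ)}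
    (hf : ∀ ψ : 𝓢(Eucl n, ℂ),
      AEStronglyMeasurable (fun t => f t ψ) (volume.restrict (Ioi (0 : ℝ))))
    (ε : Fin n → Fin 2) (j : ℤ) (hs : ∀ s : ℝ, 0 < s → ∀ x : Eucl n,
      ∑' k, ‖coeff M (f s) ε j k * M.wavelet ε j k x‖ₑ ≠ ⊤) :
    AEStronglyMeasurable (fun z : ℝ × Eucl n => proj M (f z.1) ε j z.2) (spaceTime n) := by
  refine aestronglyMeasurable_tsum (fun k => ?_) ?_
  · refine AEStronglyMeasurable.mul (hf (M.wavelet ε j k)).comp_fst ?_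
    exact ((M.wavelet ε j k).continuous.comp continuous_snd).aestronglyMeasurable
  · filter_upwards [ae_spaceTime_pos] with z hz
    exact summable_of_tsum_enorm_ne_top (hs z.1 hz z.2)

theorem tsum_coeff_low_ne_top (hα : 0 < α) (hβ : 0 < β) (hu : FlowBound M θ α β u) (j : ℤ)
    {s : ℝ} (hs : 0 < s) (x : Eucl n) :
    ∑' k, ‖coeff M (u s) 0 j k * M.wavelet 0 j k x‖ₑ ≠ ⊤ := by
  obtain ⟨C₀, hC₀⟩ := hu.bound
  obtain ⟨C₁, hC₁⟩ := exists_tsum_coeff_low_le M hα hβ hu.expansion hC₀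
  obtain ⟨jt, hjt⟩ := exists_mem_ring hs
  exact ne_top_of_le_ne_top (ENNReal.mul_ne_top (ENNReal.mul_ne_top ENNReal.coe_ne_top
    (two_rpow_ne_top _)) (two_rpow_ne_top _)) (hC₁ j jt s hjt x)

theorem tsum_coeff_wavelet_ne_top (hv : FlowBound M θ α β v) (ε : Dir n) (j : ℤ)
    {s : ℝ} (hs : 0 < s) (x : Eucl n) :
    ∑' k, ‖coeff M (v s) ε j k * M.wavelet ε j k x‖ₑ ≠ ⊤ := by
  obtain ⟨C₁, hC₁⟩ := exists_tsum_coeff_wavelet_le M n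
  obtain ⟨C₂, hC₂⟩ := exists_tsum_mul_prof_le n
  obtain ⟨C₃, hC₃⟩ := hv.bound
  obtain ⟨jt, hjt⟩ := exists_mem_ring hs
  have hfin : seqNorm θ (ringSeq M v j jt) ≠ ⊤ :=
    ne_top_of_le_ne_top (ENNReal.mul_ne_top (ENNReal.mul_ne_top ENNReal.coe_ne_top
      (two_rpow_ne_top _)) (two_rpow_ne_top _)) (hC₃ j jt)
  refine ne_top_of_le_ne_top ?_ (hC₁ v ε j jt s hjt x)
  exact ENNReal.mul_ne_top ENNReal.coe_ne_top (ne_top_of_le_ne_top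
    (ENNReal.mul_ne_top ENNReal.coe_ne_top hfin) (hC₂ θ _ _))

theorem aestronglyMeasurable_paraTerm (hα : 0 < α) (hβ : 0 < β) (hu : FlowBound M θ α β u)
    (hv : FlowBound M θ α β v) (ε : Dir n) (j : ℤ) :
    AEStronglyMeasurable (fun z : ℝ × Eucl n => paraTerm M ε.1 (u z.1) (v z.1) z.2 j)
      (spaceTime n) :=
  (aestronglyMeasurable_proj hu.measurable 0 (j - 2) fun _ hs x =>
    tsum_coeff_low_ne_top hα hβ hu (j - 2) hs x).mul
  (aestronglyMeasurable_proj hv.measurable ε.1 j fun _ hs x =>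
    tsum_coeff_wavelet_ne_top hv ε j hs x)

theorem aestronglyMeasurable_paraproduct (hα : 0 < α) (hβ : 0 < β) (hu : FlowBound M θ α β u)
    (hv : FlowBound M θ α β v) (ε : Dir n) :
    AEStronglyMeasurable (fun z : ℝ × Eucl n => paraproduct M ε.1 (u z.1) (v z.1) z.2)
      (spaceTime n) := by
  refine aestronglyMeasurable_tsum (aestronglyMeasurable_paraTerm hα hβ hu hv ε) ?_
  filter_upwards [ae_spaceTime_pos] with z hz using summable_paraTerm hα hβ hu hv ε hz z.2

theorem aestronglyMeasurable_proj_space (f : 𝓢'(Eucl n, ℂ)) (ε : Fin n → Fin 2) (j : ℤ)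
    (hs : ∀ x : Eucl n, ∑' k, ‖coeff M f ε j k * M.wavelet ε j k x‖ₑ ≠ ⊤) :
    AEStronglyMeasurable (fun x : Eucl n => proj M f ε j x) volume :=
  aestronglyMeasurable_tsum
    (fun k => ((M.wavelet ε j k).continuous.const_smul (coeff M f ε j k)).aestronglyMeasurable)
    (Filter.Eventually.of_forall fun x => summable_of_tsum_enorm_ne_top (hs x))

theorem aestronglyMeasurable_paraTerm_space (hα : 0 < α) (hβ : 0 < β) (hu : FlowBound M θ α β u)
    (hv : FlowBound M θ α β v) (ε : Dir n) (j : ℤ) {s : ℝ} (hs : 0 < s) :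
    AEStronglyMeasurable (fun x : Eucl n => paraTerm M ε.1 (u s) (v s) x j) volume :=
  (aestronglyMeasurable_proj_space (u s) 0 (j - 2) fun x =>
    tsum_coeff_low_ne_top hα hβ hu (j - 2) hs x).mul
  (aestronglyMeasurable_proj_space (v s) ε.1 j fun x =>
    tsum_coeff_wavelet_ne_top hv ε j hs x)

theorem aestronglyMeasurable_paraproduct_space (hα : 0 < α) (hβ : 0 < β)
    (hu : FlowBound M θ α β u) (hv : FlowBound M θ α β v) (ε : Dir n) {s : ℝ} (hs : 0 < s) :
    AEStronglyMeasurable (fun x : Eucl n => paraproduct M ε.1 (u s) (v s) x) volume :=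
  aestronglyMeasurable_tsum (fun j => aestronglyMeasurable_paraTerm_space hα hβ hu hv ε j hs)
    (Filter.Eventually.of_forall fun x => summable_paraTerm hα hβ hu hv ε hs x)

/-- Termwise integration of a product of two absolutely convergent series against an integrable
function. -/
theorem integral_tsum_mul_tsum_mul_eq_zero {X ι κ : Type*} [MeasurableSpace X] {μ : Measure X}
    [Countable ι] [Countable κ] {a : ι → X → ℂ} {b : κ → X → ℂ} {T : X → ℂ}
    (ha : ∀ i, Measurable (a i)) (hb : ∀ k, Measurable (b k)) (hT : Measurable T)
    {B : ℝ≥0∞} (hB : B ≠ ⊤) (hab : ∀ x, (∑' i, ‖a i x‖ₑ) * (∑' k, ‖b k x‖ₑ) ≤ B)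
    (ha' : ∀ x, ∑' i, ‖a i x‖ₑ ≠ ⊤) (hb' : ∀ x, ∑' k, ‖b k x‖ₑ ≠ ⊤)
    (hTfin : ∫⁻ x, ‖T x‖ₑ ∂μ ≠ ⊤) (h0 : ∀ i k, ∫ x, a i x * b k x * T x ∂μ = 0) :
    ∫ x, (∑' i, a i x) * (∑' k, b k x) * T x ∂μ = 0 := by
  have hFm : ∀ i : ι × κ, Measurable fun x => a i.1 x * b i.2 x * T x :=
    fun i => ((ha i.1).mul (hb i.2)).mul hT
  have key := hasSum_integral_of_tsum_lintegral (μ := μ)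
    (F := fun (i : ι × κ) x => a i.1 x * b i.2 x * T x)
    (g := fun x => (∑' i, a i x) * (∑' k, b k x) * T x)
    (fun i => (hFm i).aestronglyMeasurable) ?_ ?_
  · rw [← key.2.tsum_eq]
    simp [h0]
  · rw [← lintegral_tsum fun i => (hFm i).enorm.aemeasurable]
    refine ne_top_of_le_ne_top (ENNReal.mul_ne_top hB hTfin) ?_
    rw [← lintegral_const_mul _ hT.enorm]
    refine lintegral_mono fun x => ?_
    simp only [enorm_mul]
    rw [ENNReal.tsum_mul_right, ENNReal.tsum_prod']
    simp only [ENNReal.tsum_mul_left, ENNReal.tsum_mul_right]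
    gcongr
    exact hab x
  · refine Filter.Eventually.of_forall fun x => ?_
    have h1 : Summable fun i => ‖a i x‖ := (summable_of_tsum_enorm_ne_top (ha' x)).norm
    have h2 : Summable fun k => ‖b k x‖ := (summable_of_tsum_enorm_ne_top (hb' x)).norm
    have h3 := tsum_mul_tsum_of_summable_norm h1 h2
    have h4 := (summable_mul_of_summable_norm h1 h2).hasSum
    rw [← h3] at h4
    exact h4.mul_right (T x)

/-- Each term of the paraproduct is only seen by wavelets of neighbouring scales. -/
theorem integral_paraTerm_mul_eq_zero (hα : 0 < α) (hβ : 0 < β) (hu : FlowBound M θ α β u)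
    (hv : FlowBound M θ α β v) (ε : Dir n) {ρ : Eucl n → ℂ} (hρ : IsHomogeneousSymbol ρ)
    {τ : ℝ} (hτ : 0 ≤ τ) {s : ℝ} (hs : 0 < s) (γ : Idx n) {j : ℤ} (hj : 2 < |γ.2.1 - j|) :
    ∫ x, paraTerm M ε.1 (u s) (v s) x j * transposeMultiplier (heatSymbol ρ τ) (wav M γ) x = 0 := by
  obtain ⟨C, hC⟩ := exists_lintegral_transposeMultiplier_wavelet_le M hρ
  obtain ⟨B, hB⟩ := exists_tsum_mul_tsum_le hα hβ hu hv ε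
  obtain ⟨jt, hjt⟩ := exists_mem_ring hs
  have hTm : Measurable (transposeMultiplier (heatSymbol ρ τ) (wav M γ)) :=
    measurable_transposeMultiplier hρ.continuous τ (wav M γ)
  have hTfin : ∫⁻ x, ‖transposeMultiplier (heatSymbol ρ τ) (wav M γ) x‖ₑ ≠ ⊤ :=
    ne_top_of_le_ne_top (ENNReal.mul_ne_top ENNReal.coe_ne_top (two_rpow_ne_top _)) (hC γ τ hτ)
  have h0 := integral_mul_transposeMultiplier_eq_zero M hρ hτ ε γ hj
  generalize transposeMultiplier (heatSymbol ρ τ) (wav M γ) = T at hTm hTfin h0 ⊢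
  unfold paraTerm proj
  refine integral_tsum_mul_tsum_mul_eq_zero (B := B * 2 ^ (2 * jt : ℝ) *
    2 ^ decay (2 * α) β ((j : ℝ) - jt)) (fun k => ?_) (fun k => ?_) hTm ?_ (hB j jt s hjt)
    (tsum_coeff_low_ne_top hα hβ hu (j - 2) hs) (tsum_coeff_wavelet_ne_top hv ε j hs) hTfin ?_
  · exact (continuous_const.mul (M.wavelet 0 (j - 2) k).continuous).measurable
  · exact (continuous_const.mul (M.wavelet ε.1 j k).continuous).measurable
  · exact ENNReal.mul_ne_top (ENNReal.mul_ne_top ENNReal.coe_ne_top (two_rpow_ne_top _))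
      (two_rpow_ne_top _)
  · intro k k'
    have e : ∀ x, coeff M (u s) 0 (j - 2) k * M.wavelet 0 (j - 2) k x *
        (coeff M (v s) ε j k' * M.wavelet ε.1 j k' x) * T x =
        (coeff M (u s) 0 (j - 2) k * coeff M (v s) ε j k') *
          (M.wavelet 0 (j - 2) k x * M.wavelet ε.1 j k' x * T x) := fun x => by ring
    rw [integral_congr_ae (Filter.Eventually.of_forall e), integral_const_mul, h0 k k', mul_zero]

end Para

/-! ### Testing the paraproduct against heat-evolved wavelets -/

section Test

variable {n : ℕ}

/-- The normalized overlap of the cubes with indices `(j, k)` and `(j', k')`: the kernel that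
transfers coefficients from the scale `j'` to the scale `j`. -/
def overlap (j j' : ℤ) (k k' : Fin n → ℤ) : ℝ≥0∞ :=
  2 ^ ((n : ℝ) * j) * ∫⁻ x : Eucl n, prof ((2 : ℝ) ^ j • x - lat k) * prof ((2 : ℝ) ^ j' • x - lat k')

theorem measurable_prof_comp (j : ℤ) (a : Eucl n) :
    Measurable fun x : Eucl n => prof ((2 : ℝ) ^ j • x - a) :=
  measurable_prof.comp ((continuous_const_smul _).sub continuous_const).measurable

theorem measurable_prof_mul_prof (j j' : ℤ) (a a' : Eucl n) : Measurable fun x : Eucl n =>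
    prof ((2 : ℝ) ^ j • x - a) * prof ((2 : ℝ) ^ j' • x - a') :=
  (measurable_prof_comp j a).mul (measurable_prof_comp j' a')

/-- Row and column sums of the overlap kernel, as required by `seqNorm_schur`. -/
theorem exists_tsum_overlap_le (n : ℕ) : ∃ C : ℝ≥0, ∀ j j' : ℤ, j' ∈ Finset.Icc (j - 2) (j + 2) →
    (∀ k : Fin n → ℤ, ∑' k', overlap j j' k k' ≤ C) ∧
      ∀ k' : Fin n → ℤ, ∑' k, overlap j j' k k' ≤ C := by
  obtain ⟨C, hC⟩ := exists_tsum_prof_le n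
  have hI : (∫⁻ x : Eucl n, prof x) ≠ ⊤ := lintegral_prof_lt_top.ne
  have h4 : (1 : ℝ≥0∞) ≤ 2 ^ (2 * (n : ℝ)) := by
    rw [← ENNReal.rpow_zero (x := 2)]
    exact ENNReal.rpow_le_rpow_of_exponent_le one_le_two (by positivity)
  have hfin : (2 : ℝ≥0∞) ^ (2 * (n : ℝ)) * (C * ∫⁻ x : Eucl n, prof x) ≠ ⊤ :=
    ENNReal.mul_ne_top (two_rpow_ne_top _) (ENNReal.mul_ne_top ENNReal.coe_ne_top hI)
  refine ⟨_, fun j j' hj => ⟨fun k => le_of_le_of_eq ?_ (ENNReal.coe_toNNReal hfin).symm,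
    fun k' => le_of_le_of_eq ?_ (ENNReal.coe_toNNReal hfin).symm⟩⟩
  · unfold overlap
    rw [ENNReal.tsum_mul_left, ← lintegral_tsum fun k' =>
      (measurable_prof_mul_prof j j' (lat k) (lat k')).aemeasurable]
    calc _ ≤ 2 ^ ((n : ℝ) * j) * ∫⁻ x : Eucl n, prof ((2 : ℝ) ^ j • x - lat k) * C := by
          gcongr with x
          rw [ENNReal.tsum_mul_left]
          gcongr
          exact hC _
      _ = (2 ^ ((n : ℝ) * j) * 2 ^ (-((n : ℝ) * j))) * (C * ∫⁻ x : Eucl n, prof x) := by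
          rw [lintegral_mul_const' _ _ ENNReal.coe_ne_top, lintegral_comp_smul_sub prof]
          ring
      _ ≤ _ := by
          rw [← two_rpow_add, add_neg_cancel, ENNReal.rpow_zero]
          gcongr
  · unfold overlap
    rw [ENNReal.tsum_mul_left, ← lintegral_tsum fun k =>
      (measurable_prof_mul_prof j j' (lat k) (lat k')).aemeasurable]
    calc _ ≤ 2 ^ ((n : ℝ) * j) * ∫⁻ x : Eucl n, C * prof ((2 : ℝ) ^ j' • x - lat k') := by
          gcongr with x
          rw [ENNReal.tsum_mul_right]
          gcongr
          exact hC _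
      _ = (2 ^ ((n : ℝ) * j) * 2 ^ (-((n : ℝ) * j'))) * (C * ∫⁻ x : Eucl n, prof x) := by
          rw [lintegral_const_mul' _ _ ENNReal.coe_ne_top, lintegral_comp_smul_sub prof]
          ring
      _ ≤ _ := by
          rw [← two_rpow_add]
          gcongr
          · exact one_le_two
          · have : (j : ℝ) - 2 ≤ j' := by exact_mod_cast (Finset.mem_Icc.mp hj).1
            have hn : (0 : ℝ) ≤ n := by positivity
            nlinarith

/-- A shift of at most two scales costs a constant factor. -/
theorem decay_le_add {α β x y : ℝ} (hα : 0 ≤ α) (hβ : 0 ≤ β) (h : |x - y| ≤ 2) :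
    decay α β x ≤ decay α β y + 2 * (α + β) := by
  unfold decay
  obtain ⟨h1, h2⟩ := abs_le.mp h
  have hmin : min x 0 ≤ min y 0 + 2 := by
    rcases le_total y 0 with hy | hy
    · rw [min_eq_left hy]; exact (min_le_left _ _).trans (by linarith)
    · rw [min_eq_right hy]; exact (min_le_right _ _).trans (by linarith)
  have hmax : max y 0 - 2 ≤ max x 0 := by
    rcases le_total y 0 with hy | hy
    · rw [max_eq_right hy]; exact le_trans (by linarith) (le_max_right _ _)
    · rw [max_eq_left hy]; exact le_trans (by linarith) (le_max_left _ _)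
  nlinarith

theorem two_rpow_decay_le {α β : ℝ} (hα : 0 ≤ α) (hβ : 0 ≤ β) {j j' : ℤ}
    (hj : j' ∈ Finset.Icc (j - 2) (j + 2)) (jt : ℤ) :
    (2 : ℝ≥0∞) ^ decay α β ((j' : ℝ) - jt) ≤
      2 ^ (2 * (α + β)) * 2 ^ decay α β ((j : ℝ) - jt) := by
  rw [← two_rpow_add]
  refine ENNReal.rpow_le_rpow_of_exponent_le one_le_two ?_
  rw [add_comm]
  refine decay_le_add hα hβ ?_
  have h1 : (j : ℝ) - 2 ≤ j' := by exact_mod_cast (Finset.mem_Icc.mp hj).1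
  have h2 : (j' : ℝ) ≤ j + 2 := by exact_mod_cast (Finset.mem_Icc.mp hj).2
  rw [abs_le]
  constructor <;> linarith

variable {M : MeyerFunction} {θ α β : ℝ} {u v : ℝ → 𝓢'(Eucl n, ℂ)}

/-- Only the terms of the paraproduct at neighbouring scales contribute. -/
theorem enorm_integral_paraproduct_le (hα : 0 < α) (hβ : 0 < β) (hu : FlowBound M θ α β u)
    (hv : FlowBound M θ α β v) (ε : Dir n) {ρ : Eucl n → ℂ} (hρ : IsHomogeneousSymbol ρ)
    {τ : ℝ} (hτ : 0 ≤ τ) {s : ℝ} (hs : 0 < s) (γ : Idx n) :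
    ‖∫ x, paraproduct M ε.1 (u s) (v s) x *
      transposeMultiplier (heatSymbol ρ τ) (wav M γ) x‖ₑ ≤
      ∑ j ∈ Finset.Icc (γ.2.1 - 2) (γ.2.1 + 2), ∫⁻ x, ‖paraTerm M ε.1 (u s) (v s) x j‖ₑ *
        ‖transposeMultiplier (heatSymbol ρ τ) (wav M γ) x‖ₑ := by
  obtain ⟨C, hC⟩ := exists_lintegral_transposeMultiplier_wavelet_le M hρ
  obtain ⟨B, hB⟩ := exists_tsum_enorm_paraTerm_le hα hβ hu hv ε
  obtain ⟨jt, hjt⟩ := exists_mem_ring hs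
  have hTm : Measurable (transposeMultiplier (heatSymbol ρ τ) (wav M γ)) :=
    measurable_transposeMultiplier hρ.continuous τ (wav M γ)
  have hTfin : ∫⁻ x, ‖transposeMultiplier (heatSymbol ρ τ) (wav M γ) x‖ₑ ≠ ⊤ :=
    ne_top_of_le_ne_top (ENNReal.mul_ne_top ENNReal.coe_ne_top (two_rpow_ne_top _)) (hC γ τ hτ)
  have h0 := fun j => integral_paraTerm_mul_eq_zero hα hβ hu hv ε hρ hτ hs γ (j := j)
  generalize transposeMultiplier (heatSymbol ρ τ) (wav M γ) = T at hTm hTfin h0 ⊢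
  have hFm : ∀ j : ℤ, AEStronglyMeasurable (fun x => paraTerm M ε.1 (u s) (v s) x j * T x) volume :=
    fun j => (aestronglyMeasurable_paraTerm_space hα hβ hu hv ε j hs).mul hTm.aestronglyMeasurable
  have key := hasSum_integral_of_tsum_lintegral
    (F := fun (j : ℤ) x => paraTerm M ε.1 (u s) (v s) x j * T x)
    (g := fun x => paraproduct M ε.1 (u s) (v s) x * T x) hFm ?_ ?_
  · rw [← key.2.tsum_eq]
    refine enorm_tsum_le_tsum_enorm.trans ?_
    rw [tsum_eq_sum (s := Finset.Icc (γ.2.1 - 2) (γ.2.1 + 2))]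
    · refine Finset.sum_le_sum fun j _ => (enorm_integral_le_lintegral_enorm _).trans_eq ?_
      simp only [enorm_mul]
    · intro j hj
      rw [Finset.mem_Icc, not_and_or, not_le, not_le] at hj
      rw [h0 j (by rw [lt_abs]; omega), enorm_zero]
  · rw [← lintegral_tsum fun j => (hFm j).enorm]
    refine ne_top_of_le_ne_top (ENNReal.mul_ne_top (ENNReal.mul_ne_top (ENNReal.coe_ne_top (r := B))
      (two_rpow_ne_top (2 * jt : ℝ))) hTfin) ?_
    rw [← lintegral_const_mul _ hTm.enorm]
    refine lintegral_mono fun x => ?_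
    simp only [enorm_mul]
    rw [ENNReal.tsum_mul_right]
    gcongr
    exact hB jt s hjt x
  · exact Filter.Eventually.of_forall fun x => (summable_paraTerm hα hβ hu hv ε hs x).hasSum.mul_right _

/-- The size of the paraproduct tested against one heat-evolved wavelet. -/
theorem exists_enorm_integral_paraproduct_le (hα : 0 < α) (hβ : 0 < β) (hu : FlowBound M θ α β u)
    (hv : FlowBound M θ α β v) (ε : Dir n) {ρ : Eucl n → ℂ} (hρ : IsHomogeneousSymbol ρ) :
    ∃ C : ℝ≥0, ∀ (γ : Idx n) (τ : ℝ), 0 ≤ τ → ∀ (jt : ℤ) (s : ℝ), s ∈ ring jt →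
      ‖∫ x, paraproduct M ε.1 (u s) (v s) x *
        transposeMultiplier (heatSymbol ρ τ) (wav M γ) x‖ₑ ≤
        C * 2 ^ ((1 - (n : ℝ) / 2) * γ.2.1) *
          (2 ^ (2 * jt : ℝ) * 2 ^ decay (2 * α) β ((γ.2.1 : ℝ) - jt)) := by
  obtain ⟨C, hC⟩ := exists_lintegral_transposeMultiplier_wavelet_le M hρ
  obtain ⟨B, hB⟩ := exists_enorm_paraTerm_le hα hβ hu hv ε
  set L : ℝ≥0 := ((2 : ℝ≥0∞) ^ (2 * (2 * α + β))).toNNReal with hL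
  have hLc : (L : ℝ≥0∞) = 2 ^ (2 * (2 * α + β)) := ENNReal.coe_toNNReal (two_rpow_ne_top _)
  refine ⟨5 * (B * L * C), fun γ τ hτ jt s hs => ?_⟩
  have hs0 : 0 < s := lt_of_lt_of_le (by positivity) hs.1
  refine (enorm_integral_paraproduct_le hα hβ hu hv ε hρ hτ hs0 γ).trans ?_
  have hTm : Measurable (transposeMultiplier (heatSymbol ρ τ) (wav M γ)) :=
    measurable_transposeMultiplier hρ.continuous τ (wav M γ)
  have hT := hC γ τ hτ
  generalize transposeMultiplier (heatSymbol ρ τ) (wav M γ) = T at hTm hT ⊢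
  calc _ ≤ ∑ _j ∈ Finset.Icc (γ.2.1 - 2) (γ.2.1 + 2),
        ((B : ℝ≥0∞) * 2 ^ (2 * jt : ℝ) * (L * 2 ^ decay (2 * α) β ((γ.2.1 : ℝ) - jt))) *
          (C * 2 ^ ((1 - (n : ℝ) / 2) * γ.2.1)) := by
        refine Finset.sum_le_sum fun j hj => ?_
        refine le_trans ?_ (mul_le_mul' le_rfl hT)
        rw [← lintegral_const_mul _ hTm.enorm]
        gcongr with x
        refine (hB j jt s hs x).trans ?_
        gcongr
        rw [hLc]
        exact two_rpow_decay_le (by positivity) hβ.le hj jt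
    _ = _ := by
        rw [Finset.sum_const, Int.card_Icc, show (γ.2.1 + 2 + 1 - (γ.2.1 - 2)).toNat = 5 by omega,
          nsmul_eq_mul]
        push_cast
        ring

/-- The refined estimate, which keeps track of the position of the coefficients and of the decay of
the heat kernel. -/
theorem exists_enorm_integral_paraproduct_le_tsum (hα : 0 < α) (hβ : 0 < β)
    (hu : FlowBound M θ α β u) (hv : FlowBound M θ α β v) (ε : Dir n) {ρ : Eucl n → ℂ}
    (hρ : IsHomogeneousSymbol ρ) (K : ℕ) :
    ∃ C : ℝ≥0, ∀ (ε' : Dir n) (j : ℤ) (k : Fin n → ℤ) (τ : ℝ), 0 ≤ τ → ∀ (jt : ℤ) (s : ℝ),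
      s ∈ ring jt →
      2 ^ ((n : ℝ) * j / 2) * ‖∫ x, paraproduct M ε.1 (u s) (v s) x *
        transposeMultiplier (heatSymbol ρ τ) (M.wavelet ε'.1 j k) x‖ₑ ≤
        C * (2 ^ (jt : ℝ) * 2 ^ (α * min ((j : ℝ) - jt) 0) * 2 ^ (j : ℝ)) *
          (∑ j' ∈ Finset.Icc (j - 2) (j + 2), ∑' k', overlap j j' k k' * ringSeq M v j' jt k') *
          ENNReal.ofReal ((1 + 4 ^ j * τ) ^ K)⁻¹ := by
  obtain ⟨C, hC⟩ := exists_transposeMultiplier_wavelet_le M hρ K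
  obtain ⟨B, hB⟩ := exists_enorm_paraTerm_le_tsum hα hβ hu v ε
  set L : ℝ≥0 := ((2 : ℝ≥0∞) ^ (2 * α)).toNNReal with hL
  have hLc : (L : ℝ≥0∞) = 2 ^ (2 * α) := ENNReal.coe_toNNReal (two_rpow_ne_top _)
  refine ⟨B * L * C, fun ε' j k τ hτ jt s hs => ?_⟩
  have hs0 : 0 < s := lt_of_lt_of_le (by positivity) hs.1
  have h1 := enorm_integral_paraproduct_le hα hβ hu hv ε hρ hτ hs0 (ε', j, k)
  have hT := hC ε' τ hτ j k
  refine (mul_le_mul' le_rfl h1).trans ?_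
  dsimp only [wav]
  generalize transposeMultiplier (heatSymbol ρ τ) (M.wavelet ε'.1 j k) = T at hT ⊢
  rw [Finset.mul_sum, Finset.mul_sum, Finset.sum_mul]
  refine Finset.sum_le_sum fun j' hj' => ?_
  have hshift : (2 : ℝ≥0∞) ^ (α * min ((j' : ℝ) - jt) 0) ≤
      L * 2 ^ (α * min ((j : ℝ) - jt) 0) := by
    have := two_rpow_decay_le hα.le le_rfl hj' jt (β := 0)
    simpa [decay, hLc] using this
  set E := ENNReal.ofReal ((1 + 4 ^ j * τ) ^ K)⁻¹ with hE
  set A : ℝ≥0∞ := (B * 2 ^ (jt : ℝ) * (L * 2 ^ (α * min ((j : ℝ) - jt) 0))) *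
    (C * 2 ^ (j : ℝ) * E * 2 ^ ((n : ℝ) * j / 2)) with hA
  have hAtop : A ≠ ⊤ := by
    rw [hA]
    have := two_rpow_ne_top
    refine ENNReal.mul_ne_top (ENNReal.mul_ne_top (ENNReal.mul_ne_top ENNReal.coe_ne_top (this _))
      (ENNReal.mul_ne_top ENNReal.coe_ne_top (this _))) (ENNReal.mul_ne_top (ENNReal.mul_ne_top
        (ENNReal.mul_ne_top ENNReal.coe_ne_top (this _)) ENNReal.ofReal_ne_top) (this _))
  have hm : ∀ k', Measurable fun x : Eucl n => ringSeq M v j' jt k' *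
      (prof ((2 : ℝ) ^ j • x - lat k) * prof ((2 : ℝ) ^ j' • x - lat k')) := fun k' =>
    (measurable_prof_mul_prof j j' (lat k) (lat k')).const_mul _
  calc 2 ^ ((n : ℝ) * j / 2) * ∫⁻ x, ‖paraTerm M ε.1 (u s) (v s) x j'‖ₑ * ‖T x‖ₑ
      ≤ 2 ^ ((n : ℝ) * j / 2) * ∫⁻ x : Eucl n, A * ∑' k', ringSeq M v j' jt k' *
          (prof ((2 : ℝ) ^ j • x - lat k) * prof ((2 : ℝ) ^ j' • x - lat k')) := by
        refine mul_le_mul' le_rfl (lintegral_mono fun x => ?_)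
        calc ‖paraTerm M ε.1 (u s) (v s) x j'‖ₑ * ‖T x‖ₑ
            ≤ (B * 2 ^ (jt : ℝ) * (L * 2 ^ (α * min ((j : ℝ) - jt) 0)) *
              ∑' k', ringSeq M v j' jt k' * prof ((2 : ℝ) ^ j' • x - lat k')) *
              (C * 2 ^ (j : ℝ) * E * (2 ^ ((n : ℝ) * j / 2) * prof ((2 : ℝ) ^ j • x - lat k))) := by
              refine mul_le_mul' ?_ (hT x)
              refine (enorm_paraTerm_le _ _ _ _ _).trans ((hB j' jt s hs x).trans ?_)
              gcongr
          _ = A * (prof ((2 : ℝ) ^ j • x - lat k) *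
              ∑' k', ringSeq M v j' jt k' * prof ((2 : ℝ) ^ j' • x - lat k')) := by
              rw [hA]; ring
          _ = _ := by
              rw [← ENNReal.tsum_mul_left]
              congr 1
              exact tsum_congr fun k' => by ring
    _ = 2 ^ ((n : ℝ) * j / 2) * (A * ∑' k', ringSeq M v j' jt k' *
          ∫⁻ x : Eucl n, prof ((2 : ℝ) ^ j • x - lat k) * prof ((2 : ℝ) ^ j' • x - lat k')) := by
        rw [lintegral_const_mul' _ _ hAtop, lintegral_tsum fun k' => (hm k').aemeasurable]
        congr 3 with k'
        exact lintegral_const_mul _ (measurable_prof_mul_prof j j' (lat k) (lat k'))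
    _ = _ := by
        have e : (2 : ℝ≥0∞) ^ ((n : ℝ) * j) = 2 ^ ((n : ℝ) * j / 2) * 2 ^ ((n : ℝ) * j / 2) := by
          rw [← two_rpow_add]; congr 1; ring
        have h2 : ∑' k', overlap j j' k k' * ringSeq M v j' jt k' = 2 ^ ((n : ℝ) * j) *
            ∑' k', ringSeq M v j' jt k' *
              ∫⁻ x : Eucl n, prof ((2 : ℝ) ^ j • x - lat k) * prof ((2 : ℝ) ^ j' • x - lat k') := by
          rw [← ENNReal.tsum_mul_left]
          exact tsum_congr fun k' => by unfold overlap; ring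
        rw [h2, e, hA]
        push_cast
        ring

end Test

/-! ### Integration over dyadic rings of times -/

section Time

theorem volume_ring_le (jt : ℤ) : volume (ring jt) ≤ 4 * 2 ^ (-(2 * jt : ℝ)) := by
  unfold ring
  rw [Real.volume_Ico]
  have e : (2 : ℝ) ^ (2 - 2 * jt) = 4 * 2 ^ (-(2 * jt : ℝ)) := by
    rw [← Real.rpow_intCast, sub_eq_add_neg]
    push_cast
    rw [Real.rpow_add two_pos]
    norm_num
  calc ENNReal.ofReal ((2 : ℝ) ^ (2 - 2 * jt) - 2 ^ (-2 * jt))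
      ≤ ENNReal.ofReal (4 * 2 ^ (-(2 * jt : ℝ))) := by
        refine ENNReal.ofReal_le_ofReal ?_
        rw [e]
        have : (0 : ℝ) < 2 ^ (-2 * jt) := by positivity
        linarith
    _ = _ := by
        rw [ENNReal.ofReal_mul (by norm_num), ofReal_two_rpow]
        norm_num

/-- The times before `t` are covered by the rings of index at least that of `t`. -/
theorem lintegral_Ioo_le_tsum_ring {t : ℝ} {Jt : ℤ} (ht : t ∈ ring Jt) (g : ℝ → ℝ≥0∞) :
    ∫⁻ s in Ioo 0 t, g s ≤ ∑' i : ℕ, ∫⁻ s in ring (Jt + i) ∩ Iio t, g s := by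
  refine le_trans (lintegral_mono_set (t := ⋃ i : ℕ, ring (Jt + i) ∩ Iio t) fun s hs => ?_)
    (lintegral_iUnion_le _ _)
  obtain ⟨jt, hjt⟩ := exists_mem_ring hs.1
  have hle : Jt ≤ jt := by
    by_contra hlt
    have h1 : (2 : ℝ) ^ (2 - 2 * Jt) ≤ 2 ^ (-2 * jt) := zpow_le_zpow_right₀ one_le_two (by omega)
    have h2 := ht.2
    have h3 := hjt.1
    linarith [hs.2]
  obtain ⟨i, hi⟩ := Int.eq_ofNat_of_zero_le (sub_nonneg.mpr hle)
  refine mem_iUnion.mpr ⟨i, ?_, hs.2⟩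
  have : Jt + (i : ℤ) = jt := by omega
  rwa [this]

theorem lintegral_Ioi_inv_sq_le {c : ℝ} (hc : 0 < c) :
    ∫⁻ r in Ioi (0 : ℝ), ENNReal.ofReal ((1 + c * r) ^ 2)⁻¹ ≤ ENNReal.ofReal c⁻¹ := by
  have hpos : ∀ r ∈ Ici (0 : ℝ), 0 < 1 + c * r := fun r hr => by
    have := mul_nonneg hc.le (mem_Ici.mp hr); linarith
  have hd : ∀ r ∈ Ici (0 : ℝ), HasDerivAt (fun r => -(c⁻¹ * (1 + c * r)⁻¹))
      (((1 + c * r) ^ 2)⁻¹) r := by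
    intro r hr
    have h1 : HasDerivAt (fun r => 1 + c * r) c r := by
      simpa using ((hasDerivAt_id r).const_mul c).const_add 1
    have h2 := ((h1.inv (hpos r hr).ne').const_mul c⁻¹).neg
    convert! h2 using 1
    have := (hpos r hr).ne'
    field_simp
  have hlim : Filter.Tendsto (fun r => -(c⁻¹ * (1 + c * r)⁻¹)) Filter.atTop (nhds 0) := by
    have h1 : Filter.Tendsto (fun r : ℝ => 1 + c * r) Filter.atTop Filter.atTop :=
      Filter.tendsto_atTop_add_const_left _ _ (Filter.tendsto_id.const_mul_atTop hc)
    simpa using (h1.inv_tendsto_atTop.const_mul c⁻¹).neg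
  have hnn : ∀ r ∈ Ioi (0 : ℝ), 0 ≤ ((1 + c * r) ^ 2)⁻¹ := fun r _ => by positivity
  have hint := integrableOn_Ioi_deriv_of_nonneg' hd hnn hlim
  have hval := integral_Ioi_of_hasDerivAt_of_nonneg' hd hnn hlim
  rw [← ofReal_integral_eq_lintegral_ofReal hint
    (Filter.Eventually.of_forall fun r => by positivity), hval]
  simp

/-- The heat integral over all earlier times gains `c⁻¹`, with `c = 4^j` in the application. -/
theorem lintegral_Iio_heat_le {c : ℝ} (hc : 0 < c) {K : ℕ} (hK : 2 ≤ K) (t : ℝ) :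
    ∫⁻ s in Iio t, ENNReal.ofReal ((1 + c * (t - s)) ^ K)⁻¹ ≤ ENNReal.ofReal c⁻¹ := by
  calc ∫⁻ s in Iio t, ENNReal.ofReal ((1 + c * (t - s)) ^ K)⁻¹
      ≤ ∫⁻ s in Iio t, ENNReal.ofReal ((1 + c * (t - s)) ^ 2)⁻¹ := by
        refine setLIntegral_mono' measurableSet_Iio fun s hs => ENNReal.ofReal_le_ofReal ?_
        have h1 : 1 ≤ 1 + c * (t - s) := by
          have := mul_pos hc (sub_pos.mpr (mem_Iio.mp hs)); linarith
        have h0 : 0 < 1 + c * (t - s) := by linarith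
        exact inv_anti₀ (by positivity) (pow_le_pow_right₀ h1 hK)
    _ = ∫⁻ s, (Ioi (0 : ℝ)).indicator (fun r => ENNReal.ofReal ((1 + c * r) ^ 2)⁻¹) (t - s) := by
        rw [← lintegral_indicator measurableSet_Iio]
        refine lintegral_congr fun s => ?_
        by_cases h : s < t
        · rw [indicator_of_mem (mem_Iio.mpr h), indicator_of_mem (mem_Ioi.mpr (sub_pos.mpr h))]
        · rw [indicator_of_notMem (by simpa using h), indicator_of_notMem (by simpa using h)]
    _ = ∫⁻ r in Ioi (0 : ℝ), ENNReal.ofReal ((1 + c * r) ^ 2)⁻¹ := by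
        rw [lintegral_sub_left_eq_self (fun r => (Ioi (0 : ℝ)).indicator
          (fun r => ENNReal.ofReal ((1 + c * r) ^ 2)⁻¹) r) t, lintegral_indicator measurableSet_Ioi]
    _ ≤ _ := lintegral_Ioi_inv_sq_le hc

theorem four_zpow_eq (j : ℤ) : (4 : ℝ) ^ j = 2 ^ (2 * j : ℝ) := by
  rw [Real.rpow_mul two_pos.le, Real.rpow_intCast]
  norm_num

/-- The length of a ring of times is at most `4 · 4^{-jt}`. -/
theorem lintegral_ring_le (jt : ℤ) (t : ℝ) {g : ℝ → ℝ≥0∞} {B : ℝ≥0∞}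
    (hg : ∀ s ∈ ring jt ∩ Iio t, g s ≤ B) :
    2 ^ (2 * jt : ℝ) * ∫⁻ s in ring jt ∩ Iio t, g s ≤ 4 * B := by
  calc 2 ^ (2 * jt : ℝ) * ∫⁻ s in ring jt ∩ Iio t, g s
      ≤ 2 ^ (2 * jt : ℝ) * (B * (4 * 2 ^ (-(2 * jt : ℝ)))) := by
        gcongr
        calc ∫⁻ s in ring jt ∩ Iio t, g s ≤ ∫⁻ _s in ring jt ∩ Iio t, B :=
              setLIntegral_mono' (measurableSet_Ico.inter measurableSet_Iio) hg
          _ = B * volume (ring jt ∩ Iio t) := setLIntegral_const _ _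
          _ ≤ _ := by
              gcongr
              exact (measure_mono inter_subset_left).trans (volume_ring_le jt)
    _ = (2 ^ (2 * jt : ℝ) * 2 ^ (-(2 * jt : ℝ))) * (4 * B) := by ring
    _ = _ := by rw [← two_rpow_add, add_neg_cancel, ENNReal.rpow_zero, one_mul]

/-- The contribution of a ring of times to the heat integral, for times close to `t`: the decay of
the kernel makes up for the size of the ring when `j` is large. -/
theorem lintegral_near_ring_le {K : ℕ} (hK : 2 ≤ K) (j Jt : ℤ) {i : ℕ} (hi : i ≤ 1) (t : ℝ) :
    2 ^ (2 * ((Jt + i : ℤ) : ℝ)) *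
      ∫⁻ s in ring (Jt + i) ∩ Iio t, ENNReal.ofReal ((1 + 4 ^ j * (t - s)) ^ K)⁻¹ ≤
      4 * 2 ^ (-(2 * max ((j : ℝ) - Jt) 0)) := by
  have hi' : (i : ℝ) ≤ 1 := by exact_mod_cast hi
  rcases le_total ((j : ℝ) - Jt) 0 with h | h
  · rw [max_eq_right h, mul_zero, neg_zero, ENNReal.rpow_zero]
    refine lintegral_ring_le (Jt + i) t fun s hs => ?_
    rw [← ENNReal.ofReal_one]
    refine ENNReal.ofReal_le_ofReal (inv_le_one_of_one_le₀ (one_le_pow₀ ?_))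
    have : 0 ≤ (4 : ℝ) ^ j * (t - s) := mul_nonneg (by positivity) (sub_nonneg.mpr hs.2.le)
    linarith
  · rw [max_eq_left h]
    calc _ ≤ 2 ^ (2 * ((Jt + i : ℤ) : ℝ)) * ENNReal.ofReal ((4 : ℝ) ^ j)⁻¹ := by
          gcongr
          exact (lintegral_mono_set inter_subset_right).trans
            (lintegral_Iio_heat_le (by positivity) hK t)
      _ = 2 ^ (2 * ((Jt + i : ℤ) : ℝ) - 2 * j) := by
          rw [four_zpow_eq, ← Real.rpow_neg two_pos.le, ofReal_two_rpow, ← two_rpow_add,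
            sub_eq_add_neg]
      _ ≤ 2 ^ ((2 : ℝ) + -(2 * ((j : ℝ) - Jt))) := by
          refine ENNReal.rpow_le_rpow_of_exponent_le one_le_two ?_
          push_cast
          linarith
      _ = _ := by
          rw [two_rpow_add]
          norm_num

/-- The contribution of a ring of times far from `t`, where the heat kernel has decayed. -/
theorem lintegral_far_ring_le (K : ℕ) (j Jt : ℤ) {i : ℕ} (hi : 2 ≤ i) {t : ℝ} (ht : t ∈ ring Jt) :
    2 ^ (2 * ((Jt + i : ℤ) : ℝ)) *
      ∫⁻ s in ring (Jt + i) ∩ Iio t, ENNReal.ofReal ((1 + 4 ^ j * (t - s)) ^ K)⁻¹ ≤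
      4 * 2 ^ (K : ℝ) * 2 ^ (-(2 * K * max ((j : ℝ) - Jt) 0)) := by
  rw [mul_assoc]
  refine lintegral_ring_le (Jt + i) t fun s hs => ?_
  -- two rings apart, `s ≤ t / 2`
  have hts : 2⁻¹ * (2 : ℝ) ^ (-(2 * Jt : ℝ)) ≤ t - s := by
    have h1 : (2 : ℝ) ^ (-(2 * Jt : ℝ)) ≤ t := by
      have := ht.1
      rwa [← Real.rpow_intCast, show (((-2 * Jt : ℤ)) : ℝ) = -(2 * Jt : ℝ) by push_cast; ring] at this
    have h2 : s ≤ 2⁻¹ * (2 : ℝ) ^ (-(2 * Jt : ℝ)) := by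
      refine hs.1.2.le.trans ?_
      rw [← Real.rpow_intCast, ← Real.rpow_neg_one, ← Real.rpow_add two_pos]
      refine Real.rpow_le_rpow_of_exponent_le one_le_two ?_
      have : (2 : ℝ) ≤ i := by exact_mod_cast hi
      push_cast
      linarith
    linarith
  have hbase : 2⁻¹ * (2 : ℝ) ^ (2 * max ((j : ℝ) - Jt) 0) ≤ 1 + 4 ^ j * (t - s) := by
    have h0 : 0 ≤ (4 : ℝ) ^ j * (t - s) := mul_nonneg (by positivity) (sub_nonneg.mpr hs.2.le)
    rcases le_total ((j : ℝ) - Jt) 0 with h | h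
    · rw [max_eq_right h, mul_zero, Real.rpow_zero]; linarith
    · rw [max_eq_left h]
      calc 2⁻¹ * (2 : ℝ) ^ (2 * ((j : ℝ) - Jt))
          = 4 ^ j * (2⁻¹ * (2 : ℝ) ^ (-(2 * Jt : ℝ))) := by
            rw [four_zpow_eq, mul_left_comm, ← Real.rpow_add two_pos]
            congr 2; ring
        _ ≤ 4 ^ j * (t - s) := by gcongr
        _ ≤ _ := by linarith
  calc ENNReal.ofReal ((1 + 4 ^ j * (t - s)) ^ K)⁻¹
      ≤ ENNReal.ofReal ((2⁻¹ * (2 : ℝ) ^ (2 * max ((j : ℝ) - Jt) 0)) ^ K)⁻¹ := by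
        refine ENNReal.ofReal_le_ofReal (inv_anti₀ (by positivity) ?_)
        exact pow_le_pow_left₀ (by positivity) hbase K
    _ = ENNReal.ofReal (2 ^ ((K : ℝ) + -(2 * K * max ((j : ℝ) - Jt) 0))) := by
        congr 1
        rw [← Real.rpow_neg_one, ← Real.rpow_neg_one, ← Real.rpow_add two_pos, ← Real.rpow_natCast,
          ← Real.rpow_mul two_pos.le, ← Real.rpow_mul two_pos.le]
        congr 1; ring
    _ = _ := by rw [ofReal_two_rpow, two_rpow_add]

theorem two_rpow_tsum_nat_decay_le {α β : ℝ} (hα : 0 < α) (hβ : 0 < β) : ∃ C : ℝ≥0, ∀ j Jt : ℤ,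
    ∑' i : ℕ, (2 : ℝ≥0∞) ^ decay α β ((j : ℝ) - (Jt + i : ℤ)) ≤
      C * 2 ^ (α * min ((j : ℝ) - Jt) 0) := by
  obtain ⟨C, hC⟩ := exists_tsum_decay_le hα hβ
  refine ⟨C, fun j Jt => le_trans ?_ (hC j Jt)⟩
  have hinj : Function.Injective fun i : ℕ => j - (i : ℤ) := fun a b h => by
    simp only at h; omega
  refine le_trans (le_of_eq ?_) (ENNReal.tsum_comp_le_tsum_of_injective hinj _)
  refine tsum_congr fun i => ?_
  rw [if_pos (by omega)]
  congr 2
  push_cast; ring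

/-- Bounds `W i` for the heat integrals over the rings of times before a ring, and their sum weighted
by the size of the nonlinearity. -/
theorem exists_ring_weights {α β : ℝ} (hα : 0 < α) (hβ : 0 < β) {K : ℕ} (hK : 2 ≤ K)
    (hKβ : β + 2 ≤ 2 * K) : ∃ C : ℝ≥0, ∀ j Jt : ℤ, ∃ W : ℕ → ℝ≥0∞,
      (∀ (i : ℕ) (t : ℝ), t ∈ ring Jt → 2 ^ (2 * ((Jt + i : ℤ) : ℝ)) *
        ∫⁻ s in ring (Jt + i) ∩ Iio t, ENNReal.ofReal ((1 + 4 ^ j * (t - s)) ^ K)⁻¹ ≤ W i) ∧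
      ∑' i : ℕ, 2 ^ decay α β ((j : ℝ) - (Jt + i : ℤ)) * W i ≤
        C * 2 ^ decay α (β + 2) ((j : ℝ) - Jt) := by
  obtain ⟨C, hC⟩ := two_rpow_tsum_nat_decay_le hα hβ
  set L : ℝ≥0 := ((2 : ℝ≥0∞) ^ (2 * (α + β))).toNNReal with hL
  have hLc : (L : ℝ≥0∞) = 2 ^ (2 * (α + β)) := ENNReal.coe_toNNReal (two_rpow_ne_top _)
  set R : ℝ≥0 := ((2 : ℝ≥0∞) ^ (K : ℝ)).toNNReal with hR
  have hRc : (R : ℝ≥0∞) = 2 ^ (K : ℝ) := ENNReal.coe_toNNReal (two_rpow_ne_top _)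
  refine ⟨2 * (4 * L) + 4 * R * C, fun j Jt => ?_⟩
  set X : ℝ := (j : ℝ) - Jt with hX
  set W : ℕ → ℝ≥0∞ := fun i =>
    if i < 2 then 4 * 2 ^ (-(2 * max X 0)) else 4 * R * 2 ^ (-(2 * K * max X 0)) with hW
  -- the near rings gain the full two powers, the far rings as much as needed by the choice of `K`
  have hnear : decay α (β + 2) X = decay α β X + -(2 * max X 0) := by unfold decay; ring
  have hfar : α * min X 0 + -(2 * K * max X 0) ≤ decay α (β + 2) X := by
    unfold decay
    nlinarith [le_max_right X 0]
  refine ⟨W, fun i t ht => ?_, ?_⟩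
  · rcases lt_or_ge i 2 with hi | hi
    · simp only [hW, if_pos hi]
      exact lintegral_near_ring_le hK j Jt (Nat.lt_succ_iff.mp hi) t
    · simp only [hW, if_neg hi.not_gt, hRc]
      exact lintegral_far_ring_le K j Jt hi ht
  have hterm : ∀ i : ℕ, 2 ^ decay α β ((j : ℝ) - (Jt + i : ℤ)) * W i ≤
      (if i < 2 then 4 * (L : ℝ≥0∞) * 2 ^ decay α (β + 2) X else 0) +
        2 ^ decay α β ((j : ℝ) - (Jt + i : ℤ)) * (4 * R * 2 ^ (-(2 * K * max X 0))) := by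
    intro i
    rcases lt_or_ge i 2 with hi | hi
    · simp only [hW, if_pos hi]
      refine le_trans ?_ le_self_add
      have hsh : (2 : ℝ≥0∞) ^ decay α β ((j : ℝ) - (Jt + i : ℤ)) ≤ L * 2 ^ decay α β X := by
        rw [hLc, ← two_rpow_add]
        refine ENNReal.rpow_le_rpow_of_exponent_le one_le_two ?_
        refine (decay_le_add hα.le hβ.le ?_).trans_eq (add_comm _ _)
        have : (i : ℝ) ≤ 2 := by exact_mod_cast hi.le
        rw [hX, abs_le]
        push_cast
        constructor <;> linarith [(Nat.cast_nonneg i : (0 : ℝ) ≤ i)]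
      calc _ ≤ ((L : ℝ≥0∞) * 2 ^ decay α β X) * (4 * 2 ^ (-(2 * max X 0))) :=
            mul_le_mul' hsh le_rfl
        _ = _ := by rw [hnear, two_rpow_add]; ring
    · simp only [hW, if_neg hi.not_gt]
      exact le_add_self
  refine (ENNReal.tsum_le_tsum hterm).trans ?_
  rw [ENNReal.tsum_add, ENNReal.tsum_mul_right, tsum_eq_sum (s := Finset.range 2)
    (fun i hi => if_neg (by simpa using hi)), ENNReal.coe_add, add_mul]
  refine add_le_add (le_of_eq ?_) ?_
  · rw [Finset.sum_range_succ, Finset.sum_range_one, if_pos (by norm_num), if_pos (by norm_num)]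
    push_cast
    ring
  · calc _ ≤ ((C : ℝ≥0∞) * 2 ^ (α * min X 0)) * (4 * R * 2 ^ (-(2 * K * max X 0))) := by
          gcongr; exact hC j Jt
      _ = 4 * R * C * 2 ^ (α * min X 0 + -(2 * K * max X 0)) := by rw [two_rpow_add]; ring
      _ ≤ _ := by
          push_cast
          gcongr
          exact one_le_two

end Time

/-! ### Distributions synthesized from wavelet coefficients -/

section Synthesis

variable {n : ℕ} (M : MeyerFunction)

/-- Weighted sums of the wavelet coefficients of a Schwartz function, with the weight that matches
the coefficients of the paraproduct flow. -/
theorem exists_tsum_coeff_mul_two_rpow_le (n : ℕ) : ∃ P : Seminorm ℝ 𝓢(Eucl n, ℂ), Continuous P ∧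
    ∀ ψ : 𝓢(Eucl n, ℂ),
      ∑' γ : Idx n, ‖∫ x, wav M γ x * ψ x‖ₑ * 2 ^ ((1 - (n : ℝ) / 2) * γ.2.1) ≤
        ENNReal.ofReal (P ψ) := by
  obtain ⟨P, hPc, hP⟩ := exists_tsum_coeff_mul_le M n 1
  have hfin : ∑' j : ℤ, (2 : ℝ≥0∞) ^ ((n : ℝ) * j / 2) *
      2 ^ (-(2 * ((1 : ℕ) : ℝ) * max (j : ℝ) 0)) * 2 ^ ((1 - (n : ℝ) / 2) * j) < ⊤ :=
    tsum_scale_weight_lt_top (by linarith) (by push_cast; linarith)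
  set C : ℝ≥0 := (∑' j : ℤ, (2 : ℝ≥0∞) ^ ((n : ℝ) * j / 2) *
      2 ^ (-(2 * ((1 : ℕ) : ℝ) * max (j : ℝ) 0)) * 2 ^ ((1 - (n : ℝ) / 2) * j)).toNNReal with hC
  refine ⟨C • P, hPc.const_smul C, fun ψ => ?_⟩
  refine (hP (fun j => 2 ^ ((1 - (n : ℝ) / 2) * j)) ψ).trans_eq ?_
  rw [smul_apply, NNReal.smul_def, smul_eq_mul, ENNReal.ofReal_mul C.coe_nonneg,
    ENNReal.ofReal_coe_nnreal, hC, ENNReal.coe_toNNReal hfin.ne]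

variable {M}

theorem tsum_enorm_coeff_mul_ne_top {d : Idx n → ℂ} {C : ℝ≥0}
    (hd : ∀ γ, ‖d γ‖ₑ ≤ C * 2 ^ ((1 - (n : ℝ) / 2) * γ.2.1)) (ψ : 𝓢(Eucl n, ℂ)) :
    ∑' γ : Idx n, ‖(∫ x, wav M γ x * ψ x) * d γ‖ₑ ≠ ⊤ := by
  obtain ⟨P, -, hP⟩ := exists_tsum_coeff_mul_two_rpow_le M n
  refine ne_top_of_le_ne_top (ENNReal.mul_ne_top (ENNReal.coe_ne_top (r := C))
    (ENNReal.ofReal_ne_top (r := P ψ))) ?_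
  refine le_trans ?_ (mul_le_mul' le_rfl (hP ψ))
  rw [← ENNReal.tsum_mul_left]
  refine ENNReal.tsum_le_tsum fun γ => ?_
  rw [enorm_mul, mul_left_comm]
  exact mul_le_mul' le_rfl (hd γ)

/-- A tempered distribution with prescribed action on the wavelets. -/
theorem exists_synthesis {d : Idx n → ℂ} {C : ℝ≥0}
    (hd : ∀ γ, ‖d γ‖ₑ ≤ C * 2 ^ ((1 - (n : ℝ) / 2) * γ.2.1)) :
    ∃ w : 𝓢'(Eucl n, ℂ), ∀ ψ : 𝓢(Eucl n, ℂ),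
      w ψ = ∑' γ : Idx n, (∫ x, wav M γ x * ψ x) * d γ := by
  obtain ⟨P, hPc, hP⟩ := exists_tsum_coeff_mul_two_rpow_le M n
  have hsum : ∀ ψ : 𝓢(Eucl n, ℂ), Summable fun γ : Idx n => (∫ x, wav M γ x * ψ x) * d γ :=
    fun ψ => summable_of_tsum_enorm_ne_top (tsum_enorm_coeff_mul_ne_top hd ψ)
  have hint : ∀ (γ : Idx n) (ψ : 𝓢(Eucl n, ℂ)), Integrable fun x => wav M γ x * ψ x := fun γ ψ =>
    (SchwartzMap.pairing (ContinuousLinearMap.mul ℂ ℂ) (wav M γ) ψ).integrable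
  set f : 𝓢(Eucl n, ℂ) →ₗ[ℂ] ℂ :=
    { toFun := fun ψ => ∑' γ : Idx n, (∫ x, wav M γ x * ψ x) * d γ
      map_add' := fun ψ φ => by
        rw [← (hsum ψ).tsum_add (hsum φ)]
        refine tsum_congr fun γ => ?_
        rw [← add_mul, ← integral_add (hint γ ψ) (hint γ φ)]
        simp only [add_apply, mul_add]
      map_smul' := fun c ψ => by
        rw [RingHom.id_apply, smul_eq_mul, ← tsum_mul_left]
        refine tsum_congr fun γ => ?_
        rw [← mul_assoc, ← integral_const_mul]
        simp only [smul_apply, smul_eq_mul, mul_left_comm] } with hf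
  have hbound : ∀ ψ, ‖f ψ‖ ≤ C * P ψ := by
    intro ψ
    have h : ‖f ψ‖ₑ ≤ C * ENNReal.ofReal (P ψ) := by
      refine enorm_tsum_le_tsum_enorm.trans (le_trans ?_ (mul_le_mul' le_rfl (hP ψ)))
      rw [← ENNReal.tsum_mul_left]
      refine ENNReal.tsum_le_tsum fun γ => ?_
      rw [enorm_mul, mul_left_comm]
      exact mul_le_mul' le_rfl (hd γ)
    rw [← ENNReal.ofReal_coe_nnreal, ← ENNReal.ofReal_mul C.coe_nonneg, ← ofReal_norm] at h
    exact (ENNReal.ofReal_le_ofReal_iff (mul_nonneg C.coe_nonneg (apply_nonneg P ψ))).mp h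
  have hcont : Continuous f := by
    refine continuous_of_continuousAt_zero f ?_
    rw [ContinuousAt, map_zero]
    refine squeeze_zero_norm hbound ?_
    have h : Filter.Tendsto (fun ψ => (C : ℝ) * P ψ) (nhds 0) (nhds (C * P 0)) :=
      (continuous_const.mul hPc).tendsto 0
    rwa [map_zero, mul_zero] at h
  exact ⟨ContinuousLinearMap.toPointwiseConvergenceCLM _ _ _ _ ⟨f, hcont⟩, fun ψ => rfl⟩

end Synthesis

/-! ### The Duhamel integral -/

section Duhamel

variable {n : ℕ} {M : MeyerFunction} {θ α β : ℝ} {u v : ℝ → 𝓢'(Eucl n, ℂ)}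

/-- The integrand `∫ F_s(x) A_{t-s}ᵗ ψ(x) dx` of the Duhamel formula, `F_s` being the paraproduct at
the time `s`. -/
def duhamelIntegrand (M : MeyerFunction) (ε : Dir n) (u v : ℝ → 𝓢'(Eucl n, ℂ)) (ρ : Eucl n → ℂ)
    (t s : ℝ) (ψ : 𝓢(Eucl n, ℂ)) : ℂ :=
  ∫ x, paraproduct M ε.1 (u s) (v s) x * transposeMultiplier (heatSymbol ρ (t - s)) ψ x

/-- The Duhamel integral. -/
def duhamel (M : MeyerFunction) (ε : Dir n) (u v : ℝ → 𝓢'(Eucl n, ℂ)) (ρ : Eucl n → ℂ)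
    (t : ℝ) (ψ : 𝓢(Eucl n, ℂ)) : ℂ :=
  ∫ s in Ioo 0 t, duhamelIntegrand M ε u v ρ t s ψ

/-- The wavelet expansion of the test function may be inserted into the Duhamel integrand: the
paraproduct is bounded and the transposed multiplier maps wavelets to integrable functions. -/
theorem hasSum_duhamelIntegrand (hα : 0 < α) (hβ : 0 < β) (hu : FlowBound M θ α β u)
    (hv : FlowBound M θ α β v) (ε : Dir n) {ρ : Eucl n → ℂ} (hρ : IsHomogeneousSymbol ρ)
    (hn : 0 < n) {t s : ℝ} (hs : 0 < s) (hst : s ≤ t) (ψ : 𝓢(Eucl n, ℂ)) :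
    (Integrable fun x => paraproduct M ε.1 (u s) (v s) x *
      transposeMultiplier (heatSymbol ρ (t - s)) ψ x) ∧
    HasSum (fun γ : Idx n => (∫ x, wav M γ x * ψ x) * duhamelIntegrand M ε u v ρ t s (wav M γ))
      (duhamelIntegrand M ε u v ρ t s ψ) := by
  obtain ⟨C, hC⟩ := exists_lintegral_transposeMultiplier_wavelet_le M hρ
  obtain ⟨B, hB⟩ := exists_tsum_enorm_paraTerm_le hα hβ hu hv ε
  obtain ⟨P, -, hP⟩ := exists_tsum_coeff_mul_two_rpow_le M n
  obtain ⟨jt, hjt⟩ := exists_mem_ring hs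
  have hτ : 0 ≤ t - s := sub_nonneg.mpr hst
  have hTm : ∀ φ : 𝓢(Eucl n, ℂ),
      Measurable fun x => transposeMultiplier (heatSymbol ρ (t - s)) φ x := fun φ =>
    measurable_transposeMultiplier hρ.continuous (t - s) φ
  have hFm := aestronglyMeasurable_paraproduct_space hα hβ hu hv ε hs
  have hFb : ∀ x, ‖paraproduct M ε.1 (u s) (v s) x‖ₑ ≤ B * 2 ^ (2 * jt : ℝ) := fun x =>
    (enorm_paraproduct_le _ _ _ _).trans (hB jt s hjt x)
  have key := hasSum_integral_of_tsum_lintegral (μ := (volume : Measure (Eucl n)))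
    (F := fun (γ : Idx n) x => (∫ y, wav M γ y * ψ y) * (paraproduct M ε.1 (u s) (v s) x *
      transposeMultiplier (heatSymbol ρ (t - s)) (wav M γ) x))
    (g := fun x => paraproduct M ε.1 (u s) (v s) x *
      transposeMultiplier (heatSymbol ρ (t - s)) ψ x) ?_ ?_ ?_
  · refine ⟨key.1, ?_⟩
    have h := key.2
    simp only [integral_const_mul] at h
    exact h
  · exact fun γ => (hFm.mul (hTm (wav M γ)).aestronglyMeasurable).const_mul _
  · refine ne_top_of_le_ne_top (ENNReal.mul_ne_top (ENNReal.mul_ne_top (ENNReal.mul_ne_top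
      (ENNReal.coe_ne_top (r := B)) (two_rpow_ne_top (2 * jt : ℝ))) (ENNReal.coe_ne_top (r := C)))
      (ENNReal.ofReal_ne_top (r := P ψ))) ?_
    refine le_trans ?_ (mul_le_mul' le_rfl (hP ψ))
    rw [← ENNReal.tsum_mul_left]
    refine ENNReal.tsum_le_tsum fun γ => ?_
    calc _ ≤ ∫⁻ x, (‖∫ y, wav M γ y * ψ y‖ₑ * (B * 2 ^ (2 * jt : ℝ))) *
          ‖transposeMultiplier (heatSymbol ρ (t - s)) (wav M γ) x‖ₑ := by
          refine lintegral_mono fun x => ?_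
          rw [enorm_mul, enorm_mul, ← mul_assoc]
          exact mul_le_mul' (mul_le_mul' le_rfl (hFb x)) le_rfl
      _ = (‖∫ y, wav M γ y * ψ y‖ₑ * (B * 2 ^ (2 * jt : ℝ))) *
          ∫⁻ x, ‖transposeMultiplier (heatSymbol ρ (t - s)) (wav M γ) x‖ₑ :=
          lintegral_const_mul _ (hTm (wav M γ)).enorm
      _ ≤ (‖∫ y, wav M γ y * ψ y‖ₑ * (B * 2 ^ (2 * jt : ℝ))) *
          (C * 2 ^ ((1 - (n : ℝ) / 2) * γ.2.1)) := mul_le_mul' le_rfl (hC γ (t - s) hτ)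
      _ = _ := by ring
  · refine Filter.Eventually.of_forall fun x => ?_
    have h := (hasSum_transposeMultiplier M hρ hn hτ ψ x).mul_left
      (paraproduct M ε.1 (u s) (v s) x)
    refine h.congr_fun fun γ => ?_
    ring

/-- Uniform bounds for the absolute Duhamel integrals against wavelets. -/
theorem exists_lintegral_duhamelIntegrand_le (hα : 0 < α) (hβ : 0 < β) (hu : FlowBound M θ α β u)
    (hv : FlowBound M θ α β v) (ε : Dir n) {ρ : Eucl n → ℂ} (hρ : IsHomogeneousSymbol ρ) :
    ∃ C : ℝ≥0, ∀ (γ : Idx n) (t : ℝ), 0 < t →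
      ∫⁻ s in Ioo 0 t, ‖duhamelIntegrand M ε u v ρ t s (wav M γ)‖ₑ ≤
        C * 2 ^ ((1 - (n : ℝ) / 2) * γ.2.1) := by
  obtain ⟨C, hC⟩ := exists_enorm_integral_paraproduct_le hα hβ hu hv ε hρ
  obtain ⟨D, hD⟩ := two_rpow_tsum_nat_decay_le (by linarith : 0 < 2 * α) hβ
  refine ⟨4 * C * D, fun γ t ht => ?_⟩
  obtain ⟨Jt, hJt⟩ := exists_mem_ring ht
  refine (lintegral_Ioo_le_tsum_ring hJt _).trans ?_
  set A : ℝ≥0∞ := C * 2 ^ ((1 - (n : ℝ) / 2) * γ.2.1) with hA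
  have hring : ∀ i : ℕ, ∫⁻ s in ring (Jt + i) ∩ Iio t, ‖duhamelIntegrand M ε u v ρ t s (wav M γ)‖ₑ ≤
      4 * A * 2 ^ decay (2 * α) β ((γ.2.1 : ℝ) - (Jt + i : ℤ)) := by
    intro i
    have h := lintegral_ring_le (Jt + i) t
      (g := fun s => ‖duhamelIntegrand M ε u v ρ t s (wav M γ)‖ₑ) (fun s hs =>
        hC γ (t - s) (sub_nonneg.mpr hs.2.le) (Jt + i) s hs.1)
    rw [← hA] at h
    have h2 := mul_le_mul' (le_refl ((2 : ℝ≥0∞) ^ (-(2 * ((Jt + i : ℤ) : ℝ))))) h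
    rw [← mul_assoc, ← two_rpow_add, neg_add_cancel, ENNReal.rpow_zero, one_mul] at h2
    refine h2.trans_eq ?_
    calc _ = (2 ^ (-(2 * ((Jt + i : ℤ) : ℝ))) * 2 ^ (2 * ((Jt + i : ℤ) : ℝ))) *
          (4 * A * 2 ^ decay (2 * α) β ((γ.2.1 : ℝ) - (Jt + i : ℤ))) := by ring
      _ = _ := by rw [← two_rpow_add, neg_add_cancel, ENNReal.rpow_zero, one_mul]
  calc _ ≤ ∑' i : ℕ, 4 * A * 2 ^ decay (2 * α) β ((γ.2.1 : ℝ) - (Jt + i : ℤ)) :=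
        ENNReal.tsum_le_tsum hring
    _ ≤ 4 * A * (D * 2 ^ (2 * α * min ((γ.2.1 : ℝ) - Jt) 0)) := by
        rw [ENNReal.tsum_mul_left]; exact mul_le_mul' le_rfl (hD γ.2.1 Jt)
    _ ≤ 4 * A * (D * 2 ^ (0 : ℝ)) := by
        gcongr
        · exact one_le_two
        · exact mul_nonpos_of_nonneg_of_nonpos (by positivity) (min_le_right _ _)
    _ = _ := by rw [hA, ENNReal.rpow_zero]; push_cast; ring

theorem aestronglyMeasurable_integral_mul_comp_sub {F T : ℝ × Eucl n → ℂ}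
    (hF : AEStronglyMeasurable F (spaceTime n)) (hT : StronglyMeasurable T) :
    AEStronglyMeasurable (fun z : ℝ × ℝ => ∫ x, F (z.2, x) * T (z.1 - z.2, x))
      ((volume.restrict (Ioi (0 : ℝ))).prod (volume.restrict (Ioi (0 : ℝ)))) := by
  have h1 : AEStronglyMeasurable (fun z : ℝ × ℝ × Eucl n => F z.2)
      ((volume.restrict (Ioi (0 : ℝ))).prod (spaceTime n)) := hF.comp_snd
  have h2 : AEStronglyMeasurable (fun z : (ℝ × ℝ) × Eucl n => F (z.1.2, z.2))
      (((volume.restrict (Ioi (0 : ℝ))).prod (volume.restrict (Ioi (0 : ℝ)))).prod volume) :=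
    h1.comp_measurePreserving (measurePreserving_prodAssoc _ _ _)
  have hg : Measurable fun z : (ℝ × ℝ) × Eucl n => (z.1.1 - z.1.2, z.2) := by fun_prop
  exact (h2.mul (hT.comp_measurable hg).aestronglyMeasurable).integral_prod_right'

theorem aestronglyMeasurable_integral_mul_const_sub {F T : ℝ × Eucl n → ℂ}
    (hF : AEStronglyMeasurable F (spaceTime n)) (hT : StronglyMeasurable T) (t : ℝ) :
    AEStronglyMeasurable (fun s => ∫ x, F (s, x) * T (t - s, x))
      (volume.restrict (Ioi (0 : ℝ))) := by
  have hg : Measurable fun z : ℝ × Eucl n => (t - z.1, z.2) := by fun_prop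
  exact (hF.mul (hT.comp_measurable hg).aestronglyMeasurable).integral_prod_right'

/-- Joint measurability of the Duhamel integrand in both times. -/
theorem aestronglyMeasurable_duhamelIntegrand (hα : 0 < α) (hβ : 0 < β)
    (hu : FlowBound M θ α β u) (hv : FlowBound M θ α β v) (ε : Dir n) {ρ : Eucl n → ℂ}
    (hρ : IsHomogeneousSymbol ρ) (ψ : 𝓢(Eucl n, ℂ)) :
    AEStronglyMeasurable (fun z : ℝ × ℝ => duhamelIntegrand M ε u v ρ z.1 z.2 ψ)
      ((volume.restrict (Ioi (0 : ℝ))).prod (volume.restrict (Ioi (0 : ℝ)))) := by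
  have h := aestronglyMeasurable_integral_mul_comp_sub
    (aestronglyMeasurable_paraproduct hα hβ hu hv ε)
    (stronglyMeasurable_transposeMultiplier hρ.continuous ψ)
  unfold duhamelIntegrand
  simpa only using h

theorem aestronglyMeasurable_duhamelIntegrand_right (hα : 0 < α) (hβ : 0 < β)
    (hu : FlowBound M θ α β u) (hv : FlowBound M θ α β v) (ε : Dir n) {ρ : Eucl n → ℂ}
    (hρ : IsHomogeneousSymbol ρ) (t : ℝ) (ψ : 𝓢(Eucl n, ℂ)) :
    AEStronglyMeasurable (fun s => duhamelIntegrand M ε u v ρ t s ψ)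
      (volume.restrict (Ioi (0 : ℝ))) := by
  have h := aestronglyMeasurable_integral_mul_const_sub
    (aestronglyMeasurable_paraproduct hα hβ hu hv ε)
    (stronglyMeasurable_transposeMultiplier hρ.continuous ψ) t
  unfold duhamelIntegrand
  simpa only using h

/-- The upper limit `t` of the Duhamel integral is moved into the integrand as an indicator function. -/
theorem aestronglyMeasurable_duhamel (hα : 0 < α) (hβ : 0 < β)
    (hu : FlowBound M θ α β u) (hv : FlowBound M θ α β v) (ε : Dir n) {ρ : Eucl n → ℂ}
    (hρ : IsHomogeneousSymbol ρ) (ψ : 𝓢(Eucl n, ℂ)) :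
    AEStronglyMeasurable (fun t => duhamel M ε u v ρ t ψ) (volume.restrict (Ioi (0 : ℝ))) := by
  have h := (aestronglyMeasurable_duhamelIntegrand hα hβ hu hv ε hρ ψ).indicator
    (measurableSet_lt measurable_snd measurable_fst : MeasurableSet {z : ℝ × ℝ | z.2 < z.1})
  refine h.integral_prod_right'.congr (Filter.Eventually.of_forall fun t => ?_)
  unfold duhamel
  have e : ∀ s, {z : ℝ × ℝ | z.2 < z.1}.indicator
      (fun z : ℝ × ℝ => duhamelIntegrand M ε u v ρ z.1 z.2 ψ) (t, s) =
      (Iio t).indicator (fun s => duhamelIntegrand M ε u v ρ t s ψ) s := fun s => rfl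
  simp only [e]
  rw [integral_indicator measurableSet_Iio, Measure.restrict_restrict measurableSet_Iio,
    inter_comm, Ioi_inter_Iio]

/-- The wavelet expansion of the test function may be inserted into the Duhamel integral. This yields
its absolute convergence and the wavelet expansion of the paraproduct flow at once. -/
theorem hasSum_duhamel (hα : 0 < α) (hβ : 0 < β) (hu : FlowBound M θ α β u)
    (hv : FlowBound M θ α β v) (ε : Dir n) {ρ : Eucl n → ℂ} (hρ : IsHomogeneousSymbol ρ)
    (hn : 0 < n) {t : ℝ} (ht : 0 < t) (ψ : 𝓢(Eucl n, ℂ)) :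
    IntegrableOn (fun s => duhamelIntegrand M ε u v ρ t s ψ) (Ioo 0 t) ∧
    HasSum (fun γ : Idx n => (∫ x, wav M γ x * ψ x) * duhamel M ε u v ρ t (wav M γ))
      (duhamel M ε u v ρ t ψ) := by
  obtain ⟨C, hC⟩ := exists_lintegral_duhamelIntegrand_le hα hβ hu hv ε hρ
  obtain ⟨P, -, hP⟩ := exists_tsum_coeff_mul_two_rpow_le M n
  have key := hasSum_integral_of_tsum_lintegral (μ := volume.restrict (Ioo 0 t))
    (F := fun (γ : Idx n) s => (∫ x, wav M γ x * ψ x) * duhamelIntegrand M ε u v ρ t s (wav M γ))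
    (g := fun s => duhamelIntegrand M ε u v ρ t s ψ) ?_ ?_ ?_
  · refine ⟨key.1, ?_⟩
    have h := key.2
    simp only [integral_const_mul] at h
    exact h
  · exact fun γ => ((aestronglyMeasurable_duhamelIntegrand_right hα hβ hu hv ε hρ t
      (wav M γ)).mono_measure (Measure.restrict_mono Ioo_subset_Ioi_self le_rfl)).const_mul _
  · refine ne_top_of_le_ne_top (ENNReal.mul_ne_top (ENNReal.coe_ne_top (r := C))
      (ENNReal.ofReal_ne_top (r := P ψ))) ?_
    refine le_trans ?_ (mul_le_mul' le_rfl (hP ψ))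
    rw [← ENNReal.tsum_mul_left]
    refine ENNReal.tsum_le_tsum fun γ => ?_
    simp only [enorm_mul]
    rw [lintegral_const_mul' _ _ enorm_ne_top, mul_left_comm]
    exact mul_le_mul' le_rfl (hC γ t ht)
  · filter_upwards [ae_restrict_mem measurableSet_Ioo] with s hs
    exact (hasSum_duhamelIntegrand hα hβ hu hv ε hρ hn hs.1 hs.2.le ψ).2

end Duhamel

/-! ### The paraproduct flow and its norm -/

section Flow

variable {n : ℕ} {M : MeyerFunction} {θ α β : ℝ} {u v w : ℝ → 𝓢'(Eucl n, ℂ)}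

/-- The Duhamel integrals define tempered distributions, obtained by synthesis from their wavelet
coefficients. For `t ≤ 0` the value `0` is a placeholder. -/
theorem exists_duhamel_flow (hα : 0 < α) (hβ : 0 < β) (hu : FlowBound M θ α β u)
    (hv : FlowBound M θ α β v) (ε : Dir n) {ρ : Eucl n → ℂ} (hρ : IsHomogeneousSymbol ρ)
    (hn : 0 < n) : ∃ w : ℝ → 𝓢'(Eucl n, ℂ), ∀ t : ℝ, 0 < t → ∀ ψ : 𝓢(Eucl n, ℂ),
      w t ψ = duhamel M ε u v ρ t ψ := by
  obtain ⟨C, hC⟩ := exists_lintegral_duhamelIntegrand_le hα hβ hu hv ε hρ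
  have h : ∀ t : ℝ, ∃ w : 𝓢'(Eucl n, ℂ), 0 < t → ∀ ψ : 𝓢(Eucl n, ℂ),
      w ψ = duhamel M ε u v ρ t ψ := by
    intro t
    by_cases ht : 0 < t
    · obtain ⟨w, hw⟩ := exists_synthesis (M := M) (d := fun γ => duhamel M ε u v ρ t (wav M γ))
        (fun γ => (enorm_integral_le_lintegral_enorm _).trans (hC γ t ht))
      exact ⟨w, fun _ ψ => (hw ψ).trans (hasSum_duhamel hα hβ hu hv ε hρ hn ht ψ).2.tsum_eq⟩
    · exact ⟨0, fun h => absurd h ht⟩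
  choose w hw using h
  exact ⟨w, hw⟩

theorem isParaproductFlow_of_eq_duhamel (hα : 0 < α) (hβ : 0 < β) (hu : FlowBound M θ α β u)
    (hv : FlowBound M θ α β v) (ε : Dir n) {ρ : Eucl n → ℂ} (hρ : IsHomogeneousSymbol ρ)
    (hn : 0 < n) (hw : ∀ t : ℝ, 0 < t → ∀ ψ : 𝓢(Eucl n, ℂ), w t ψ = duhamel M ε u v ρ t ψ) :
    IsParaproductFlow M (heatSymbol ρ) ε.1 u v w :=
  ⟨fun _ hs x => summable_paraTerm hα hβ hu hv ε hs x, fun t ht ψ =>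
    ⟨fun _ hs => (hasSum_duhamelIntegrand hα hβ hu hv ε hρ hn hs.1 hs.2.le ψ).1,
      (hasSum_duhamel hα hβ hu hv ε hρ hn ht ψ).1, hw t ht ψ⟩⟩

/-- The coefficients of the paraproduct flow at times in one ring, as a sum over the earlier rings `i` of
localized sums of the coefficients of `v`. The weights `W i` bound the heat integrals uniformly in the
ring, so that the supremum over `t` may be taken. -/
theorem exists_ringSeq_duhamel_le (hα : 0 < α) (hβ : 0 < β) (hu : FlowBound M θ α β u)
    (hv : FlowBound M θ α β v) (ε : Dir n) {ρ : Eucl n → ℂ} (hρ : IsHomogeneousSymbol ρ)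
    (hw : ∀ t : ℝ, 0 < t → ∀ ψ : 𝓢(Eucl n, ℂ), w t ψ = duhamel M ε u v ρ t ψ) (K : ℕ) :
    ∃ C : ℝ≥0, ∀ (j Jt : ℤ) (W : ℕ → ℝ≥0∞),
      (∀ (i : ℕ) (t : ℝ), t ∈ ring Jt → 2 ^ (2 * ((Jt + i : ℤ) : ℝ)) *
        ∫⁻ s in ring (Jt + i) ∩ Iio t, ENNReal.ofReal ((1 + 4 ^ j * (t - s)) ^ K)⁻¹ ≤ W i) →
      ∀ k, ringSeq M w j Jt k ≤ ∑' i : ℕ, C * 2 ^ (j : ℝ) * (2 ^ (-((Jt + i : ℤ) : ℝ)) *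
        2 ^ (α * min ((j : ℝ) - (Jt + i : ℤ)) 0) * W i) *
          ∑ j' ∈ Finset.Icc (j - 2) (j + 2), ∑' k', overlap j j' k k' *
            ringSeq M v j' (Jt + i) k' := by
  obtain ⟨C, hC⟩ := exists_enorm_integral_paraproduct_le_tsum hα hβ hu hv ε hρ K
  refine ⟨Fintype.card (Dir n) * C, fun j Jt W hW k => iSup₂_le fun t ht => ?_⟩
  have ht0 : 0 < t := lt_of_lt_of_le (by positivity) ht.1
  set b : ℕ → ℝ≥0∞ := fun i => ∑ j' ∈ Finset.Icc (j - 2) (j + 2), ∑' k', overlap j j' k k' *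
    ringSeq M v j' (Jt + i) k' with hb
  have hring : ∀ (ε' : Dir n) (i : ℕ), 2 ^ ((n : ℝ) * j / 2) * ∫⁻ s in ring (Jt + i) ∩ Iio t,
      ‖duhamelIntegrand M ε u v ρ t s (M.wavelet ε'.1 j k)‖ₑ ≤
      C * 2 ^ (j : ℝ) * (2 ^ (-((Jt + i : ℤ) : ℝ)) *
        2 ^ (α * min ((j : ℝ) - (Jt + i : ℤ)) 0) * W i) * b i := by
    intro ε' i
    set X : ℝ := ((Jt + i : ℤ) : ℝ) with hX
    set D : ℝ≥0∞ := C * (2 ^ X * 2 ^ (α * min ((j : ℝ) - X) 0) * 2 ^ (j : ℝ)) * b i with hD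
    have e : (2 : ℝ≥0∞) ^ X = 2 ^ (-X) * 2 ^ (2 * X) := by rw [← two_rpow_add]; congr 1; ring
    calc _ = ∫⁻ s in ring (Jt + i) ∩ Iio t, 2 ^ ((n : ℝ) * j / 2) *
          ‖duhamelIntegrand M ε u v ρ t s (M.wavelet ε'.1 j k)‖ₑ :=
          (lintegral_const_mul' _ _ (two_rpow_ne_top _)).symm
      _ ≤ ∫⁻ s in ring (Jt + i) ∩ Iio t,
          D * ENNReal.ofReal ((1 + 4 ^ j * (t - s)) ^ K)⁻¹ :=
          setLIntegral_mono' (measurableSet_Ico.inter measurableSet_Iio) fun s hs =>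
            hC ε' j k (t - s) (sub_nonneg.mpr hs.2.le) (Jt + i) s hs.1
      _ = D * ∫⁻ s in ring (Jt + i) ∩ Iio t,
          ENNReal.ofReal ((1 + 4 ^ j * (t - s)) ^ K)⁻¹ := by
          refine lintegral_const_mul _ ?_
          fun_prop
      _ = C * 2 ^ (j : ℝ) * (2 ^ (-X) * 2 ^ (α * min ((j : ℝ) - X) 0) * (2 ^ (2 * X) *
          ∫⁻ s in ring (Jt + i) ∩ Iio t,
          ENNReal.ofReal ((1 + 4 ^ j * (t - s)) ^ K)⁻¹)) * b i := by rw [hD, e]; ring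
      _ ≤ _ := mul_le_mul' (mul_le_mul' le_rfl (mul_le_mul' le_rfl (hW i t ht))) le_rfl
  have hdir : ∀ ε' : Dir n, 2 ^ ((n : ℝ) * j / 2) * ‖coeff M (w t) ε' j k‖ₑ ≤
      ∑' i : ℕ, C * 2 ^ (j : ℝ) * (2 ^ (-((Jt + i : ℤ) : ℝ)) *
        2 ^ (α * min ((j : ℝ) - (Jt + i : ℤ)) 0) * W i) * b i := by
    intro ε'
    unfold coeff
    rw [hw t ht0]
    calc _ ≤ 2 ^ ((n : ℝ) * j / 2) * ∑' i : ℕ, ∫⁻ s in ring (Jt + i) ∩ Iio t,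
          ‖duhamelIntegrand M ε u v ρ t s (M.wavelet ε'.1 j k)‖ₑ :=
          mul_le_mul' le_rfl ((enorm_integral_le_lintegral_enorm _).trans
            (lintegral_Ioo_le_tsum_ring ht _))
      _ ≤ _ := by
          rw [← ENNReal.tsum_mul_left]
          exact ENNReal.tsum_le_tsum (hring ε')
  unfold cellSeq
  rw [← ENNReal.tsum_mul_left]
  refine (ENNReal.tsum_le_tsum hdir).trans_eq ?_
  rw [tsum_fintype, Finset.sum_const, Finset.card_univ, nsmul_eq_mul, ← ENNReal.tsum_mul_left]
  refine tsum_congr fun i => ?_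
  push_cast
  ring

/-- Schur's test removes the interaction of neighbouring cubes. -/
theorem exists_seqNorm_sum_overlap_le (h0 : 0 < θ) (h1 : θ < 1) (hα : 0 < α) (hβ : 0 < β)
    (hv : FlowBound M θ α β v) : ∃ C : ℝ≥0, ∀ j jt : ℤ,
      seqNorm θ (fun k : Fin n → ℤ => ∑ j' ∈ Finset.Icc (j - 2) (j + 2), ∑' k', overlap j j' k k' *
        ringSeq M v j' jt k') ≤ C * 2 ^ (jt : ℝ) * 2 ^ decay α β ((j : ℝ) - jt) := by
  obtain ⟨A, hA⟩ := exists_tsum_overlap_le n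
  obtain ⟨B, hB⟩ := hv.bound
  set L : ℝ≥0 := ((2 : ℝ≥0∞) ^ (2 * (α + β))).toNNReal with hL
  have hLc : (L : ℝ≥0∞) = 2 ^ (2 * (α + β)) := ENNReal.coe_toNNReal (two_rpow_ne_top _)
  set D : ℝ≥0 := (A * (1 - θ)⁻¹ : ℝ).toNNReal with hD
  refine ⟨5 * (D * B * L), fun j jt => (seqNorm_sum_le _ _ _).trans ?_⟩
  calc _ ≤ ∑ j' ∈ Finset.Icc (j - 2) (j + 2),
        (D * B * L : ℝ≥0∞) * 2 ^ (jt : ℝ) * 2 ^ decay α β ((j : ℝ) - jt) := by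
        refine Finset.sum_le_sum fun j' hj' => ?_
        calc _ ≤ (D : ℝ≥0∞) * seqNorm θ (ringSeq M v j' jt) :=
              seqNorm_schur h0 h1 (overlap j j') (hA j j' hj').1 (hA j j' hj').2 _
          _ ≤ (D : ℝ≥0∞) * (B * 2 ^ (jt : ℝ) * (L * 2 ^ decay α β ((j : ℝ) - jt))) := by
              refine mul_le_mul' le_rfl ((hB j' jt).trans (mul_le_mul' le_rfl ?_))
              rw [hLc]
              exact two_rpow_decay_le hα.le hβ.le hj' jt
          _ = _ := by ring
    _ = _ := by
        rw [Finset.sum_const, Int.card_Icc, nsmul_eq_mul,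
          show j + 2 + 1 - (j - 2) = 5 by ring]
        push_cast
        norm_num
        ring

/-- The discrete norms of the paraproduct flow: at high frequencies, two more powers of `2^{j-jt}`
are gained from the heat flow. -/
theorem exists_seqNorm_ringSeq_duhamel_le (h0 : 0 < θ) (h1 : θ < 1) (hα : 0 < α) (hβ : 0 < β)
    (hu : FlowBound M θ α β u) (hv : FlowBound M θ α β v) (ε : Dir n) {ρ : Eucl n → ℂ}
    (hρ : IsHomogeneousSymbol ρ)
    (hw : ∀ t : ℝ, 0 < t → ∀ ψ : 𝓢(Eucl n, ℂ), w t ψ = duhamel M ε u v ρ t ψ) :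
    ∃ C : ℝ≥0, ∀ j jt : ℤ, seqNorm θ (ringSeq M w j jt) ≤
      C * 2 ^ (j : ℝ) * 2 ^ decay (2 * α) (β + 2) ((j : ℝ) - jt) := by
  obtain ⟨K, hK⟩ := exists_nat_ge (β + 2)
  have hK0 : (2 : ℝ) ≤ K := by linarith
  obtain ⟨A, hA⟩ := exists_ringSeq_duhamel_le hα hβ hu hv ε hρ hw K
  obtain ⟨B, hB⟩ := exists_seqNorm_sum_overlap_le h0 h1 hα hβ hv
  obtain ⟨D, hD⟩ := exists_ring_weights (by linarith : 0 < 2 * α) hβ (K := K)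
    (by exact_mod_cast hK0) (by linarith)
  refine ⟨A * B * D, fun j Jt => ?_⟩
  obtain ⟨W, hW, hWsum⟩ := hD j Jt
  refine (seqNorm_mono (hA j Jt W hW)).trans ((seqNorm_tsum_le _ _).trans ?_)
  calc _ ≤ ∑' i : ℕ, (A * B : ℝ≥0∞) * 2 ^ (j : ℝ) *
        (2 ^ decay (2 * α) β ((j : ℝ) - (Jt + i : ℤ)) * W i) := by
        refine ENNReal.tsum_le_tsum fun i => ?_
        rw [seqNorm_const_mul]
        set X : ℝ := ((Jt + i : ℤ) : ℝ) with hX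
        have e : (2 : ℝ≥0∞) ^ decay (2 * α) β ((j : ℝ) - X) = (2 ^ (-X) * 2 ^ X) *
            (2 ^ (α * min ((j : ℝ) - X) 0) * 2 ^ decay α β ((j : ℝ) - X)) := by
          rw [← two_rpow_add, ← two_rpow_add, neg_add_cancel, ENNReal.rpow_zero, one_mul]
          congr 1
          unfold decay
          ring
        refine (mul_le_mul' le_rfl (hB j (Jt + i))).trans_eq ?_
        rw [e]
        ring
    _ ≤ (A * B : ℝ≥0∞) * 2 ^ (j : ℝ) * (D * 2 ^ decay (2 * α) (β + 2) ((j : ℝ) - Jt)) := by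
        rw [ENNReal.tsum_mul_left]
        exact mul_le_mul' le_rfl hWsum
    _ = _ := by push_cast; ring

/-- In the discrete norms, the exponents `m'` and `m` become the rates `1 - 2m'` and `2m - 1` of decay
towards coarse and fine scales, which are positive for `m' < 1/2 < m`. -/
theorem FlowBound.of_memFlowSpace {p m' m : ℝ} {q : ℝ≥0∞} (hp : 1 < p) (hq : 1 ≤ q)
    (hu : MemFlowSpace M p q m' m u) :
    FlowBound M (1 - 1 / p) (1 - 2 * m') (2 * m - 1) u :=
  ⟨hu.measurable, hu.expansion, exists_seqNorm_ringSeq_le M hp hq hu.norm_lt_top⟩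

/-- The paraproduct flow has decay rates `2(1 - 2m')` and `2m + 1`, which beat the weights of the ring
norms by a factor of at most `2^{-|j - jt|}`; this suffices for every `q`. -/
theorem memFlowSpace_of_eq_duhamel {p m' m : ℝ} {q : ℝ≥0∞} (hp : 1 < p) (hq : 1 ≤ q)
    (hm' : m' < 1 / 2) (hm : 1 / 2 < m) (hu : MemFlowSpace M p q m' m u)
    (hv : MemFlowSpace M p q m' m v) (ε : Dir n) {ρ : Eucl n → ℂ} (hρ : IsHomogeneousSymbol ρ)
    (hn : 0 < n) (hw : ∀ t : ℝ, 0 < t → ∀ ψ : 𝓢(Eucl n, ℂ), w t ψ = duhamel M ε u v ρ t ψ) :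
    MemFlowSpace M p q m' m w := by
  have hα : 0 < 1 - 2 * m' := by linarith
  have hβ : 0 < 2 * m - 1 := by linarith
  have hu' := FlowBound.of_memFlowSpace hp hq hu
  have hv' := FlowBound.of_memFlowSpace hp hq hv
  have hp0 : 0 < 1 / p := by positivity
  have hp1 : 1 / p < 1 := by rw [div_lt_one (by linarith)]; exact hp
  refine ⟨fun ψ => ?_, fun t ht ψ => ?_, ?_⟩
  · refine (aestronglyMeasurable_duhamel hα hβ hu' hv' ε hρ ψ).congr ?_
    filter_upwards [ae_restrict_mem measurableSet_Ioi] with t ht using (hw t ht ψ).symm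
  · rw [hw t ht]
    refine (hasSum_duhamel hα hβ hu' hv' ε hρ hn ht ψ).2.congr_fun fun γ => ?_
    unfold coeff
    rw [hw t ht, mul_comm]
  · obtain ⟨C, hC⟩ := exists_seqNorm_ringSeq_duhamel_le (by linarith) (by linarith) hα hβ hu' hv' ε
      hρ hw
    -- the exponents are `-X` for `X ≥ 0` and `(2 - 2m') X ≤ X` for `X ≤ 0`
    refine flowNorm_lt_top M (C := C) hq one_pos fun j jt => ?_
    refine (ringNorm_le_seqNorm M hp _ w j jt).trans ?_
    refine (mul_le_mul' le_rfl (hC j jt)).trans ?_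
    set a : ℝ := if jt ≤ j then m else m' with ha
    set X : ℝ := (j : ℝ) - jt with hX
    calc _ = (C : ℝ≥0∞) * (2 ^ (-(j : ℝ)) * 2 ^ (j : ℝ)) *
          (2 ^ (2 * X * a) * 2 ^ decay (2 * (1 - 2 * m')) (2 * m - 1 + 2) X) := by ring
      _ = (C : ℝ≥0∞) * 2 ^ (2 * X * a + decay (2 * (1 - 2 * m')) (2 * m - 1 + 2) X) := by
          rw [← two_rpow_add, ← two_rpow_add, neg_add_cancel, ENNReal.rpow_zero, mul_one]
      _ ≤ _ := by
          refine mul_le_mul' le_rfl (ENNReal.rpow_le_rpow_of_exponent_le one_le_two ?_)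
          rcases le_or_gt jt j with h | h
          · have hX0 : 0 ≤ X := sub_nonneg.mpr (by exact_mod_cast h)
            rw [ha, if_pos h, decay, min_eq_right hX0, max_eq_left hX0, abs_of_nonneg hX0]
            linarith
          · have hX0 : X ≤ 0 := sub_nonpos.mpr (by exact_mod_cast h.le)
            rw [ha, if_neg h.not_ge, decay, min_eq_left hX0, max_eq_right hX0, abs_of_nonpos hX0]
            nlinarith

end Flow

/-! ### The two symbols -/

section Symbols

variable {n : ℕ}

theorem isHomogeneousSymbol_deriv (l : Fin n) :
    IsHomogeneousSymbol fun η : Eucl n => Complex.I * (2 * Real.pi * η l : ℝ) where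
  continuous := by fun_prop
  smooth η _ := by
    have h : ContDiff ℝ ∞ fun η : Eucl n => 2 * Real.pi * η l :=
      contDiff_const.mul (EuclideanSpace.proj (𝕜 := ℝ) l).contDiff
    exact (contDiff_const.mul (Complex.ofRealCLM.contDiff.comp h)).contDiffAt
  homogeneous c _ η := by
    simp only [PiLp.smul_apply, smul_eq_mul]
    push_cast
    ring

theorem symbolA_eq_heatSymbol (l : Fin n) :
    symbolA l = heatSymbol fun η : Eucl n => Complex.I * (2 * Real.pi * η l : ℝ) := rfl

/-- The symbol of `∂_l ∂_{l'} ∂_{l''} (-Δ)⁻¹`, with the value `0` at the origin. -/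
def thirdOrderSymbol (l l' l'' : Fin n) (η : Eucl n) : ℂ :=
  ((Complex.I * (2 * Real.pi * η l : ℝ)) * (Complex.I * (2 * Real.pi * η l' : ℝ)) *
    (Complex.I * (2 * Real.pi * η l'' : ℝ))) / ((2 * Real.pi * ‖η‖) ^ 2 : ℝ)

theorem symbolA₃_eq_heatSymbol (l l' l'' : Fin n) :
    symbolA₃ l l' l'' = heatSymbol (thirdOrderSymbol l l' l'') := by
  funext τ η
  unfold symbolA₃ heatSymbol thirdOrderSymbol
  rw [mul_div_assoc]

/-- The symbol is continuous at the origin since it grows linearly. -/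
theorem norm_thirdOrderSymbol_le (l l' l'' : Fin n) (η : Eucl n) :
    ‖thirdOrderSymbol l l' l'' η‖ ≤ 2 * Real.pi * ‖η‖ := by
  have hpi := Real.pi_pos
  have h : ∀ i : Fin n, ‖Complex.I * ((2 * Real.pi * η i : ℝ) : ℂ)‖ ≤ 2 * Real.pi * ‖η‖ := by
    intro i
    rw [norm_mul, Complex.norm_I, one_mul, Complex.norm_real, norm_mul,
      Real.norm_of_nonneg (by positivity)]
    exact mul_le_mul_of_nonneg_left (PiLp.norm_apply_le η i) (by positivity)
  unfold thirdOrderSymbol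
  rw [norm_div, norm_mul, norm_mul, Complex.norm_real, Real.norm_of_nonneg (by positivity)]
  refine div_le_of_le_mul₀ (by positivity) (by positivity) ?_
  calc _ ≤ (2 * Real.pi * ‖η‖) * (2 * Real.pi * ‖η‖) * (2 * Real.pi * ‖η‖) := by
        gcongr
        exacts [h l, h l', h l'']
    _ = _ := by ring

theorem isHomogeneousSymbol_thirdOrderSymbol (l l' l'' : Fin n) :
    IsHomogeneousSymbol (thirdOrderSymbol l l' l'') := by
  have hsmooth : ∀ η : Eucl n, η ≠ 0 → ContDiffAt ℝ ∞ (thirdOrderSymbol l l' l'') η := by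
    intro η hη
    have h0 : 2 * Real.pi * ‖η‖ ≠ 0 :=
      mul_ne_zero (mul_ne_zero two_ne_zero Real.pi_ne_zero) (norm_ne_zero_iff.mpr hη)
    have h1 : (((2 * Real.pi * ‖η‖) ^ 2 : ℝ) : ℂ) ≠ 0 :=
      Complex.ofReal_ne_zero.mpr (pow_ne_zero 2 h0)
    have h2 : ContDiffAt ℝ ∞ (fun η : Eucl n => (((2 * Real.pi * ‖η‖) ^ 2 : ℝ) : ℂ)) η :=
      Complex.ofRealCLM.contDiff.contDiffAt.comp η
        ((contDiffAt_const.mul (contDiffAt_norm ℝ hη)).pow 2)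
    have e : thirdOrderSymbol l l' l'' = fun η : Eucl n =>
        ((Complex.I * (2 * Real.pi * η l : ℝ)) * (Complex.I * (2 * Real.pi * η l' : ℝ)) *
          (Complex.I * (2 * Real.pi * η l'' : ℝ))) * (((2 * Real.pi * ‖η‖) ^ 2 : ℝ) : ℂ)⁻¹ :=
      funext fun η => div_eq_mul_inv _ _
    rw [e]
    exact ((((isHomogeneousSymbol_deriv l).smooth η hη).mul
      ((isHomogeneousSymbol_deriv l').smooth η hη)).mul
      ((isHomogeneousSymbol_deriv l'').smooth η hη)).mul (h2.inv h1)
  refine ⟨continuous_iff_continuousAt.mpr fun η => ?_, hsmooth, fun c hc η => ?_⟩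
  · rcases eq_or_ne η 0 with rfl | hη
    · have h0 : thirdOrderSymbol l l' l'' (0 : Eucl n) = 0 := by simp [thirdOrderSymbol]
      rw [ContinuousAt, h0]
      refine squeeze_zero_norm (norm_thirdOrderSymbol_le l l' l'') ?_
      have h : Continuous fun η : Eucl n => 2 * Real.pi * ‖η‖ := by fun_prop
      simpa using h.tendsto 0
    · exact (hsmooth η hη).continuousAt
  · have hc' : (c : ℂ) ≠ 0 := by exact_mod_cast hc.ne'
    unfold thirdOrderSymbol
    simp only [PiLp.smul_apply, smul_eq_mul, norm_smul, Real.norm_of_nonneg hc.le]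
    push_cast
    rcases eq_or_ne η 0 with rfl | hη
    · simp
    have hη' : ((‖η‖ : ℝ) : ℂ) ≠ 0 := by exact_mod_cast norm_ne_zero_iff.mpr hη
    have hpi : ((Real.pi : ℝ) : ℂ) ≠ 0 := by exact_mod_cast Real.pi_ne_zero
    field_simp

end Symbols

/-- The flows with a symbol `e^{-τ|ξ|²} ρ(ξ)`, for a homogeneous `ρ` of degree one. -/
theorem exists_isParaproductFlow_memFlowSpace {n : ℕ} {M : MeyerFunction} {ρ : Eucl n → ℂ}
    (hρ : IsHomogeneousSymbol ρ) (hn : 0 < n) (ε : Dir n) {p m' m : ℝ} {q : ℝ≥0∞} (hp : 1 < p)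
    (hq : 1 ≤ q) (hm' : m' < 1 / 2) (hm : 1 / 2 < m) {u v : ℝ → 𝓢'(Eucl n, ℂ)}
    (hu : MemFlowSpace M p q m' m u) (hv : MemFlowSpace M p q m' m v) :
    ∃ w : ℝ → 𝓢'(Eucl n, ℂ), IsParaproductFlow M (heatSymbol ρ) ε.1 u v w ∧
      MemFlowSpace M p q m' m w := by
  have hα : 0 < 1 - 2 * m' := by linarith
  have hβ : 0 < 2 * m - 1 := by linarith
  have hu' := FlowBound.of_memFlowSpace hp hq hu
  have hv' := FlowBound.of_memFlowSpace hp hq hv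
  obtain ⟨w, hw⟩ := exists_duhamel_flow hα hβ hu' hv' ε hρ hn
  exact ⟨w, isParaproductFlow_of_eq_duhamel hα hβ hu' hv' ε hρ hn hw,
    memFlowSpace_of_eq_duhamel hp hq hm' hm hu hv ε hρ hn hw⟩

end BesovLorentz

end

theorem theorem1p2 {n : ℕ} (M : BesovLorentz.MeyerFunction) (l l' l'' : Fin n)
    (ε : Fin n → Fin 2) (hε : ε ≠ 0)
    (p : ℝ) (hp : 1 < p) (q : ℝ≥0∞) (hq : 1 ≤ q)
    (m' m : ℝ) (hm'0 : 0 ≤ m') (hm' : m' < 1 / 2) (hm : 1 < m)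
    (u v : ℝ → 𝓢'(BesovLorentz.Eucl n, ℂ))
    (hu : BesovLorentz.MemFlowSpace M p q m' m u)
    (hv : BesovLorentz.MemFlowSpace M p q m' m v) :
    (∃ w : ℝ → 𝓢'(BesovLorentz.Eucl n, ℂ),
      BesovLorentz.IsParaproductFlow M (BesovLorentz.symbolA l) ε u v w ∧
      BesovLorentz.MemFlowSpace M p q m' m w) ∧
    (∃ w : ℝ → 𝓢'(BesovLorentz.Eucl n, ℂ),
      BesovLorentz.IsParaproductFlow M (BesovLorentz.symbolA₃ l l' l'') ε u v w ∧
      BesovLorentz.MemFlowSpace M p q m' m w) := by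
  have hn : 0 < n := l.pos
  have hm₀ : 1 / 2 < m := by linarith
  rw [BesovLorentz.symbolA_eq_heatSymbol, BesovLorentz.symbolA₃_eq_heatSymbol]
  exact ⟨BesovLorentz.exists_isParaproductFlow_memFlowSpace
      (BesovLorentz.isHomogeneousSymbol_deriv l) hn ⟨ε, hε⟩ hp hq hm' hm₀ hu hv,
    BesovLorentz.exists_isParaproductFlow_memFlowSpace
      (BesovLorentz.isHomogeneousSymbol_thirdOrderSymbol l l' l'') hn ⟨ε, hε⟩ hp hq hm' hm₀ hu hv⟩
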